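/- **Notation.** Let $n,i\ge 1$, let $F_n$ be the free group on $x_1,\dots,x_n$, $H=H_1(F_n,\mathbb Q)=\mathbb Q^n$ with basis $e_1,\dots,e_n$ and dual basis $e_1^*,\dots,e_n^*$, and let $\mathrm{IA}_n=\ker(\mathrm{Aut}(F_n)\to \mathrm{GL}(n,\mathbb Z))$. Put $U_i=\mathrm{Hom}(H,\bigwedge^{i+1}H)=\bigwedge^{i+1}H\otimes H^*$ and $U=U_1$. * For a group $G$, the Albanese homology $H^A_i(G,\mathbb Q)$ is the image of the map $H_i(G,\mathbb Q)\to H_i(G^{\mathrm{ab}},\mathbb Q)$ induced by abelianization. The Johnson homomorphism $\tau:\mathrm{IA}_n\to U$, $\tau(\varphi)(e_j)=[x_j^{-1}\varphi(x_j)]\in \Gamma_2F_n/\Gamma_3F_n\otimes\mathbb Q=\bigwedge^2H$, induces a linear map $\Lambda:H^A_i(\mathrm{IA}_n,\mathbb Q)\to H_i(U,\mathbb Q)\cong\bigwedge^iU$. "The $\mathrm{GL}(n,\mathbb Q)$-action on $H^A_i(\mathrm{IA}_n,\mathbb Q)$" is the one for which $\Lambda$ is $\mathrm{GL}(n,\mathbb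 Q)$-equivariant. * For partitions $\lambda,\mu$ let $T\subset H^{\otimes|\lambda|}\otimes (H^*)^{\otimes|\mu|}$ be the common kernel of all contractions of a factor $H$ with a factor $H^*$, and $V_{\lambda,\mu}=T\otimes_{\mathbb Q[\mathfrak S_{|\lambda|}\times\mathfrak S_{|\mu|}]}(S^\lambda\otimes S^\mu)$, where $S^\lambda$, $S^\mu$ are Specht modules. * Let $M_i=(H^{\otimes2}\otimes H^*)^{\otimes i}$, let $\phi:U\to H^{\otimes2}\otimes H^*$, $(a\wedge b)\otimes d\mapsto(a\otimes b-b\otimes a)\otimes d$, and let $\iota_i:\bigwedge^iU\to M_i$, $u_1\wedge\dots\wedge u_i\mapsto\sum_{\sigma\in\mathfrak S_i}\mathrm{sgn}(\sigma)\,\phi(u_{\sigma(1)})\otimes\dots\otimes\phi(u_{\sigma(i)})$. Define $$c_i:M_i\to U_i,\quad \bigotimes_{j=1}^i(a_j\otimes b_j\otimes d_j)\mapsto\Big(\prod_{j=2}^i d_j(b_{j-1})\Big)(a_1\wedge\dots\wedge a_i\wedge b_i)\otimes d_1,$$ $$c_i^{\mathrm{wheel}}:M_i\to\textstyle\bigwedge^iH,\quad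 \displaystyle\bigotimes_{j=1}^i(a_j\otimes b_j\otimes d_j)\mapsto\Big(d_1(b_i)\prod_{j=2}^i d_j(b_{j-1})\Big)a_1\wedge\dots\wedge a_i .$$ * Let $U_i^{\mathrm{wheel}}$ be the image of the embedding $\bigwedge^iH\to U_i$, $w\mapsto(v\mapsto v\wedge w)$, through which $c_i^{\mathrm{wheel}}$ is regarded as a map to $U_i^{\mathrm{wheel}}$. Let $U_i^{\mathrm{tree}}$ be the kernel of the contraction $U_i\to\bigwedge^iH$. * For $2\le k\le n$ let $h_{k,1}\in\mathrm{IA}_n$ be given by $x_j\mapsto x_kx_jx_k^{-1}$ for $j<k$ and $x_j\mapsto x_j$ for $j\ge k$. These elements commute. For $n\ge i+1$ let $\alpha_{(0,i)}\in H_i(\mathrm{IA}_n,\mathbb Q)$ be the abelian cycle of $(h_{2,1},\dots,h_{i+1,1})$, that is, the image of the fundamental class of the torus under the homomorphism $\mathbb Z^i\to\mathrm{IA}_n$ that sends the standard generators to these elements; its image in $H^A_i(\mathrm{IA}_n,\mathbb Q)$ is denoted by the same symbol. **Theorem.** Let $i\ge1$ and $n\ge i+1$. 1. The $\mathrm{GL}(n,\mathbb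 Q)$-action on $H^A_i(\mathrm{IA}_n,\mathbb Q)$ exists, and $H^A_i(\mathrm{IA}_n,\mathbb Q)$ contains a $\mathrm{GL}(n,\mathbb Q)$-subrepresentation isomorphic to $\mathrm{Hom}(H,\bigwedge^{i+1}H)$. 2. As $\mathrm{GL}(n,\mathbb Q)$-representations, $\mathrm{Hom}(H,\bigwedge^{i+1}H)\cong V_{1^i,0}\oplus V_{1^{i+1},1}$. More precisely, $U_i=U_i^{\mathrm{tree}}\oplus U_i^{\mathrm{wheel}}$ with $U_i^{\mathrm{tree}}\cong V_{1^{i+1},1}$ and $U_i^{\mathrm{wheel}}\cong V_{1^i,0}$. 3. Let $c_i^{\mathrm{tree}}:M_i\to U_i^{\mathrm{tree}}$ be $c_i$ followed by the projection of $U_i=U_i^{\mathrm{tree}}\oplus U_i^{\mathrm{wheel}}$ onto $U_i^{\mathrm{tree}}$. The map $$H^A_i(\mathrm{IA}_n,\mathbb Q)\to \mathrm{Hom}(H,\textstyle\bigwedge^{i+1}H),\qquad x\mapsto c_i^{\mathrm{wheel}}\iota_i\Lambda(x)+c_i^{\mathrm{tree}}\iota_i\Lambda(x)$$ is a surjective $\mathrm{GL}(n,\mathbb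 Q)$-homomorphism. It is detected by the abelian cycle: $c_i^{\mathrm{wheel}}\iota_i\Lambda(\alpha_{(0,i)})\ne0$, and $c_i^{\mathrm{tree}}\iota_i\Lambda(\alpha_{(0,i)})\neq0$ if $n\ge i+2$ (for $n=i+1$ one has $V_{1^{i+1},1}=0$). 4. In particular $H^A_i(\mathrm{IA}_n,\mathbb Q)\ne0$. -/

import Mathlib

open CategoryTheory
open scoped TensorProduct

namespace AlbIA

noncomputable section

/-- `H_i(G; ℚ)`, group homology with trivial rational coefficients. -/
abbrev GroupH (G : Type) [Group G] (i : ℕ) : ModuleCat ℚ := groupHomology (Rep.trivial ℚ G ℚ) i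

/-- The map `H_i(G; ℚ) → H_i(K; ℚ)` induced by a group homomorphism. -/
def groupHMap {G K : Type} [Group G] [Group K] (f : G →* K) (i : ℕ) : GroupH G i →ₗ[ℚ] GroupH K i :=
  (groupHomology.map (A := Rep.trivial ℚ G ℚ) (B := Rep.trivial ℚ K ℚ) f (𝟙 _) i).hom

/-- The Albanese homology `H^A_i(G; ℚ)`: the image of `H_i(G; ℚ) → H_i(G^ab; ℚ)`, the map induced by
the abelianization. -/
abbrev AlbaneseHomology (G : Type) [Group G] (i : ℕ) : Submodule ℚ (GroupH (Abelianization G) i) :=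
  LinearMap.range (groupHMap (Abelianization.of (G := G)) i)

section Wedge
variable {A W : Type} [Group A] [AddCommGroup W] [Module ℚ W]

/-- For a homomorphism `τ : A → W` to a rational vector space, the linear map on inhomogeneous
chains `[a₁|…|a_i] ↦ (1/i!) τ(a₁) ∧ … ∧ τ(a_i)`. -/
def wedgeChain (τ : A →* Multiplicative W) (i : ℕ) : ((Fin i → A) →₀ ℚ) →ₗ[ℚ] ⋀[ℚ]^i W :=
  Finsupp.linearCombination ℚ fun a =>
    ((i.factorial : ℚ)⁻¹) • exteriorPower.ιMulti ℚ i fun j => (τ (a j)).toAdd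

theorem ιMulti_contractNth_castSucc {i : ℕ} (j : Fin i) (t : Fin (i + 1) → W) :
    exteriorPower.ιMulti ℚ i (Fin.contractNth j.castSucc (· + ·) t) =
      exteriorPower.ιMulti ℚ i (fun m => t (j.castSucc.succAbove m)) +
        exteriorPower.ιMulti ℚ i (fun m => t (j.succ.succAbove m)) := by
  have h0 : Fin.contractNth j.castSucc (· + ·) t =
      Function.update (fun m => t (j.succ.succAbove m)) j (t j.succ + t j.castSucc) := by
    funext m
    rcases lt_trichotomy m j with h | h | h
    · rw [Fin.contractNth_apply_of_lt _ _ _ _ (by simpa using h), Function.update_of_ne h.ne,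
        Fin.succAbove_of_castSucc_lt _ _
          (by simp only [Fin.lt_def, Fin.val_castSucc, Fin.val_succ] at *; omega)]
    · subst h
      rw [Fin.contractNth_apply_of_eq _ _ _ _ (by simp), Function.update_self, add_comm]
    · rw [Fin.contractNth_apply_of_gt _ _ _ _ (by simpa using h), Function.update_of_ne h.ne',
        Fin.succAbove_of_le_castSucc _ _
          (by simp only [Fin.lt_def, Fin.le_def, Fin.val_castSucc, Fin.val_succ] at *; omega)]
  have h1 : (fun m => t (j.castSucc.succAbove m)) =
      Function.update (fun m => t (j.succ.succAbove m)) j (t j.succ) := by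
    funext m
    rcases lt_trichotomy m j with h | h | h
    · rw [Function.update_of_ne h.ne,
        Fin.succAbove_of_castSucc_lt _ _
          (by simp only [Fin.lt_def, Fin.val_castSucc, Fin.val_succ] at *; omega),
        Fin.succAbove_of_castSucc_lt _ _
          (by simp only [Fin.lt_def, Fin.val_castSucc, Fin.val_succ] at *; omega)]
    · subst h
      simp
    · rw [Function.update_of_ne h.ne',
        Fin.succAbove_of_le_castSucc _ _
          (by simp only [Fin.lt_def, Fin.le_def, Fin.val_castSucc, Fin.val_succ] at *; omega),
        Fin.succAbove_of_le_castSucc _ _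
          (by simp only [Fin.lt_def, Fin.le_def, Fin.val_castSucc, Fin.val_succ] at *; omega)]
  have h2 : (fun m => t (j.succ.succAbove m)) =
      Function.update (fun m => t (j.succ.succAbove m)) j (t j.castSucc) := by
    funext m
    by_cases h : m = j
    · subst h; simp
    · rw [Function.update_of_ne h]
  rw [h0, AlternatingMap.map_update_add, ← h1, ← h2]

theorem alternating_telescope {V : Type} [AddCommGroup V] [Module ℚ V] {i : ℕ}
    (w : Fin (i + 1) → V) :
    w 0 + (∑ j : Fin i, (-1 : ℚ) ^ ((j.castSucc : ℕ) + 1) • (w j.castSucc + w j.succ) +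
      (-1 : ℚ) ^ ((Fin.last i : ℕ) + 1) • w (Fin.last i)) = 0 := by
  have e1 := Fin.sum_univ_succ (fun k : Fin (i + 1) => (-1 : ℚ) ^ (k : ℕ) • w k)
  rw [Fin.sum_univ_castSucc] at e1
  simp only [smul_add, Finset.sum_add_distrib, pow_succ, mul_neg,
    mul_one, neg_smul, Finset.sum_neg_distrib, Fin.val_castSucc, Fin.val_succ, Fin.val_zero,
    pow_zero, one_smul, Fin.val_last] at e1 ⊢
  rw [← sub_eq_zero] at e1
  rw [← neg_eq_zero, ← e1]
  abel

theorem wedgeChain_comp_d (τ : A →* Multiplicative W) (i : ℕ) :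
    wedgeChain τ i ∘ₗ (groupHomology.inhomogeneousChains.d (Rep.trivial ℚ A ℚ) i).hom = 0 := by
  refine Finsupp.lhom_ext' fun a => LinearMap.ext_ring ?_
  have key : ∀ t : Fin (i + 1) → W, exteriorPower.ιMulti ℚ i (fun m => t m.succ) +
      ∑ j : Fin (i + 1), (-1 : ℚ) ^ ((j : ℕ) + 1) •
        exteriorPower.ιMulti ℚ i (Fin.contractNth j (· + ·) t) = 0 := by
    intro t
    have hl : Fin.contractNth (Fin.last i) (· + ·) t = fun m => t ((Fin.last i).succAbove m) := by
      funext m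
      rw [Fin.contractNth_apply_of_lt _ _ _ _ (by simp), Fin.succAbove_last]
    have hz : (fun m => t (Fin.succ m)) = fun m => t ((0 : Fin (i + 1)).succAbove m) := by
      funext m; simp
    rw [Fin.sum_univ_castSucc, hl, hz]
    simp only [ιMulti_contractNth_castSucc]
    exact alternating_telescope
      (fun k => exteriorPower.ιMulti ℚ i (fun m => t (k.succAbove m)))
  have hc : ∀ j : Fin (i + 1), (fun m => (τ (Fin.contractNth j (· * ·) a m)).toAdd) =
      Fin.contractNth j (· + ·) (fun m => (τ (a m)).toAdd) := by
    intro j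
    funext m
    unfold Fin.contractNth
    split_ifs <;> simp
  have := key fun m => (τ (a m)).toAdd
  have h2 := congrArg (fun x => ((i.factorial : ℚ)⁻¹) • x) this
  simp only [LinearMap.comp_apply, Finsupp.lsingle_apply, LinearMap.zero_apply]
  erw [groupHomology.inhomogeneousChains.d_single]
  simp only [smul_add, smul_zero, Finset.smul_sum] at h2
  rw [map_add, map_sum]
  simp only [map_smul, wedgeChain, Finsupp.linearCombination_single]
  simp only [hc]
  rw [← h2]
  congr 1
  · simp
  · refine Finset.sum_congr rfl fun j _ => ?_
    exact (congrArg _ (one_smul ℚ _)).trans (smul_comm _ _ _)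

/-- The map `H_i(A; ℚ) → ⋀^i W` induced by `wedgeChain τ i`; it is the composition of
`τ_* : H_i(A; ℚ) → H_i(W; ℚ)` with the standard isomorphism `H_i(W; ℚ) ≅ ⋀^i W`, which sends the
Pontryagin product `∑_σ sgn(σ) [w_{σ(1)}|…|w_{σ(i)}]` of `w₁, …, w_i` to `w₁ ∧ … ∧ w_i`. -/
def wedgeClass (τ : A →* Multiplicative W) (i : ℕ) : GroupH A i →ₗ[ℚ] ⋀[ℚ]^i W :=
  ((groupHomology.inhomogeneousChains (Rep.trivial ℚ A ℚ)).homologyι i ≫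
    (groupHomology.inhomogeneousChains (Rep.trivial ℚ A ℚ)).descOpcycles
      (A := ModuleCat.of ℚ (⋀[ℚ]^i W)) (ModuleCat.ofHom (wedgeChain τ i)) (i + 1)
      (ChainComplex.prev ℕ i) (by
        rw [groupHomology.inhomogeneousChains.d_def]
        exact ModuleCat.hom_ext (wedgeChain_comp_d τ i))).hom
end Wedge

section Cycle
variable {G : Type} [Group G] {i : ℕ}

/-- The image of the fundamental chain `∑_σ sgn(σ) [z_{σ(1)}|…|z_{σ(i)}]` of `ℤ^i` under
`z_k ↦ φ_k`. -/
def torusChain (φ : Fin i → G) : (Fin i → G) →₀ ℚ :=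
  ∑ σ : Equiv.Perm (Fin i), Finsupp.single (φ ∘ σ) ((Equiv.Perm.sign σ : ℤ) : ℚ)

theorem d_torusChain {m : ℕ} (φ : Fin (m + 1) → G) (hφ : ∀ a b, Commute (φ a) (φ b)) :
    (groupHomology.inhomogeneousChains.d (Rep.trivial ℚ G ℚ) m).hom (torusChain φ) = 0 := by
  have e0 : ∀ σ : Equiv.Perm (Fin (m + 1)),
      (groupHomology.inhomogeneousChains.d (Rep.trivial ℚ G ℚ) m).hom
        (Finsupp.single (φ ∘ σ) ((Equiv.Perm.sign σ : ℤ) : ℚ)) =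
      Finsupp.single (fun j => φ (σ j.succ)) ((Equiv.Perm.sign σ : ℤ) : ℚ) +
        ∑ j : Fin (m + 1), (-1 : ℚ) ^ ((j : ℕ) + 1) •
          Finsupp.single (Fin.contractNth j (· * ·) (φ ∘ σ)) ((Equiv.Perm.sign σ : ℤ) : ℚ) := by
    intro σ
    erw [groupHomology.inhomogeneousChains.d_single]
    rfl
  have hmid : ∀ j : Fin m, ∑ σ : Equiv.Perm (Fin (m + 1)),
      Finsupp.single (Fin.contractNth j.castSucc (· * ·) (φ ∘ σ))
        ((Equiv.Perm.sign σ : ℤ) : ℚ) = 0 := by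
    intro j
    have hne : j.castSucc ≠ j.succ := by simp [Fin.ext_iff]
    have h : ∑ σ : Equiv.Perm (Fin (m + 1)),
        Finsupp.single (Fin.contractNth j.castSucc (· * ·) (φ ∘ σ))
          ((Equiv.Perm.sign σ : ℤ) : ℚ) =
        -∑ σ : Equiv.Perm (Fin (m + 1)),
          Finsupp.single (Fin.contractNth j.castSucc (· * ·) (φ ∘ σ))
            ((Equiv.Perm.sign σ : ℤ) : ℚ) := by
      conv_lhs => rw [← Equiv.sum_comp (Equiv.mulRight (Equiv.swap j.castSucc j.succ))]
      rw [← Finset.sum_neg_distrib]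
      refine Finset.sum_congr rfl fun σ _ => ?_
      have : Fin.contractNth j.castSucc (· * ·)
          (φ ∘ ⇑(σ * Equiv.swap j.castSucc j.succ)) =
          Fin.contractNth j.castSucc (· * ·) (φ ∘ σ) := by
        funext k
        rcases lt_trichotomy k j with h | h | h
        · rw [Fin.contractNth_apply_of_lt _ _ _ _ (by simpa using h),
            Fin.contractNth_apply_of_lt _ _ _ _ (by simpa using h)]
          simp only [Function.comp_apply, Equiv.Perm.mul_apply]
          rw [Equiv.swap_apply_of_ne_of_ne] <;> simp only [ne_eq, Fin.ext_iff, Fin.lt_def, Fin.val_castSucc, Fin.val_succ] at * <;> omega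
        · subst h
          rw [Fin.contractNth_apply_of_eq _ _ _ _ (by simp),
            Fin.contractNth_apply_of_eq _ _ _ _ (by simp)]
          simp only [Function.comp_apply, Equiv.Perm.mul_apply, Equiv.swap_apply_left,
            Equiv.swap_apply_right]
          exact (hφ _ _).eq
        · rw [Fin.contractNth_apply_of_gt _ _ _ _ (by simpa using h),
            Fin.contractNth_apply_of_gt _ _ _ _ (by simpa using h)]
          simp only [Function.comp_apply, Equiv.Perm.mul_apply]
          rw [Equiv.swap_apply_of_ne_of_ne] <;> simp only [ne_eq, Fin.ext_iff, Fin.lt_def, Fin.val_castSucc, Fin.val_succ] at * <;> omega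
      rw [Equiv.coe_mulRight, this, Equiv.Perm.sign_mul, Equiv.Perm.sign_swap hne]
      simp
    exact self_eq_neg.mp h
  have hend : ∑ σ : Equiv.Perm (Fin (m + 1)),
      Finsupp.single (Fin.contractNth (Fin.last m) (· * ·) (φ ∘ σ))
        ((Equiv.Perm.sign σ : ℤ) : ℚ) =
      (-1 : ℚ) ^ m • ∑ σ : Equiv.Perm (Fin (m + 1)),
        Finsupp.single (fun j => φ (σ (Fin.succ j))) ((Equiv.Perm.sign σ : ℤ) : ℚ) := by
    conv_lhs => rw [← Equiv.sum_comp (Equiv.mulRight (finRotate (m + 1)))]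
    rw [Finset.smul_sum]
    refine Finset.sum_congr rfl fun σ _ => ?_
    have : Fin.contractNth (Fin.last m) (· * ·) (φ ∘ ⇑(σ * finRotate (m + 1))) =
        fun j => φ (σ (Fin.succ j)) := by
      funext k
      rw [Fin.contractNth_apply_of_lt _ _ _ _ (by simp)]
      simp only [Function.comp_apply, Equiv.Perm.mul_apply]
      congr 2
      simp
    rw [Equiv.coe_mulRight, this, Equiv.Perm.sign_mul, sign_finRotate]
    simp [mul_comm]
  rw [torusChain, map_sum]
  simp only [e0, Finset.sum_add_distrib]
  rw [Finset.sum_comm]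
  simp only [← Finset.smul_sum]
  rw [Fin.sum_univ_castSucc, hend]
  simp only [hmid, smul_zero, Finset.sum_const_zero, zero_add, Fin.val_last, smul_smul]
  rw [← pow_add, Odd.neg_one_pow ⟨m, by ring⟩]
  simp

/-- The abelian cycle `A(φ₁, …, φ_i)` of pairwise commuting elements: the image of the fundamental
class of the `i`-torus under the homomorphism `ℤ^i → G`, `z_k ↦ φ_k`. -/
def abelianCycle (φ : Fin i → G) (hφ : ∀ a b, Commute (φ a) (φ b)) : GroupH G i :=
  (groupHomology.π (Rep.trivial ℚ G ℚ) i).hom <|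
    groupHomology.cyclesMk (A := Rep.trivial ℚ G ℚ) i ((ComplexShape.down ℕ).next i) rfl
      (torusChain φ) (by
        cases i with
        | zero =>
          rw [HomologicalComplex.shape _ _ _ (by simp)]
          rfl
        | succ m =>
          rw [ChainComplex.next_nat_succ, groupHomology.inhomogeneousChains.d_def]
          exact d_torusChain φ hφ)
end Cycle

/-- `H = H_1(F_n; ℚ) = ℚ^n` with its standard basis `e_1, …, e_n`. -/
abbrev H (n : ℕ) : Type := Fin n → ℚ

/-- The free group of rank `n`. -/
abbrev F (n : ℕ) : Type := FreeGroup (Fin n)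

/-- `U_i = Hom(H, ⋀^{i+1} H)`; in particular `U = U_1`. -/
abbrev U (n i : ℕ) : Type := H n →ₗ[ℚ] ⋀[ℚ]^(i + 1) (H n)

/-- The action of `Aut(F_n)` on `F_n^ab ≅ ℤ^n`, that is, `Aut(F_n) → GL(n, ℤ)`. -/
def autAbelianization (n : ℕ) : MulAut (F n) →* MulAut (Abelianization (F n)) where
  toFun φ := MulEquiv.abelianizationCongr φ
  map_one' := by
    ext x
    induction x using QuotientGroup.induction_on
    rfl
  map_mul' φ ψ := by
    ext x
    induction x using QuotientGroup.induction_on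
    rfl

/-- The IA-automorphism group `IA_n`: the kernel of `Aut(F_n) → GL(n, ℤ)`. -/
def IA (n : ℕ) : Subgroup (MulAut (F n)) := (autAbelianization n).ker

theorem IA_apply {n : ℕ} (φ : IA n) (x : F n) :
    Abelianization.of (φ.1 x) = Abelianization.of x :=
  congrArg (fun ψ : MulAut (Abelianization (F n)) => ψ (Abelianization.of x))
    (MonoidHom.mem_ker.mp φ.2)

/-- The bilinear map `(a, b) ↦ a ∧ b`. -/
def wedge2 (n : ℕ) : H n →ₗ[ℚ] H n →ₗ[ℚ] ⋀[ℚ]^2 (H n) :=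
  LinearMap.mk₂ ℚ (fun a b => exteriorPower.ιMulti ℚ 2 ![a, b])
    (fun a a' b => (exteriorPower.ιMulti ℚ 2 (M := H n)).toMultilinearMap.cons_add ![b] a a')
    (fun c a b => (exteriorPower.ιMulti ℚ 2 (M := H n)).toMultilinearMap.cons_smul ![b] c a)
    (fun a b b' => by
      have h : ∀ x, ![a, x] = Function.update ![a, b] 1 x := fun x => by
        funext k; fin_cases k <;> simp
      rw [h (b + b'), h b', AlternatingMap.map_update_add, ← h b, ← h b'])
    (fun c a b => by
      have h : ∀ x, ![a, x] = Function.update ![a, b] 1 x := fun x => by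
        funext k; fin_cases k <;> simp
      rw [h (c • b), AlternatingMap.map_update_smul, ← h b])

theorem wedge2_self {n : ℕ} (a : H n) : wedge2 n a a = 0 :=
  (exteriorPower.ιMulti ℚ 2 (M := H n)).map_eq_zero_of_eq ![a, a] (i := 0) (j := 1) rfl (by simp)

/-- The rational free nilpotent group of class two on `H` (the Malcev completion of
`F_n / Γ₃ F_n`): pairs in `H × ⋀² H` with `(a, u)(b, v) = (a + b, u + v + ½ a ∧ b)`. -/
@[ext]
structure Nil2 (n : ℕ) where
  lin : H n
  quad : ⋀[ℚ]^2 (H n)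

namespace Nil2
variable {n : ℕ}

instance : Mul (Nil2 n) :=
  ⟨fun p q => ⟨p.lin + q.lin, p.quad + q.quad + (2⁻¹ : ℚ) • wedge2 n p.lin q.lin⟩⟩
instance : One (Nil2 n) := ⟨⟨0, 0⟩⟩
instance : Inv (Nil2 n) := ⟨fun p => ⟨-p.lin, -p.quad⟩⟩

@[simp] theorem mul_lin (p q : Nil2 n) : (p * q).lin = p.lin + q.lin := rfl
@[simp] theorem mul_quad (p q : Nil2 n) :
    (p * q).quad = p.quad + q.quad + (2⁻¹ : ℚ) • wedge2 n p.lin q.lin := rfl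
@[simp] theorem one_lin : (1 : Nil2 n).lin = 0 := rfl
@[simp] theorem one_quad : (1 : Nil2 n).quad = 0 := rfl
@[simp] theorem inv_lin (p : Nil2 n) : p⁻¹.lin = -p.lin := rfl
@[simp] theorem inv_quad (p : Nil2 n) : p⁻¹.quad = -p.quad := rfl

instance : Group (Nil2 n) :=
  Group.ofLeftAxioms
    (fun p q r => by
      ext1
      · simp [add_assoc]
      · simp only [mul_quad, mul_lin, map_add, LinearMap.add_apply, smul_add]
        abel)
    (fun p => by ext1 <;> simp)
    (fun p => by ext1 <;> simp [wedge2_self])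

theorem commutator_lin (p q : Nil2 n) : (p * q * p⁻¹ * q⁻¹).lin = 0 := by
  simp

/-- Commutators realise the identification of the second graded quotient with `⋀² H`. -/
theorem commutator_quad (p q : Nil2 n) : (p * q * p⁻¹ * q⁻¹).quad = wedge2 n p.lin q.lin := by
  have h : ∀ a b : H n, wedge2 n b a = -wedge2 n a b := fun a b => by
    have := wedge2_self (a + b)
    simp only [map_add, LinearMap.add_apply, wedge2_self, zero_add, add_zero] at this
    exact eq_neg_of_add_eq_zero_left this
  simp only [mul_quad, mul_lin, inv_lin, inv_quad, map_add, map_neg,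
    LinearMap.add_apply, LinearMap.neg_apply, wedge2_self]
  rw [h p.lin q.lin]
  module

end Nil2

/-- The homomorphism from `F_n` to its class-two Malcev completion, `x_j ↦ (e_j, 0)`. On `Γ₂ F_n` its
second component is the projection to `Γ₂/Γ₃ ⊗ ℚ = ⋀² H`, `[x, y] ↦ x ∧ y`. -/
def toNil2 (n : ℕ) : F n →* Nil2 n := FreeGroup.lift fun j => ⟨Pi.single j 1, 0⟩

/-- The linear part of `toNil2 n` is the class in `F_n^ab ⊗ ℚ = H`. -/
theorem toNil2_lin_eq {n : ℕ} {x y : F n} (h : Abelianization.of x = Abelianization.of y) :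
    (toNil2 n x).lin = (toNil2 n y).lin := by
  let f : F n →* Multiplicative (H n) :=
    { toFun := fun x => Multiplicative.ofAdd (toNil2 n x).lin
      map_one' := by simp
      map_mul' := fun x y => by simp }
  have h1 : ∀ z, f z = Abelianization.lift f (Abelianization.of z) := fun z => by simp
  have : f x = f y := by rw [h1, h1, h]
  exact this

/-- For `φ ∈ IA_n`, the map sending `x` to the class of `x⁻¹ φ(x)` in `Γ₂/Γ₃ ⊗ ℚ = ⋀² H`. -/
def johnsonHom {n : ℕ} (φ : IA n) : F n →* Multiplicative (⋀[ℚ]^2 (H n)) where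
  toFun x := Multiplicative.ofAdd (toNil2 n (x⁻¹ * φ.1 x)).quad
  map_one' := by simp
  map_mul' x y := by
    have hx := toNil2_lin_eq (IA_apply φ x)
    have hy := toNil2_lin_eq (IA_apply φ y)
    rw [← ofAdd_add]
    congr 1
    simp only [map_mul, map_inv, mul_inv_rev, Nil2.mul_quad, Nil2.mul_lin, Nil2.inv_lin,
      Nil2.inv_quad, hx, hy, map_add, map_neg, LinearMap.add_apply, LinearMap.neg_apply,
      wedge2_self]
    module

theorem johnsonHom_eq {n : ℕ} (φ : IA n) {x y : F n}
    (h : Abelianization.of x = Abelianization.of y) : johnsonHom φ x = johnsonHom φ y := by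
  have h1 : ∀ z, johnsonHom φ z = Abelianization.lift (johnsonHom φ) (Abelianization.of z) :=
    fun z => by simp
  rw [h1, h1, h]

theorem toNil2_inv_mul_lin {n : ℕ} (φ : IA n) (x : F n) : (toNil2 n (x⁻¹ * φ.1 x)).lin = 0 := by
  simp [toNil2_lin_eq (IA_apply φ x)]

/-- The (first) Johnson homomorphism `τ : IA_n → U = Hom(H, ⋀² H)`,
`τ(φ)(e_j) = [x_j⁻¹ φ(x_j)] ∈ Γ₂/Γ₃ ⊗ ℚ = ⋀² H`. -/
def johnson (n : ℕ) : IA n →* Multiplicative (U n 1) where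
  toFun φ := Multiplicative.ofAdd <|
    (Pi.basisFun ℚ (Fin n)).constr ℚ fun j => (johnsonHom φ (FreeGroup.of j)).toAdd
  map_one' := by
    refine congrArg Multiplicative.ofAdd ((Pi.basisFun ℚ (Fin n)).ext fun j => ?_)
    simp only [Module.Basis.constr_basis]
    change (toNil2 n ((FreeGroup.of j)⁻¹ * FreeGroup.of j)).quad = 0
    simp
  map_mul' φ ψ := by
    rw [← ofAdd_add]
    refine congrArg Multiplicative.ofAdd ((Pi.basisFun ℚ (Fin n)).ext fun j => ?_)
    simp only [LinearMap.add_apply, Module.Basis.constr_basis]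
    rw [← johnsonHom_eq φ (IA_apply ψ (FreeGroup.of j))]
    change (toNil2 n ((FreeGroup.of j)⁻¹ * φ.1 (ψ.1 (FreeGroup.of j)))).quad =
      (toNil2 n ((ψ.1 (FreeGroup.of j))⁻¹ * φ.1 (ψ.1 (FreeGroup.of j)))).quad +
      (toNil2 n ((FreeGroup.of j)⁻¹ * ψ.1 (FreeGroup.of j))).quad
    have := toNil2_inv_mul_lin ψ (FreeGroup.of j)
    rw [show (FreeGroup.of j)⁻¹ * φ.1 (ψ.1 (FreeGroup.of j)) =
      ((FreeGroup.of j)⁻¹ * ψ.1 (FreeGroup.of j)) *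
        ((ψ.1 (FreeGroup.of j))⁻¹ * φ.1 (ψ.1 (FreeGroup.of j))) by group, map_mul, Nil2.mul_quad,
      this]
    rw [map_zero, LinearMap.zero_apply, smul_zero, add_zero, add_comm]

/-- `x_j ↦ x_k x_j x_k⁻¹` for `j < k`, and `x_j ↦ x_j` for `j ≥ k`. -/
def conjBelow {n : ℕ} (k : Fin n) : F n →* F n := FreeGroup.lift fun j =>
  if j < k then FreeGroup.of k * FreeGroup.of j * (FreeGroup.of k)⁻¹ else FreeGroup.of j

/-- The inverse of `conjBelow k`. -/
def conjBelowInv {n : ℕ} (k : Fin n) : F n →* F n := FreeGroup.lift fun j =>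
  if j < k then (FreeGroup.of k)⁻¹ * FreeGroup.of j * FreeGroup.of k else FreeGroup.of j

/-- `conjBelow k` as an automorphism of `F_n`. -/
def hAut {n : ℕ} (k : Fin n) : MulAut (F n) :=
  MonoidHom.toMulEquiv (conjBelow k) (conjBelowInv k)
    (by
      ext j
      by_cases h : j < k <;> simp [conjBelow, conjBelowInv, h, mul_assoc])
    (by
      ext j
      by_cases h : j < k <;> simp [conjBelow, conjBelowInv, h, mul_assoc])

/-- The element `h_{k,1} = g_{k,1} g_{k,2} ⋯ g_{k,k-1}` of `IA_n`, where `g_{a,b}` sends `x_b` to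
`x_a x_b x_a⁻¹` and fixes the other generators. -/
def hIA {n : ℕ} (k : Fin n) : IA n := ⟨hAut k, by
  rw [IA, MonoidHom.mem_ker]
  ext x
  induction x using QuotientGroup.induction_on with
  | H x =>
    change Abelianization.of (conjBelow k x) = Abelianization.of x
    have : Abelianization.of.comp (conjBelow k) = Abelianization.of (G := F n) := by
      ext j
      by_cases hj : j < k <;> simp [conjBelow, hj]
    exact DFunLike.congr_fun this x⟩

theorem hIA_commute {n : ℕ} (k l : Fin n) : Commute (hIA k) (hIA l) := by
  wlog hkl : k < l generalizing k l
  · rcases eq_or_lt_of_le (not_lt.mp hkl) with rfl | h'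
    · exact Commute.refl _
    · exact (this l k h').symm
  have key : (conjBelow k).comp (conjBelow l) = (conjBelow l).comp (conjBelow k) := by
    ext j
    rcases lt_or_ge j k with hj | hj
    · simp [conjBelow, hj, hj.trans hkl, hkl, hkl.not_gt, mul_assoc]
    · rcases lt_or_ge j l with hj' | hj'
      · simp [conjBelow, hj.not_gt, hj', hkl.not_gt, mul_assoc]
      · simp [conjBelow, hj.not_gt, hj'.not_gt]
  apply Subtype.ext
  ext x
  exact DFunLike.congr_fun key x

/-- The standard representation of `GL(n, ℚ)` on `H`. -/
def stdRep (n : ℕ) : Representation ℚ (GL (Fin n) ℚ) (H n) where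
  toFun g := Matrix.toLin' (g : Matrix (Fin n) (Fin n) ℚ)
  map_one' := by rw [Units.val_one, Matrix.toLin'_one]; rfl
  map_mul' g k := by rw [Units.val_mul, Matrix.toLin'_mul]; rfl

/-- The `k`-th exterior power of a representation. -/
def extRep {G V : Type} [Group G] [AddCommGroup V] [Module ℚ V]
    (ρ : Representation ℚ G V) (k : ℕ) : Representation ℚ G (⋀[ℚ]^k V) where
  toFun g := exteriorPower.map k (ρ g)
  map_one' := by rw [map_one]; exact exteriorPower.map_id
  map_mul' g l := by rw [map_mul]; exact exteriorPower.map_comp (ρ l) (ρ g)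

/-- The representation of `GL(n, ℚ)` on `U_i = Hom(H, ⋀^{i+1} H)`. -/
def uRep (n i : ℕ) : Representation ℚ (GL (Fin n) ℚ) (U n i) :=
  (stdRep n).linHom (extRep (stdRep n) (i + 1))

/-! ### Contraction maps -/

/-- The dual basis vector `e_k^*`. -/
def dualE {n : ℕ} (k : Fin n) : Module.Dual ℚ (H n) := LinearMap.proj k

/-- `H^{⊗2} ⊗ H^*`. -/
abbrev HHd (n : ℕ) : Type := (⨂[ℚ]^2 (H n)) ⊗[ℚ] Module.Dual ℚ (H n)

/-- `M_i = (H^{⊗2} ⊗ H^*)^{⊗i}`. -/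
abbrev M (n i : ℕ) : Type := ⨂[ℚ]^i (HHd n)

/-- The embedding `φ : U → H^{⊗2} ⊗ H^*`, `(a ∧ b) ⊗ d^* ↦ (a ⊗ b - b ⊗ a) ⊗ d^*`. -/
def phi (n : ℕ) : U n 1 →ₗ[ℚ] HHd n :=
  ∑ k : Fin n, (TensorProduct.mk ℚ (⨂[ℚ]^2 (H n)) (Module.Dual ℚ (H n))).flip (dualE k) ∘ₗ
    exteriorPower.toTensorPower ℚ (H n) 2 ∘ₗ LinearMap.applyₗ (Pi.single k (1 : ℚ))

/-- The embedding `ι_i : ⋀^i U → M_i`,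
`u₁ ∧ … ∧ u_i ↦ ∑_σ sgn(σ) φ(u_{σ(1)}) ⊗ … ⊗ φ(u_{σ(i)})`. -/
def iota (n i : ℕ) : ⋀[ℚ]^i (U n 1) →ₗ[ℚ] M n i :=
  PiTensorProduct.map (fun _ => phi n) ∘ₗ exteriorPower.toTensorPower ℚ (U n 1) i

/-- The basis of `M_i` formed by the tensors `⨂_j (a_j ⊗ b_j ⊗ d_j^*)` of basis vectors. The index
`K` stands for `a_j = e_{(K j).1 0}`, `b_j = e_{(K j).1 1}`, `d_j^* = e_{(K j).2}^*`. -/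
def basisM (n i : ℕ) : Module.Basis (Fin i → (Fin 2 → Fin n) × Fin n) ℚ (M n i) :=
  Basis.piTensorProduct fun _ =>
    (Basis.piTensorProduct fun _ => Pi.basisFun ℚ (Fin n)).tensorProduct
      (Pi.basisFun ℚ (Fin n)).dualBasis

/-- The contraction `c_i : M_i → U_i`,
`⨂_j (a_j ⊗ b_j ⊗ d_j^*) ↦ (∏_{j=2}^i d_j^*(b_{j-1})) (a₁ ∧ … ∧ a_i ∧ b_i) ⊗ d₁^*`,
given on basis tensors. Indices are in `Fin i`, where the first one is `0` and the last one
is `0 - 1`. -/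
def cMap (n i : ℕ) [NeZero i] : M n i →ₗ[ℚ] U n i :=
  (basisM n i).constr ℚ fun K =>
    (∏ j ∈ Finset.univ.erase (0 : Fin i), if (K j).2 = (K (j - 1)).1 1 then (1 : ℚ) else 0) •
      (dualE (K 0).2).smulRight (exteriorPower.ιMulti ℚ (i + 1)
        (Fin.snoc (α := fun _ => H n) (fun j => Pi.single ((K j).1 0) 1)
          (Pi.single ((K (0 - 1)).1 1) 1)))

/-- The contraction `c_i^wheel : M_i → ⋀^i H`,
`⨂_j (a_j ⊗ b_j ⊗ d_j^*) ↦ (∏_{j=1}^i d_j^*(b_{j-1})) a₁ ∧ … ∧ a_i` with `b_0 = b_i`, given on basis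
tensors; subtraction in `Fin i` is cyclic. -/
def cWheel (n i : ℕ) [NeZero i] : M n i →ₗ[ℚ] ⋀[ℚ]^i (H n) :=
  (basisM n i).constr ℚ fun K =>
    (∏ j : Fin i, if (K j).2 = (K (j - 1)).1 1 then (1 : ℚ) else 0) •
      exteriorPower.ιMulti ℚ i fun j => (Pi.single ((K j).1 0) 1 : H n)

/-- The embedding `⋀^i H → U_i`, `w ↦ (v ↦ v ∧ w)`. -/
def wheelIncl (n i : ℕ) : ⋀[ℚ]^i (H n) →ₗ[ℚ] U n i :=
  ((exteriorPower.alternatingMapLinearEquiv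
      (R := ℚ) (M := H n) (N := ⋀[ℚ]^(i + 1) (H n)) (n := i)).toLinearMap ∘ₗ
    (exteriorPower.ιMulti ℚ (i + 1) (M := H n)).curryLeft).flip

/-- The interior product of `f ∈ H^*`,
`v_0 ∧ … ∧ v_i ↦ ∑_m (-1)^m f(v_m) v_0 ∧ … (omit v_m) … ∧ v_i`. -/
def interior {n : ℕ} (i : ℕ) (f : Module.Dual ℚ (H n)) : ⋀[ℚ]^(i + 1) (H n) →ₗ[ℚ] ⋀[ℚ]^i (H n) :=
  exteriorPower.alternatingMapLinearEquiv
    (AlternatingMap.alternatizeUncurryFin (f.smulRight (exteriorPower.ιMulti ℚ i (M := H n))))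

/-- The contraction `U_i = ⋀^{i+1} H ⊗ H^* → ⋀^i H`. -/
def traceMap (n i : ℕ) : U n i →ₗ[ℚ] ⋀[ℚ]^i (H n) :=
  ∑ k : Fin n, interior i (dualE k) ∘ₗ LinearMap.applyₗ (Pi.single k (1 : ℚ))

/-- `U_i^wheel`, the copy of `⋀^i H` in `U_i`. -/
def wheelPart (n i : ℕ) : Submodule ℚ (U n i) := LinearMap.range (wheelIncl n i)

/-- `U_i^tree`, the traceless part of `U_i`. -/
def treePart (n i : ℕ) : Submodule ℚ (U n i) := LinearMap.ker (traceMap n i)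

/-- The contraction `c_i^tree`: the composition of `c_i` with the projection of
`U_i = U_i^tree ⊕ U_i^wheel` onto `U_i^tree`. -/
def cTree (n i : ℕ) [NeZero i] (hc : IsCompl (treePart n i) (wheelPart n i)) :
    M n i →ₗ[ℚ] U n i :=
  LinearMap.comp (Submodule.projection (R := ℚ) (E := U n i) (treePart n i) (wheelPart n i) hc)
    (cMap n i)

/-! ### Irreducible algebraic representations -/
section Schur
variable (n : ℕ) (ι κ : Type)

/-- `H^{⊗ι} ⊗ (H^*)^{⊗κ}` for finite index sets `ι`, `κ`. -/
abbrev MixedTensor : Type := (⨂[ℚ] _ : ι, H n) ⊗[ℚ] (⨂[ℚ] _ : κ, Module.Dual ℚ (H n))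

/-- The action of `GL(n, ℚ)` on mixed tensors. -/
def mixedRep : Representation ℚ (GL (Fin n) ℚ) (MixedTensor n ι κ) where
  toFun g := TensorProduct.map (PiTensorProduct.map fun _ => stdRep n g)
    (PiTensorProduct.map fun _ => (stdRep n).dual g)
  map_one' := by
    simp only [map_one]
    rw [PiTensorProduct.map_one, PiTensorProduct.map_one]
    exact TensorProduct.map_one
  map_mul' g k := by
    simp only [map_mul]
    rw [PiTensorProduct.map_mul, PiTensorProduct.map_mul, TensorProduct.map_mul]

/-- The action of `𝔖_ι × 𝔖_κ` on mixed tensors by permutation of the tensor factors. -/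
def permRep : Representation ℚ (Equiv.Perm ι × Equiv.Perm κ) (MixedTensor n ι κ) where
  toFun p := TensorProduct.map
    (PiTensorProduct.reindex ℚ (fun _ : ι => H n) p.1).toLinearMap
    (PiTensorProduct.reindex ℚ (fun _ : κ => Module.Dual ℚ (H n)) p.2).toLinearMap
  map_one' := by
    ext; simp; rfl
  map_mul' p q := by
    ext; simp; rfl

variable {n ι κ} in
theorem mixed_ext {W : Type} [AddCommMonoid W] [Module ℚ W] {A B : MixedTensor n ι κ →ₗ[ℚ] W}
    (h : ∀ v f, A (PiTensorProduct.tprod ℚ v ⊗ₜ PiTensorProduct.tprod ℚ f) =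
      B (PiTensorProduct.tprod ℚ v ⊗ₜ PiTensorProduct.tprod ℚ f)) : A = B :=
  TensorProduct.ext <| PiTensorProduct.ext <| MultilinearMap.ext fun v =>
    PiTensorProduct.ext <| MultilinearMap.ext fun f => h v f

variable {n ι κ} in
theorem mixedRep_tprod (g : GL (Fin n) ℚ) (v : ι → H n) (f : κ → Module.Dual ℚ (H n)) :
    mixedRep n ι κ g (PiTensorProduct.tprod ℚ v ⊗ₜ PiTensorProduct.tprod ℚ f) =
      PiTensorProduct.tprod ℚ (fun a => stdRep n g (v a)) ⊗ₜ
        PiTensorProduct.tprod ℚ (fun b => (stdRep n).dual g (f b)) := by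
  simp [mixedRep]

variable {n ι κ} in
theorem permRep_tprod (p : Equiv.Perm ι × Equiv.Perm κ) (v : ι → H n)
    (f : κ → Module.Dual ℚ (H n)) :
    permRep n ι κ p (PiTensorProduct.tprod ℚ v ⊗ₜ PiTensorProduct.tprod ℚ f) =
      PiTensorProduct.tprod ℚ (fun a => v (p.1⁻¹ a)) ⊗ₜ
        PiTensorProduct.tprod ℚ (fun b => f (p.2⁻¹ b)) := by
  simp [permRep]

variable {n ι κ} in
theorem permRep_mixedRep (p : Equiv.Perm ι × Equiv.Perm κ) (g : GL (Fin n) ℚ) :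
    permRep n ι κ p ∘ₗ mixedRep n ι κ g = mixedRep n ι κ g ∘ₗ permRep n ι κ p := by
  refine mixed_ext fun v f => ?_
  simp only [LinearMap.comp_apply,
    permRep_tprod, mixedRep_tprod]

theorem restrict_update_self {α V : Type} [DecidableEq α] (v : α → V) (k : α) (x : V) :
    (fun a : {a // a ≠ k} => Function.update v k x a) = fun a : {a // a ≠ k} => v a :=
  funext fun a => Function.update_of_ne a.2 _ _

theorem restrict_update_of_ne {α V : Type} [DecidableEq α] (v : α → V) {k a : α} (h : a ≠ k)
    (x : V) : (fun b : {b // b ≠ k} => Function.update v a x b) =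
      Function.update (fun b : {b // b ≠ k} => v b) ⟨a, h⟩ x := by
  funext b
  by_cases hb : b = ⟨a, h⟩
  · subst hb; simp
  · rw [Function.update_of_ne hb, Function.update_of_ne (fun h' => hb (Subtype.ext h'))]

/-- The map `V^{⊗α} → V ⊗ V^{⊗(α ∖ k)}` that splits off the tensor factor `k`. -/
def pullOut (V : Type) [AddCommGroup V] [Module ℚ V] {α : Type} [DecidableEq α] (k : α) :
    (⨂[ℚ] _ : α, V) →ₗ[ℚ] V ⊗[ℚ] (⨂[ℚ] _ : {a // a ≠ k}, V) :=
  PiTensorProduct.lift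
    { toFun := fun v => v k ⊗ₜ[ℚ] PiTensorProduct.tprod ℚ fun a : {a // a ≠ k} => v a
      map_update_add' := fun {inst} v a x y => by
        rw [Subsingleton.elim inst ‹DecidableEq α›]
        by_cases h : a = k
        · subst h
          simp only [Function.update_self, restrict_update_self, TensorProduct.add_tmul]
        · simp only [Function.update_of_ne (Ne.symm h), restrict_update_of_ne v h,
            MultilinearMap.map_update_add, TensorProduct.tmul_add]
      map_update_smul' := fun {inst} v a c x => by
        rw [Subsingleton.elim inst ‹DecidableEq α›]
        by_cases h : a = k
        · subst h
          simp only [Function.update_self, restrict_update_self, TensorProduct.smul_tmul']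
        · simp only [Function.update_of_ne (Ne.symm h), restrict_update_of_ne v h,
            MultilinearMap.map_update_smul, TensorProduct.tmul_smul] }

variable [DecidableEq ι] [DecidableEq κ]

/-- The contraction `c_{k,l}` of the factor `k` of `H^{⊗ι}` with the factor `l` of `(H^*)^{⊗κ}`. -/
def contract (k : ι) (l : κ) :
    MixedTensor n ι κ →ₗ[ℚ] MixedTensor n {a // a ≠ k} {b // b ≠ l} :=
  (TensorProduct.lid ℚ _).toLinearMap ∘ₗ
    TensorProduct.map ((contractRight ℚ (H n))) LinearMap.id ∘ₗ
    (TensorProduct.tensorTensorTensorComm ℚ (H n) (⨂[ℚ] _ : {a // a ≠ k}, H n)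
      (Module.Dual ℚ (H n)) (⨂[ℚ] _ : {b // b ≠ l}, Module.Dual ℚ (H n))).toLinearMap ∘ₗ
    TensorProduct.map (pullOut (H n) k) (pullOut (Module.Dual ℚ (H n)) l)

/-- The traceless part `T ⊆ H^{⊗ι} ⊗ (H^*)^{⊗κ}`: the common kernel of all contractions. -/
def traceless : Submodule ℚ (MixedTensor n ι κ) :=
  ⨅ (k : ι) (l : κ), LinearMap.ker (contract n ι κ k l)

variable {n ι κ}

theorem contract_tprod (k : ι) (l : κ) (v : ι → H n) (f : κ → Module.Dual ℚ (H n)) :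
    contract n ι κ k l (PiTensorProduct.tprod ℚ v ⊗ₜ PiTensorProduct.tprod ℚ f) =
      f l (v k) • (PiTensorProduct.tprod ℚ (fun a : {a // a ≠ k} => v a) ⊗ₜ
        PiTensorProduct.tprod ℚ (fun b : {b // b ≠ l} => f b)) := by
  simp [contract, pullOut]

theorem mem_traceless {x : MixedTensor n ι κ} :
    x ∈ traceless n ι κ ↔ ∀ k l, contract n ι κ k l x = 0 := by
  simp [traceless]

theorem mixedRep_traceless (g : GL (Fin n) ℚ) :
    traceless n ι κ ≤ (traceless n ι κ).comap (mixedRep n ι κ g) := by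
  intro x hx
  rw [Submodule.mem_comap, mem_traceless]
  intro k l
  have h : contract n ι κ k l ∘ₗ mixedRep n ι κ g =
      mixedRep n {a // a ≠ k} {b // b ≠ l} g ∘ₗ contract n ι κ k l := by
    refine mixed_ext fun v f => ?_
    simp only [LinearMap.comp_apply,
      mixedRep_tprod, contract_tprod, map_smul]
    congr 1
    change f l (stdRep n g⁻¹ (stdRep n g (v k))) = f l (v k)
    rw [← Module.End.mul_apply, ← map_mul, inv_mul_cancel, map_one, Module.End.one_apply]
  have := LinearMap.congr_fun h x
  rw [LinearMap.comp_apply, LinearMap.comp_apply, mem_traceless.mp hx, map_zero] at this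
  exact this

theorem permRep_traceless (p : Equiv.Perm ι × Equiv.Perm κ) :
    traceless n ι κ ≤ (traceless n ι κ).comap (permRep n ι κ p) := by
  intro x hx
  rw [Submodule.mem_comap, mem_traceless]
  intro k l
  let ek : {a // a ≠ p.1⁻¹ k} ≃ {a // a ≠ k} :=
    p.1.subtypeEquiv fun a => by simp [Equiv.Perm.inv_def, Equiv.eq_symm_apply]
  let el : {b // b ≠ p.2⁻¹ l} ≃ {b // b ≠ l} :=
    p.2.subtypeEquiv fun a => by simp [Equiv.Perm.inv_def, Equiv.eq_symm_apply]
  have h : contract n ι κ k l ∘ₗ permRep n ι κ p =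
      TensorProduct.map
        (PiTensorProduct.reindex ℚ (fun _ => H n) ek).toLinearMap
        (PiTensorProduct.reindex ℚ (fun _ => Module.Dual ℚ (H n)) el).toLinearMap ∘ₗ
      contract n ι κ (p.1⁻¹ k) (p.2⁻¹ l) := by
    refine mixed_ext fun v f => ?_
    simp only [LinearMap.comp_apply,
      permRep_tprod, contract_tprod, map_smul, TensorProduct.map_tmul, LinearEquiv.coe_coe,
      PiTensorProduct.reindex_tprod]
    rfl
  have := LinearMap.congr_fun h x
  rw [LinearMap.comp_apply, LinearMap.comp_apply, mem_traceless.mp hx, map_zero] at this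
  exact this

variable (n ι κ)
instance : AddCommGroup (traceless n ι κ) := Module.addCommMonoidToAddCommGroup ℚ

/-- The action of `GL(n, ℚ)` on the traceless part. -/
def tracelessRep : Representation ℚ (GL (Fin n) ℚ) (traceless n ι κ) :=
  (mixedRep n ι κ).subrepresentation _ mixedRep_traceless

/-- The action of `𝔖_ι × 𝔖_κ` on the traceless part. -/
def tracelessPermRep : Representation ℚ (Equiv.Perm ι × Equiv.Perm κ) (traceless n ι κ) :=
  (permRep n ι κ).subrepresentation _ permRep_traceless

end Schur

section Specht

open scoped Classical in
/-- `a_μ`, the sum of the permutations of the boxes of `μ` that preserve the rows. (The boxes are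
not numbered: the symmetric group `𝔖_{|μ|}` is the group of permutations of the boxes.) -/
def rowSum (μ : YoungDiagram) : MonoidAlgebra ℚ (Equiv.Perm μ.cells) :=
  ∑ σ : Equiv.Perm μ.cells with ∀ c, (σ c).1.1 = c.1.1, MonoidAlgebra.single σ 1

open scoped Classical in
/-- `b_μ`, the signed sum of the permutations of the boxes of `μ` that preserve the columns. -/
def colSum (μ : YoungDiagram) : MonoidAlgebra ℚ (Equiv.Perm μ.cells) :=
  ∑ σ : Equiv.Perm μ.cells with ∀ c, (σ c).1.2 = c.1.2,
    MonoidAlgebra.single σ ((Equiv.Perm.sign σ : ℤ) : ℚ)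

/-- The Young symmetrizer `c_μ = b_μ a_μ`. -/
def youngSymmetrizer (μ : YoungDiagram) : MonoidAlgebra ℚ (Equiv.Perm μ.cells) :=
  colSum μ * rowSum μ

/-- The Specht module `S^μ = ℚ[𝔖] c_μ`. -/
def specht (μ : YoungDiagram) : Submodule ℚ (MonoidAlgebra ℚ (Equiv.Perm μ.cells)) :=
  (Ideal.span {youngSymmetrizer μ}).restrictScalars ℚ

/-- The left regular representation on the group algebra. -/
def groupAlgebraRep (G : Type) [Group G] : Representation ℚ G (MonoidAlgebra ℚ G) where
  toFun σ := LinearMap.mulLeft ℚ (MonoidAlgebra.single σ 1)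
  map_one' := by
    rw [← MonoidAlgebra.one_def]; exact LinearMap.mulLeft_one ℚ _
  map_mul' σ τ := by
    ext x; simp [MonoidAlgebra.single_mul_single, mul_assoc]

/-- The action of `𝔖_{|μ|}` on the Specht module by left multiplication. -/
def spechtRep (μ : YoungDiagram) : Representation ℚ (Equiv.Perm μ.cells) (specht μ) :=
  (groupAlgebraRep _).subrepresentation _ fun σ _ hx =>
    (Ideal.span {youngSymmetrizer μ}).mul_mem_left (MonoidAlgebra.single σ 1) hx

variable (n : ℕ) (lam mu : YoungDiagram)

/-- The representation `S^λ ⊗ S^μ` of `𝔖_{|λ|} × 𝔖_{|μ|}`. -/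
def spechtPair : Representation ℚ (Equiv.Perm lam.cells × Equiv.Perm mu.cells)
    (specht lam ⊗[ℚ] specht mu) :=
  Representation.tprod ((spechtRep lam).comp (MonoidHom.fst _ _))
    ((spechtRep mu).comp (MonoidHom.snd _ _))

/-- The diagonal action of `𝔖_{|λ|} × 𝔖_{|μ|}` on `T ⊗ (S^λ ⊗ S^μ)`; its coinvariants are the tensor
product of `T` and `S^λ ⊗ S^μ` over the group algebra. -/
def balancing : Representation ℚ (Equiv.Perm lam.cells × Equiv.Perm mu.cells)
    (traceless n lam.cells mu.cells ⊗[ℚ] (specht lam ⊗[ℚ] specht mu)) :=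
  (tracelessPermRep n lam.cells mu.cells).tprod (spechtPair lam mu)

/-- `V_{λ,μ} = T ⊗_{ℚ[𝔖_{|λ|} × 𝔖_{|μ|}]} (S^λ ⊗ S^μ)`, where `T` is the traceless part of
`H^{⊗|λ|} ⊗ (H^*)^{⊗|μ|}`. -/
abbrev V : Type :=
  Representation.Coinvariants (k := ℚ) (G := Equiv.Perm lam.cells × Equiv.Perm mu.cells)
    (V := traceless n lam.cells mu.cells ⊗[ℚ] (specht lam ⊗[ℚ] specht mu)) (balancing n lam mu)

/-- The action of `g ∈ GL(n, ℚ)` on `T ⊗ (S^λ ⊗ S^μ)` through the first factor. -/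
def vAct (g : GL (Fin n) ℚ) :
    Representation.IntertwiningMap (balancing n lam mu) (balancing n lam mu) :=
  (TensorProduct.map (tracelessRep n lam.cells mu.cells g)
      LinearMap.id).intertwiningMap_of_isIntertwiningMap (balancing n lam mu) (balancing n lam mu)
    (fun p x => by
      induction x using TensorProduct.induction_on with
      | zero => simp
      | add x y hx hy => simp only [map_add, hx, hy]
      | tmul t s =>
        simp only [balancing, Representation.tprod_apply, TensorProduct.map_tmul,
          LinearMap.id_apply]
        congr 1
        exact Subtype.ext (LinearMap.congr_fun (permRep_mixedRep p g) t.1).symm)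

/-- The representation of `GL(n, ℚ)` on `V_{λ,μ}`. -/
def vRep : Representation ℚ (GL (Fin n) ℚ) (V n lam mu) where
  toFun g := Representation.Coinvariants.map _ _ (vAct n lam mu g)
  map_one' := by
    refine Representation.Coinvariants.hom_ext (LinearMap.ext fun x => ?_)
    change Representation.Coinvariants.mk _ (TensorProduct.map (tracelessRep n _ _ 1) _ x) =
      Representation.Coinvariants.mk _ x
    rw [map_one, Module.End.one_eq_id, TensorProduct.map_id]
    rfl
  map_mul' g l := by
    refine Representation.Coinvariants.hom_ext (LinearMap.ext fun x => ?_)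
    change Representation.Coinvariants.mk _ (TensorProduct.map (tracelessRep n _ _ (g * l)) _ x) =
      Representation.Coinvariants.mk _ (TensorProduct.map (tracelessRep n _ _ g) LinearMap.id
        (TensorProduct.map (tracelessRep n _ _ l) LinearMap.id x))
    rw [map_mul]
    exact congrArg _ (LinearMap.congr_fun (TensorProduct.map_comp
      (tracelessRep n lam.cells mu.cells g) LinearMap.id
      (tracelessRep n lam.cells mu.cells l) LinearMap.id) x)

/-- The Young diagram of the partition `1^p`: one column with `p` boxes. -/
def column (p : ℕ) : YoungDiagram := YoungDiagram.ofRowLens (List.replicate p 1)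
  List.pairwise_replicate_of_refl.sortedGE
end Specht

/-! ### The abelian cycle and the comparison map -/

/-- The abelian cycle `α_{(0,i)} = A(h_{2,1}, h_{3,1}, …, h_{i+1,1}) ∈ H_i(IA_n; ℚ)`. (The generator
`x_{k}` has index `k - 1` in `Fin n`.) -/
def alphaCycle (n i : ℕ) (hn : i + 1 ≤ n) : GroupH (IA n) i :=
  abelianCycle (fun m : Fin i => hIA (⟨m + 1, by omega⟩ : Fin n)) fun _ _ => hIA_commute _ _

/-- The class of `α_{(0,i)}` in `H^A_i(IA_n; ℚ)`. -/
def alphaAlb (n i : ℕ) (hn : i + 1 ≤ n) : AlbaneseHomology (IA n) i :=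
  (groupHMap (Abelianization.of (G := IA n)) i).rangeRestrict (alphaCycle n i hn)

/-- The canonical map `H^A_i(IA_n; ℚ) ⊆ H_i(IA_n^ab; ℚ) → H_i(U; ℚ) ≅ ⋀^i U` induced by the Johnson
homomorphism. Composed with `H_i(IA_n; ℚ) → H^A_i(IA_n; ℚ)` it is `τ_*`. -/
def albToWedge (n i : ℕ) : AlbaneseHomology (IA n) i →ₗ[ℚ] ⋀[ℚ]^i (U n 1) :=
  wedgeClass (Abelianization.lift (A := Multiplicative (U n 1)) (johnson n)) i ∘ₗ (AlbaneseHomology (IA n) i).subtype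

/-- `ρ` is the `GL(n, ℚ)`-representation structure of `H^A_i(IA_n; ℚ)`: the one that it has as a
subspace of `⋀^i U` through the canonical map `albToWedge n i`. -/
def IsAlbaneseAction (n i : ℕ)
    (ρ : Representation ℚ (GL (Fin n) ℚ) (AlbaneseHomology (IA n) i)) : Prop :=
  ∀ g x, albToWedge n i (ρ g x) = extRep (uRep n 1) i g (albToWedge n i x)

end

end AlbIA

namespace AlbIA

/-! ### The map from group homology to exterior powers -/

section Homology
variable {A B W W' : Type} [Group A] [Group B] [AddCommGroup W] [Module ℚ W]
  [AddCommGroup W'] [Module ℚ W']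

/-! Everything is transported to `⋀^i U` along `Λ = albToWedge`. Let `W` be the image of `Λ`. It
equals the image of `τ_* : H_i(IA_n) → ⋀^i U`, because every Albanese class lifts to `H_i(IA_n)`.

`W` is stable under `GL(n, ℚ)` (`range_albToWedge_stable`). Conjugation by `Aut(F_n)` acts on
`IA_n`, and `τ` is equivariant for it (`johnson_conj`), so Nielsen transformations make `W` stable
under the integral elementary matrices. The action of `g` on `⋀^i U` is polynomial in `g` and `g⁻¹`,
and a polynomial curve that meets a subspace infinitely often stays in it. This passes first to all
rational transvections and then, through `n`-th powers, to all diagonal matrices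
(`stabilizer_eq_top`).

The contractions are equivariant and can be computed on the cycle. Both `c_i` and `c_i^wheel` are
instances of one iterated contraction `chain`, applied to `u_1, …, u_i` regarded as maps `H → H ⊗
H`. On `α_{(0,i)}` the operators are `e_l ↦ e_k ⊗ e_l - e_l ⊗ e_k` for `l < k` and `0` otherwise.
They never lower the index, and all surviving terms have the same sign. The results are `i! · e_2 ∧
… ∧ e_{i+1}` for the wheel (`cWheel_alpha`) and a nonzero multiple of `(e_1 ∧ … ∧ e_{i+1}) ⊗ e_1^*`
for `c_i` (`cMap_alpha`).

A stable subspace of `U_i` that contains `c_i^wheel + c_i^tree` of this cycle is all of `U_i`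
(`eq_top_of_wheel_add_tree_mem`). If `n ≥ i + 2`, the transvection `e_1 ↦ e_1 + e_b` with `b > i +
1` fixes the wheel component and changes the tree component by a traceless monomial, which generates
the tree part. Subtraction then leaves a wheel vector, which generates the wheel part. For `n = i +
1` the tree part is zero. Hence the comparison map is surjective.

A subrepresentation is obtained by splitting this surjection. The representations in question have a
basis in which `g` and its transpose act by transposed matrices. The standard scalar product in that
basis is positive definite over `ℚ` and has stable orthogonal complements
(`isCompl_of_hasTransposeBasis`). The action on `W` lifts to `H^A_i` through a linear splitting of
`Λ`, so injectivity of `Λ` is not required.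

Finally, the Specht module of a column is the sign line, so `V_{λ,μ}` is the antisymmetric part of
the traceless tensors. It is compared with `⋀^i H` and `U_i` through projection and
antisymmetrization (`exists_vRep_intertwiner`). -/

theorem wedgeClass_π (τ : A →* Multiplicative W) (i : ℕ)
    (z : groupHomology.cycles (Rep.trivial ℚ A ℚ) i) :
    wedgeClass τ i ((groupHomology.π (Rep.trivial ℚ A ℚ) i).hom z) =
      wedgeChain τ i ((groupHomology.iCycles (Rep.trivial ℚ A ℚ) i).hom z) := by
  have h : (groupHomology.inhomogeneousChains (Rep.trivial ℚ A ℚ)).homologyπ i ≫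
      (groupHomology.inhomogeneousChains (Rep.trivial ℚ A ℚ)).homologyι i ≫
      (groupHomology.inhomogeneousChains (Rep.trivial ℚ A ℚ)).descOpcycles
      (A := ModuleCat.of ℚ (⋀[ℚ]^i W)) (ModuleCat.ofHom (wedgeChain τ i)) (i + 1)
      (ChainComplex.prev ℕ i) (by
        rw [groupHomology.inhomogeneousChains.d_def]
        exact ModuleCat.hom_ext (wedgeChain_comp_d τ i)) =
      (groupHomology.inhomogeneousChains (Rep.trivial ℚ A ℚ)).iCycles i ≫
        ModuleCat.ofHom (wedgeChain τ i) := by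
    rw [HomologicalComplex.homology_π_ι_assoc, HomologicalComplex.p_descOpcycles]
  exact LinearMap.congr_fun (congrArg ModuleCat.Hom.hom h) z

/-- Both sides are evaluated on cycles, where the induced map sends the chain `[a₁|…|a_i]` to `[f
a₁|…|f a_i]`. -/
theorem wedgeClass_groupHMap (f : A →* B) (τ : B →* Multiplicative W) (i : ℕ) (x : GroupH A i) :
    wedgeClass τ i (groupHMap f i x) = wedgeClass (τ.comp f) i x := by
  induction x using groupHomology_induction_on with
  | h z =>
    have h1 := LinearMap.congr_fun (congrArg ModuleCat.Hom.hom
      (groupHomology.π_map (A := Rep.trivial ℚ A ℚ) (B := Rep.trivial ℚ B ℚ) f (𝟙 _) i)) z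
    have h2 := LinearMap.congr_fun (congrArg ModuleCat.Hom.hom
      (HomologicalComplex.cyclesMap_i (groupHomology.chainsMap (A := Rep.trivial ℚ A ℚ)
        (B := Rep.trivial ℚ B ℚ) f (𝟙 _)) i)) z
    have h3 : groupHMap f i ((groupHomology.π (Rep.trivial ℚ A ℚ) i).hom z) =
      (groupHomology.π (Rep.trivial ℚ B ℚ) i).hom ((groupHomology.cyclesMap
        (A := Rep.trivial ℚ A ℚ) (B := Rep.trivial ℚ B ℚ) f (𝟙 _) i).hom z) := h1
    have h4 : (groupHomology.iCycles (Rep.trivial ℚ B ℚ) i).hom ((groupHomology.cyclesMap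
        (A := Rep.trivial ℚ A ℚ) (B := Rep.trivial ℚ B ℚ) f (𝟙 _) i).hom z) =
        ((groupHomology.chainsMap (A := Rep.trivial ℚ A ℚ)
        (B := Rep.trivial ℚ B ℚ) f (𝟙 _)).f i).hom
          ((groupHomology.iCycles (Rep.trivial ℚ A ℚ) i).hom z) := h2
    have h5 : wedgeChain τ i ∘ₗ ((groupHomology.chainsMap (A := Rep.trivial ℚ A ℚ)
        (B := Rep.trivial ℚ B ℚ) f (𝟙 _)).f i).hom = wedgeChain (τ.comp f) i := by
      refine Finsupp.lhom_ext' fun a => LinearMap.ext_ring ?_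
      have h6 : ((groupHomology.chainsMap (A := Rep.trivial ℚ A ℚ)
        (B := Rep.trivial ℚ B ℚ) f (𝟙 _)).f i).hom (Finsupp.single a (1 : ℚ)) =
          Finsupp.single (f ∘ a) (1 : ℚ) :=
        groupHomology.chainsMap_f_single (A := Rep.trivial ℚ A ℚ) (B := Rep.trivial ℚ B ℚ)
          f (𝟙 _) i a (1 : ℚ)
      simp only [LinearMap.comp_apply, Finsupp.lsingle_apply]
      refine (congrArg (wedgeChain τ i) h6).trans ?_
      simp [wedgeChain]
    rw [h3, wedgeClass_π, wedgeClass_π, h4]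
    exact LinearMap.congr_fun h5 _

theorem wedgeClass_map (L : W →ₗ[ℚ] W') (τ : A →* Multiplicative W) (τ' : A →* Multiplicative W')
    (h : ∀ a, (τ' a).toAdd = L (τ a).toAdd) (i : ℕ) (x : GroupH A i) :
    wedgeClass τ' i x = exteriorPower.map i L (wedgeClass τ i x) := by
  induction x using groupHomology_induction_on with
  | h z =>
    have h5 : wedgeChain τ' i = exteriorPower.map i L ∘ₗ wedgeChain τ i := by
      refine Finsupp.lhom_ext' fun a => LinearMap.ext_ring ?_
      simp only [wedgeChain, LinearMap.comp_apply, Finsupp.lsingle_apply,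
        Finsupp.linearCombination_single, map_smul, exteriorPower.map_apply_ιMulti, h]
      rfl
    rw [wedgeClass_π, wedgeClass_π, h5]
    rfl

/-- Reordering `τ(φ_{σ(1)}) ∧ … ∧ τ(φ_{σ(i)})` costs `sgn(σ)`, which cancels the coefficient of the
torus chain. The `i!` equal terms are then normalized by the factor `1/i!` of `wedgeChain`. -/
theorem wedgeClass_abelianCycle (τ : A →* Multiplicative W) {i : ℕ} (φ : Fin i → A)
    (hφ : ∀ a b, Commute (φ a) (φ b)) :
    wedgeClass τ i (abelianCycle φ hφ) = exteriorPower.ιMulti ℚ i fun j => (τ (φ j)).toAdd := by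
  rw [abelianCycle, wedgeClass_π]
  refine (congrArg (wedgeChain τ i) (groupHomology.iCycles_mk (A := Rep.trivial ℚ A ℚ) rfl
    (torusChain φ) _)).trans ?_
  have h : ∀ σ : Equiv.Perm (Fin i), wedgeChain τ i
      (Finsupp.single (φ ∘ σ) ((Equiv.Perm.sign σ : ℤ) : ℚ)) =
      ((i.factorial : ℚ)⁻¹) • exteriorPower.ιMulti ℚ i fun j => (τ (φ j)).toAdd := by
    intro σ
    have h1 := (exteriorPower.ιMulti ℚ i).map_perm (fun j => (τ (φ j)).toAdd) σ
    have h2 : (fun j => (τ ((φ ∘ σ) j)).toAdd) = (fun j => (τ (φ j)).toAdd) ∘ σ := rfl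
    rw [wedgeChain, Finsupp.linearCombination_single, h2, h1]
    rcases Int.units_eq_one_or (Equiv.Perm.sign σ) with h | h <;> simp [h]
  rw [torusChain, map_sum, Finset.sum_congr rfl fun σ _ => h σ, Finset.sum_const,
    Finset.card_univ, Fintype.card_perm, Fintype.card_fin, ← Nat.cast_smul_eq_nsmul ℚ, smul_smul,
    mul_inv_cancel₀ (by exact_mod_cast i.factorial_ne_zero), one_smul]

theorem albToWedge_rangeRestrict (n i : ℕ) (x : GroupH (IA n) i) :
    albToWedge n i ((groupHMap (Abelianization.of (G := IA n)) i).rangeRestrict x) =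
      wedgeClass (W := U n 1) (johnson n) i x := by
  change wedgeClass _ i (groupHMap _ i x) = _
  rw [wedgeClass_groupHMap]
  congr 1

/-- This moves the study of the image from `H^A_i` to `H_i(IA_n)`, on which conjugation by
`Aut(F_n)` acts directly. -/
theorem range_albToWedge (n i : ℕ) :
    LinearMap.range (albToWedge n i) = LinearMap.range (wedgeClass (W := U n 1) (johnson n) i) := by
  ext y
  constructor
  · rintro ⟨x, hx⟩
    obtain ⟨z, hz⟩ := x.2
    refine ⟨z, ?_⟩
    rw [← albToWedge_rangeRestrict, ← hx]
    exact congrArg _ (Subtype.ext hz)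
  · rintro ⟨z, rfl⟩
    exact ⟨_, albToWedge_rangeRestrict n i z⟩

theorem albToWedge_alphaAlb (n i : ℕ) (hn : i + 1 ≤ n) :
    albToWedge n i (alphaAlb n i hn) = exteriorPower.ιMulti ℚ i (M := U n 1) fun m : Fin i =>
      (johnson n (hIA (⟨m + 1, by omega⟩ : Fin n))).toAdd := by
  rw [alphaAlb, albToWedge_rangeRestrict]
  have h2 : alphaCycle n i hn = abelianCycle (fun m : Fin i => hIA (⟨m + 1, by omega⟩ : Fin n))
    fun _ _ => hIA_commute _ _ := rfl
  have h := wedgeClass_abelianCycle (W := U n 1) (johnson n)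
    (fun m : Fin i => hIA (⟨m + 1, by omega⟩ : Fin n)) fun _ _ => hIA_commute _ _
  rw [h2]
  exact h

end Homology

end AlbIA

namespace AlbIA

/-! ### Conjugation and the Johnson homomorphism -/

section JohnsonConj
variable {n : ℕ}

theorem toNil2_of_lin (j : Fin n) : (toNil2 n (FreeGroup.of j)).lin = Pi.single j 1 := by
  simp [toNil2]

/-- Both sides are homomorphisms in `x` that agree on generators. The formula is needed for all `x`,
since an automorphism does not preserve the set of generators. -/
theorem johnson_apply_lin (φ : IA n) (x : F n) :
    (johnson n φ).toAdd (toNil2 n x).lin = (johnsonHom φ x).toAdd := by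
  let f : F n →* Multiplicative (⋀[ℚ]^2 (H n)) :=
    { toFun := fun x => Multiplicative.ofAdd ((johnson n φ).toAdd (toNil2 n x).lin)
      map_one' := by simp
      map_mul' := fun x y => by simp }
  have h : f = johnsonHom φ := by
    refine FreeGroup.ext_hom _ _ fun j => ?_
    change Multiplicative.ofAdd ((johnson n φ).toAdd (toNil2 n (FreeGroup.of j)).lin) = _
    rw [toNil2_of_lin]
    have := (Pi.basisFun ℚ (Fin n)).constr_basis ℚ
      (fun j => (johnsonHom φ (FreeGroup.of j)).toAdd) j
    rw [Pi.basisFun_apply] at this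
    exact congrArg Multiplicative.ofAdd this
  exact congrArg Multiplicative.toAdd (DFunLike.congr_fun h x)

theorem map_wedge2 (L : H n →ₗ[ℚ] H n) (a b : H n) :
    exteriorPower.map 2 L (wedge2 n a b) = wedge2 n (L a) (L b) := by
  refine (exteriorPower.map_apply_ιMulti L ![a, b]).trans (congrArg (exteriorPower.ιMulti ℚ 2) ?_)
  funext k
  fin_cases k <;> rfl

/-- The defect `quad(ψ x) - ⋀²L (quad x)` is additive in `x`, because the terms `½ a ∧ b` of the
product on both sides cancel. A homomorphism to an abelian group vanishes on the commutator
subgroup. -/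
theorem toNil2_quad_aut (ψ : MulAut (F n)) (L : H n →ₗ[ℚ] H n)
    (hL : ∀ x, (toNil2 n (ψ x)).lin = L (toNil2 n x).lin) (y : F n)
    (hy : Abelianization.of y = 1) :
    (toNil2 n (ψ y)).quad = exteriorPower.map 2 L (toNil2 n y).quad := by
  let f : F n →* Multiplicative (⋀[ℚ]^2 (H n)) :=
    { toFun := fun x => Multiplicative.ofAdd
        ((toNil2 n (ψ x)).quad - exteriorPower.map 2 L (toNil2 n x).quad)
      map_one' := by simp
      map_mul' := fun x y => by
        rw [← ofAdd_add]
        congr 1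
        simp only [map_mul, Nil2.mul_quad, hL, map_add, map_smul, map_wedge2]
        abel }
  have h1 : f y = Abelianization.lift f (Abelianization.of y) := by simp
  rw [hy, map_one] at h1
  exact sub_eq_zero.mp (congrArg Multiplicative.toAdd h1)

instance : (IA n).Normal := inferInstanceAs (autAbelianization n).ker.Normal

/-- The vector `L e_j` is the class of `ψ(x_j)`, and `ψ(x_j)⁻¹ · (ψφψ⁻¹)(ψ(x_j)) = ψ(x_j⁻¹ φ(x_j))`.
The element `x_j⁻¹ φ(x_j)` lies in the commutator subgroup, so `toNil2_quad_aut` applies. -/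
theorem johnson_conj (ψ : MulAut (F n)) (L : H n →ₗ[ℚ] H n)
    (hL : ∀ x, (toNil2 n (ψ x)).lin = L (toNil2 n x).lin) (φ : IA n) (v : H n) :
    (johnson n (MulAut.conjNormal ψ φ)).toAdd (L v) =
      exteriorPower.map 2 L ((johnson n φ).toAdd v) := by
  have h : (johnson n (MulAut.conjNormal ψ φ)).toAdd ∘ₗ L =
      exteriorPower.map 2 L ∘ₗ (johnson n φ).toAdd := by
    refine (Pi.basisFun ℚ (Fin n)).ext fun j => ?_
    rw [Pi.basisFun_apply, LinearMap.comp_apply, LinearMap.comp_apply, ← toNil2_of_lin, ← hL,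
      johnson_apply_lin, johnson_apply_lin]
    change (toNil2 n ((ψ (FreeGroup.of j))⁻¹ *
      ((MulAut.conjNormal ψ φ : IA n) : MulAut (F n)) (ψ (FreeGroup.of j)))).quad = _
    rw [MulAut.conjNormal_apply, MulAut.mul_apply, MulAut.mul_apply, MulAut.inv_apply_self,
      ← map_inv, ← map_mul, toNil2_quad_aut ψ L hL]
    · rfl
    · rw [map_mul, map_inv]
      exact (congrArg _ (IA_apply φ (FreeGroup.of j))).trans (inv_mul_cancel _)
  exact LinearMap.congr_fun h v

/-- The Nielsen transformation `x_b ↦ x_b x_a`. -/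
def nielsen {a b : Fin n} (h : a ≠ b) : MulAut (F n) :=
  MonoidHom.toMulEquiv
    (FreeGroup.lift fun j => if j = b then FreeGroup.of b * FreeGroup.of a else FreeGroup.of j)
    (FreeGroup.lift fun j => if j = b then FreeGroup.of b * (FreeGroup.of a)⁻¹ else FreeGroup.of j)
    (by ext j; by_cases hj : j = b <;> simp [hj, h])
    (by ext j; by_cases hj : j = b <;> simp [hj, h])

theorem transvection_mulVec (a b : Fin n) (t : ℚ) (v : H n) :
    Matrix.mulVec (Matrix.transvection a b t) v = v + t • v b • Pi.single a 1 := by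
  rw [Matrix.transvection, Matrix.add_mulVec, Matrix.one_mulVec, Matrix.single_mulVec]
  congr 1
  funext k
  by_cases hk : k = a <;> simp [hk]

theorem nielsen_lin {a b : Fin n} (h : a ≠ b) (x : F n) :
    (toNil2 n (nielsen h x)).lin =
      Matrix.toLin' (Matrix.transvection a b (1 : ℚ)) (toNil2 n x).lin := by
  let f : F n →* Multiplicative (H n) :=
    { toFun := fun x => Multiplicative.ofAdd (toNil2 n (nielsen h x)).lin
      map_one' := by simp
      map_mul' := fun x y => by simp }
  let f' : F n →* Multiplicative (H n) :=
    { toFun := fun x => Multiplicative.ofAdd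
        (Matrix.toLin' (Matrix.transvection a b (1 : ℚ)) (toNil2 n x).lin)
      map_one' := by simp
      map_mul' := fun x y => by simp [Matrix.mulVec_add] }
  have : f = f' := by
    refine FreeGroup.ext_hom _ _ fun j => ?_
    change Multiplicative.ofAdd (toNil2 n (nielsen h (FreeGroup.of j))).lin =
      Multiplicative.ofAdd
        (Matrix.toLin' (Matrix.transvection a b (1 : ℚ)) (toNil2 n (FreeGroup.of j)).lin)
    congr 1
    by_cases hj : j = b
    · subst hj
      rw [Matrix.toLin'_apply, transvection_mulVec]
      simp [nielsen, toNil2_of_lin]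
    · rw [Matrix.toLin'_apply, transvection_mulVec]
      simp [nielsen, toNil2_of_lin, hj, Ne.symm hj]
  exact congrArg Multiplicative.toAdd (DFunLike.congr_fun this x)

end JohnsonConj

/-! ### Polynomial functions and stabilizers of subspaces -/

section Poly
variable {E E' : Type} [AddCommGroup E] [Module ℚ E] [AddCommGroup E'] [Module ℚ E']

/-- Polynomial functions `ℚ → E`. -/
def IsPoly (f : ℚ → E) : Prop := ∃ c : ℕ →₀ E, ∀ t, f t = c.sum fun k e => t ^ k • e

namespace IsPoly

theorem add {f g : ℚ → E} (hf : IsPoly f) (hg : IsPoly g) : IsPoly fun t => f t + g t := by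
  obtain ⟨c, hc⟩ := hf
  obtain ⟨d, hd⟩ := hg
  refine ⟨c + d, fun t => ?_⟩
  rw [Finsupp.sum_add_index' (by simp) (by simp), ← hc, ← hd]

theorem monomial (k : ℕ) (e : E) : IsPoly fun t => t ^ k • e :=
  ⟨Finsupp.single k e, fun t => by simp⟩

theorem const (e : E) : IsPoly fun _ => e := by simpa using monomial 0 e

theorem linear (e : E) : IsPoly fun t => t • e := by simpa using monomial 1 e

theorem sum {ι : Type*} {f : ι → ℚ → E} (s : Finset ι) (h : ∀ a ∈ s, IsPoly (f a)) :
    IsPoly fun t => ∑ a ∈ s, f a t := by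
  classical
  induction s using Finset.induction_on with
  | empty => simpa using const (0 : E)
  | insert a s ha ih =>
    simp only [Finset.sum_insert ha]
    exact (h a (Finset.mem_insert_self _ _)).add
      (ih fun b hb => h b (Finset.mem_insert_of_mem hb))

theorem pow_smul {f : ℚ → E} (hf : IsPoly f) (m : ℕ) : IsPoly fun t => t ^ m • f t := by
  obtain ⟨c, hc⟩ := hf
  simp only [hc, Finsupp.sum, Finset.smul_sum, smul_smul, ← pow_add]
  exact sum _ fun k _ => monomial _ _

theorem apply {T : ℚ → E →ₗ[ℚ] E'} (hT : ∀ e, IsPoly fun t => T t e) {f : ℚ → E}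
    (hf : IsPoly f) : IsPoly fun t => T t (f t) := by
  obtain ⟨c, hc⟩ := hf
  simp only [hc, Finsupp.sum, map_sum, map_smul]
  exact sum _ fun k _ => (hT _).pow_smul k

/-- Expanding each argument in powers of `t` leaves a finite sum of monomials, the exponents adding
up. -/
theorem multilinear {ι : Type} [Fintype ι] (m : MultilinearMap ℚ (fun _ : ι => E) E')
    {f : ι → ℚ → E} (hf : ∀ a, IsPoly (f a)) : IsPoly fun t => m fun a => f a t := by
  classical
  choose c hc using hf
  simp only [hc, Finsupp.sum]
  simp only [MultilinearMap.map_sum_finset, MultilinearMap.map_smul_univ, Finset.prod_pow_eq_pow_sum]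
  exact sum _ fun r _ => monomial _ _

theorem exteriorPower_map {T : ℚ → E →ₗ[ℚ] E'} (hT : ∀ e, IsPoly fun t => T t e) (k : ℕ)
    (w : ⋀[ℚ]^k E) : IsPoly fun t => exteriorPower.map k (T t) w := by
  have hw : w ∈ Submodule.span ℚ (Set.range (exteriorPower.ιMulti ℚ k (M := E))) := by
    rw [exteriorPower.ιMulti_span]; trivial
  induction hw using Submodule.span_induction with
  | mem x h =>
    obtain ⟨v, rfl⟩ := h
    simp only [exteriorPower.map_apply_ιMulti]
    exact multilinear (exteriorPower.ιMulti ℚ k (M := E')).toMultilinearMap fun a => hT (v a)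
  | zero => simpa using const (0 : ⋀[ℚ]^k E')
  | add x y _ _ hx hy => simpa using hx.add hy
  | smul a x _ hx =>
    simp only [map_smul]
    exact apply (T := fun _ => a • LinearMap.id) (fun e => const _) hx

/-- `H` has a finite basis, so a family of maps is polynomial as soon as its values on basis vectors
are. -/
theorem hom {n : ℕ} {T : ℚ → H n →ₗ[ℚ] E} (hT : ∀ v, IsPoly fun t => T t v) : IsPoly T := by
  have h : T = fun t => ∑ k, LinearMap.smulRightₗ (dualE k) (T t (Pi.single k 1)) := by
    funext t
    refine (Pi.basisFun ℚ (Fin n)).ext fun j => ?_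
    simp [dualE, Pi.single_apply]
  rw [h]
  exact sum _ fun k _ => apply (T := fun _ => LinearMap.smulRightₗ (dualE k))
    (fun e => const _) (hT _)

/-- If `f t ∉ W`, some functional vanishes on `W` but not at `f t`. Composed with `f` it is a
one-variable polynomial with infinitely many roots, hence zero. -/
theorem mem_of_infinite {f : ℚ → E} (hf : IsPoly f) (W : Submodule ℚ E) {S : Set ℚ}
    (hS : S.Infinite) (h : ∀ t ∈ S, f t ∈ W) (t : ℚ) : f t ∈ W := by
  by_contra ht
  obtain ⟨ℓ, h1, h2⟩ := Submodule.exists_le_ker_of_notMem ht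
  obtain ⟨c, hc⟩ := hf
  let p : Polynomial ℚ := c.sum fun k e => Polynomial.C (ℓ e) * Polynomial.X ^ k
  have hp : ∀ t, p.eval t = ℓ (f t) := fun t => by
    simp only [p, hc, Finsupp.sum, Polynomial.eval_finsetSum, map_sum, map_smul]
    refine Finset.sum_congr rfl fun k _ => ?_
    rw [Polynomial.eval_mul, Polynomial.eval_C, Polynomial.eval_pow, Polynomial.eval_X, mul_comm,
      smul_eq_mul]
  have : p = 0 := Polynomial.eq_zero_of_infinite_isRoot p
    (hS.mono fun t ht => by
      change p.eval t = 0
      rw [hp]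
      exact h2 (h t ht))
  apply h1
  rw [← hp, this, Polynomial.eval_zero]

end IsPoly

/-- The elements of a group that map a given subspace of a representation into itself. -/
def stabilizerSubmonoid {G : Type} [Group G] (ρ : Representation ℚ G E) (W : Submodule ℚ E) :
    Submonoid G where
  carrier := {g | ∀ x ∈ W, ρ g x ∈ W}
  one_mem' := fun x hx => by simpa using hx
  mul_mem' := fun {g l} hg hl x hx => by
    rw [map_mul]
    exact hg _ (hl _ hx)

end Poly

/-! ### Density: from elementary matrices to `GL(n, ℚ)` -/

section Density
variable {n : ℕ}

/-- The map `u ↦ ⋀²A ∘ u ∘ B` on `U`. -/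
noncomputable def twist (A B : H n →ₗ[ℚ] H n) : U n 1 →ₗ[ℚ] U n 1 :=
  LinearMap.llcomp ℚ _ _ _ (exteriorPower.map 2 A) ∘ₗ LinearMap.lcomp ℚ _ B

theorem twist_apply (A B : H n →ₗ[ℚ] H n) (u : U n 1) :
    twist A B u = exteriorPower.map 2 A ∘ₗ u ∘ₗ B := rfl

theorem twist_isPoly {A B : ℚ → H n →ₗ[ℚ] H n} (hA : ∀ v, IsPoly fun t => A t v)
    (hB : ∀ v, IsPoly fun t => B t v) (u : U n 1) : IsPoly fun t => twist (A t) (B t) u :=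
  IsPoly.hom fun v => IsPoly.apply (T := fun t => exteriorPower.map 2 (A t))
    (fun w => IsPoly.exteriorPower_map hA 2 w)
    (IsPoly.apply (T := fun _ => u) (fun _ => IsPoly.const _) (hB v))

theorem exteriorPower_map_smul {E E' : Type} [AddCommGroup E] [Module ℚ E] [AddCommGroup E']
    [Module ℚ E'] (c : ℚ) (L : E →ₗ[ℚ] E') (i : ℕ) :
    exteriorPower.map i (c • L) = c ^ i • exteriorPower.map i L := by
  refine exteriorPower.linearMap_ext (AlternatingMap.ext fun v => ?_)
  simp only [LinearMap.compAlternatingMap_apply, exteriorPower.map_apply_ιMulti,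
    LinearMap.smul_apply]
  have := (exteriorPower.ιMulti ℚ i (M := E')).toMultilinearMap.map_smul_univ (fun _ => c)
    (fun a => L (v a))
  rw [Finset.prod_const, Finset.card_univ, Fintype.card_fin] at this
  exact this

theorem twist_smul (c : ℚ) (A B : H n →ₗ[ℚ] H n) : twist A (c • B) = c • twist A B := by
  ext u v; simp [twist_apply]

theorem twist_scalar (s : ℚ) :
    twist (s • LinearMap.id (M := H n)) LinearMap.id = (s ^ 2) • LinearMap.id := by
  refine LinearMap.ext fun u => LinearMap.ext fun v => ?_
  rw [twist_apply, exteriorPower_map_smul, exteriorPower.map_id]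
  rfl

/-- A transvection as an element of `GL(n, ℚ)`. -/
noncomputable def transvGL {a b : Fin n} (h : a ≠ b) (t : ℚ) : GL (Fin n) ℚ :=
  ⟨Matrix.transvection a b t, Matrix.transvection a b (-t),
    by rw [Matrix.transvection_mul_transvection_same _ _ h]; simp,
    by rw [Matrix.transvection_mul_transvection_same _ _ h]; simp⟩

theorem stdRep_transvGL {a b : Fin n} (h : a ≠ b) (t : ℚ) (v : H n) :
    stdRep n (transvGL h t) v = v + t • v b • Pi.single a 1 := transvection_mulVec a b t v

theorem transvGL_inv {a b : Fin n} (h : a ≠ b) (t : ℚ) :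
    (transvGL h t)⁻¹ = transvGL h (-t) := Units.ext rfl

theorem transvGL_pow {a b : Fin n} (h : a ≠ b) (m : ℕ) :
    transvGL h 1 ^ m = transvGL h m := by
  induction m with
  | zero => apply Units.ext; simp [transvGL]
  | succ m ih =>
    rw [pow_succ, ih]
    apply Units.ext
    simp [transvGL, Matrix.transvection_mul_transvection_same _ _ h]

/-- Invertible diagonal matrices. -/
noncomputable def diagGL (n : ℕ) : (Fin n → ℚˣ) →* GL (Fin n) ℚ :=
  (Units.map (Matrix.diagonalRingHom (Fin n) ℚ).toMonoidHom).comp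
    (MulEquiv.piUnits (M := fun _ : Fin n => ℚ)).symm.toMonoidHom

theorem diagGL_val (d : Fin n → ℚˣ) :
    ((diagGL n d : GL (Fin n) ℚ) : Matrix (Fin n) (Fin n) ℚ) =
      Matrix.diagonal fun k => (d k : ℚ) := rfl

theorem stdRep_diagGL (d : Fin n → ℚˣ) (v : H n) (k : Fin n) :
    stdRep n (diagGL n d) v k = d k * v k := by
  change Matrix.mulVec ((diagGL n d : GL (Fin n) ℚ) : Matrix (Fin n) (Fin n) ℚ) v k = _
  rw [diagGL_val, Matrix.mulVec_diagonal]

/-- This is the relation `h(s) = w(s) w(1)⁻¹` in `SL₂`, where `w(s) = x(s) y(-s⁻¹) x(s)` for the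
upper and lower transvections `x`, `y`. -/
theorem diagGL_eq_transvections {a b : Fin n} (h : a ≠ b) (s : ℚˣ) :
    diagGL n (Pi.mulSingle a s * Pi.mulSingle b s⁻¹) =
      transvGL h s * transvGL h.symm (-(s⁻¹ : ℚˣ)) * transvGL h s * (transvGL h (-1) *
        transvGL h.symm 1 * transvGL h (-1)) := by
  apply Units.ext
  apply Matrix.toLin'.injective
  refine LinearMap.ext fun v => ?_
  change stdRep n _ v = stdRep n _ v
  funext k
  rw [stdRep_diagGL]
  simp only [map_mul, Module.End.mul_apply, stdRep_transvGL]
  have hs : (s : ℚ) ≠ 0 := s.ne_zero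
  by_cases ha : k = a
  · subst ha
    simp [h, h.symm]
    field_simp
    ring
  · by_cases hb : k = b
    · subst hb
      simp [h, h.symm]
      field_simp
      ring
    · simp [ha, hb]

/-- Let `ρ g = Θ(g, g⁻¹)` be a representation of `GL(n, ℚ)` where `Θ` is polynomial, and homogeneous in
the second argument. A subspace that is stable under the elementary matrices with entries `1` is
stable under `GL(n, ℚ)`. -/
theorem stabilizer_eq_top {E : Type} [AddCommGroup E] [Module ℚ E] (hn : 2 ≤ n)
    (ρ : Representation ℚ (GL (Fin n) ℚ) E) (Θ : (H n →ₗ[ℚ] H n) → (H n →ₗ[ℚ] H n) → E → E)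
    (i k : ℕ) (hρ : ∀ g x, ρ g x = Θ (stdRep n g) (stdRep n g⁻¹) x)
    (hsmul : ∀ (c : ℚ) A B x, Θ A (c • B) x = c ^ i • Θ A B x)
    (hone : ∀ (s : ℚ) x, Θ (s • LinearMap.id) LinearMap.id x = s ^ k • x)
    (hpoly : ∀ A B : ℚ → H n →ₗ[ℚ] H n, (∀ v, IsPoly fun t => A t v) →
      (∀ v, IsPoly fun t => B t v) → ∀ x, IsPoly fun t => Θ (A t) (B t) x)
    (W : Submodule ℚ E)
    (hW : ∀ (a b : Fin n) (h : a ≠ b), transvGL h 1 ∈ stabilizerSubmonoid ρ W) :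
    stabilizerSubmonoid ρ W = ⊤ := by
  have htrans : ∀ (a b : Fin n) (h : a ≠ b) (t : ℚ),
      transvGL h t ∈ stabilizerSubmonoid ρ W := by
    intro a b h t x hx
    let A : ℚ → H n →ₗ[ℚ] H n := fun t =>
      LinearMap.id + t • (dualE b).smulRight (Pi.single a (1 : ℚ))
    have hA : ∀ t, stdRep n (transvGL h t) = A t := fun t => LinearMap.ext fun v => by
      rw [stdRep_transvGL]
      simp [A, dualE]
    have hp := hpoly A (fun t => A (-t))
      (fun v => (IsPoly.const v).add (IsPoly.linear _))
      (fun v => by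
        have := (IsPoly.const v).add
          (IsPoly.linear (-((dualE b).smulRight (Pi.single a (1 : ℚ)) v)))
        simpa [A] using this) x
    -- The transvections with natural entries are powers of the one with entry `1`; these are
    -- infinitely many parameters `t`.
    have hm := hp.mem_of_infinite W (Set.infinite_range_of_injective
      (Nat.cast_injective (R := ℚ))) (by
        rintro _ ⟨m, rfl⟩
        have h1 := Submonoid.pow_mem _ (hW a b h) m x hx
        rw [transvGL_pow, hρ, transvGL_inv, hA, hA] at h1
        exact h1) t
    rw [hρ, transvGL_inv, hA, hA]
    exact hm
  -- By homogeneity, `s · id` acts as the scalar `s^k s^{-i}`, so it preserves every subspace.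
  have hscalar : ∀ s : ℚˣ, diagGL n (fun _ => s) ∈ stabilizerSubmonoid ρ W := by
    intro s x hx
    have h1 : stdRep n (diagGL n fun _ => s) = (s : ℚ) • LinearMap.id :=
      LinearMap.ext fun v => funext fun k => by simp [stdRep_diagGL]
    have h2 : stdRep n (diagGL n fun _ => s)⁻¹ = ((s⁻¹ : ℚˣ) : ℚ) • LinearMap.id :=
      LinearMap.ext fun v => funext fun k => by
        rw [← map_inv]
        exact stdRep_diagGL _ v k
    rw [hρ, h1, h2, hsmul, hone]
    exact W.smul_mem _ (W.smul_mem _ hx)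
  have hpow : ∀ (a : Fin n) (s : ℚˣ),
      diagGL n (Pi.mulSingle a (s ^ n)) ∈ stabilizerSubmonoid ρ W := by
    intro a s
    -- The product over `b` has entry `s^n s⁻¹` at `a` and `s⁻¹` elsewhere; multiplying by the
    -- scalar matrix `s` clears the `s⁻¹`. Each factor has determinant one and is a product of
    -- transvections, which is why only `n`-th powers are reached here.
    have h1 : (Pi.mulSingle a (s ^ n) : Fin n → ℚˣ) = (fun _ => s) *
        ∏ b : Fin n, (Pi.mulSingle a s * Pi.mulSingle b s⁻¹) := by
      rw [Finset.prod_mul_distrib, Finset.prod_const, Finset.card_univ, Fintype.card_fin,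
        Finset.univ_prod_mulSingle (fun _ : Fin n => s⁻¹), Pi.mulSingle_pow]
      funext k
      simp
    refine Submonoid.mem_comap.mp ?_
    rw [h1]
    refine Submonoid.mul_mem _ (hscalar s) (Submonoid.prod_mem _ fun b _ => ?_)
    rw [Submonoid.mem_comap]
    by_cases hab : a = b
    · subst hab
      rw [← Pi.mulSingle_mul, mul_inv_cancel, Pi.mulSingle_one, map_one]
      exact Submonoid.one_mem _
    · rw [diagGL_eq_transvections hab]
      exact mul_mem (mul_mem (mul_mem (htrans _ _ _ _) (htrans _ _ _ _)) (htrans _ _ _ _))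
        (mul_mem (mul_mem (htrans _ _ _ _) (htrans _ _ _ _)) (htrans _ _ _ _))
  have hdiag : ∀ (a : Fin n) (s : ℚˣ),
      diagGL n (Pi.mulSingle a s) ∈ stabilizerSubmonoid ρ W := by
    intro a s x hx
    let P : H n →ₗ[ℚ] H n := (dualE a).smulRight (Pi.single a (1 : ℚ))
    let A : ℚ → H n →ₗ[ℚ] H n := fun t => (LinearMap.id - P) + t • P
    -- `B t` is `t` times the inverse of `A t`. Clearing this denominator makes the action of the
    -- diagonal matrix polynomial in `t`, up to the nonzero factor `t^{-i}`.
    let B : ℚ → H n →ₗ[ℚ] H n := fun t => P + t • (LinearMap.id - P)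
    have hA : ∀ t : ℚˣ, stdRep n (diagGL n (Pi.mulSingle a t)) = A t := fun t =>
      LinearMap.ext fun v => funext fun k => by
        rw [stdRep_diagGL]
        by_cases hk : k = a
        · subst hk; simp [A, P, dualE]
        · simp [A, P, dualE, hk]
    have hB : ∀ t : ℚˣ, stdRep n (diagGL n (Pi.mulSingle a t))⁻¹ = ((t⁻¹ : ℚˣ) : ℚ) • B t :=
      fun t => LinearMap.ext fun v => funext fun k => by
        rw [← map_inv, ← Pi.mulSingle_inv, stdRep_diagGL]
        by_cases hk : k = a
        · subst hk; simp [B, P, dualE]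
        · simp [B, P, dualE, hk]
    have hp := hpoly A B
      (fun v => (IsPoly.const (((LinearMap.id : H n →ₗ[ℚ] H n) - P) v)).add (IsPoly.linear (P v)))
      (fun v => (IsPoly.const (P v)).add (IsPoly.linear (((LinearMap.id : H n →ₗ[ℚ] H n) - P) v))) x
    have hiff : ∀ t : ℚˣ, ρ (diagGL n (Pi.mulSingle a t)) x =
        ((t⁻¹ : ℚˣ) : ℚ) ^ i • Θ (A t) (B t) x := fun t => by
      rw [hρ, hA, hB, hsmul]
    -- The parameters `(m + 1)^n` are infinitely many and are covered by `hpow`.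
    have hm := hp.mem_of_infinite W (S := Set.range fun m : ℕ => ((m : ℚ) + 1) ^ n)
      (Set.infinite_range_of_injective fun m m' hmm => by
        have h1 : ((m : ℚ) + 1) = m' + 1 := (pow_left_inj₀ (by positivity) (by positivity)
          (by omega)).mp hmm
        exact_mod_cast add_right_cancel h1) (by
        rintro _ ⟨m, rfl⟩
        let u : ℚˣ := Units.mk0 ((m : ℚ) + 1) (by positivity)
        have h1 := hpow a u x hx
        rw [hiff] at h1
        have h2 := W.smul_mem (((u ^ n : ℚˣ) : ℚ) ^ i) h1
        rw [smul_smul, ← mul_pow, Units.mul_inv, one_pow, one_smul] at h2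
        exact h2) s
    rw [hiff]
    exact W.smul_mem _ hm
  rw [eq_top_iff]
  rintro g -
  suffices hs : ∀ g : GL (Fin n) ℚ, (g : Matrix (Fin n) (Fin n) ℚ) = g →
      g ∈ stabilizerSubmonoid ρ W from hs g rfl
  -- Gaussian elimination: an invertible matrix is a product of transvections and an invertible
  -- diagonal matrix.
  have key := Matrix.diagonal_transvection_induction_of_det_ne_zero
    (fun M => ∀ g : GL (Fin n) ℚ, (g : Matrix (Fin n) (Fin n) ℚ) = M →
      g ∈ stabilizerSubmonoid ρ W)
  refine fun g _ => key g ((Matrix.isUnit_iff_isUnit_det _).mp g.isUnit).ne_zero ?_ ?_ ?_ g rfl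
  · intro D hD g hg
    rw [Matrix.det_diagonal] at hD
    let d : Fin n → ℚˣ := fun k => Units.mk0 (D k) (Finset.prod_ne_zero_iff.mp hD k (by simp))
    have h1 : g = diagGL n d := Units.ext (hg.trans rfl)
    rw [h1]
    refine Submonoid.mem_comap.mp ?_
    rw [← Finset.univ_prod_mulSingle d]
    exact Submonoid.prod_mem _ fun k _ => hdiag k _
  · intro t g hg
    have h1 : g = transvGL t.hij t.c := Units.ext hg
    rw [h1]
    exact htrans _ _ _ _
  · intro A B hA hB ihA ihB g hg
    have h1 : g = Matrix.GeneralLinearGroup.mkOfDetNeZero A hA *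
        Matrix.GeneralLinearGroup.mkOfDetNeZero B hB := Units.ext hg
    rw [h1]
    exact mul_mem (ihA _ rfl) (ihB _ rfl)

theorem stabilizer_extRep_eq_top {E : Type} [AddCommGroup E] [Module ℚ E] (hn : 2 ≤ n)
    (ρ : Representation ℚ (GL (Fin n) ℚ) E)
    (Θ : (H n →ₗ[ℚ] H n) → (H n →ₗ[ℚ] H n) → E →ₗ[ℚ] E) (k : ℕ)
    (hρ : ∀ g, ρ g = Θ (stdRep n g) (stdRep n g⁻¹))
    (hsmul : ∀ (c : ℚ) A B, Θ A (c • B) = c • Θ A B)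
    (hone : ∀ s : ℚ, Θ (s • LinearMap.id) LinearMap.id = s ^ k • LinearMap.id)
    (hpoly : ∀ A B : ℚ → H n →ₗ[ℚ] H n, (∀ v, IsPoly fun t => A t v) →
      (∀ v, IsPoly fun t => B t v) → ∀ x, IsPoly fun t => Θ (A t) (B t) x) (i : ℕ)
    (W : Submodule ℚ (⋀[ℚ]^i E))
    (hW : ∀ (a b : Fin n) (h : a ≠ b), transvGL h 1 ∈ stabilizerSubmonoid (extRep ρ i) W) :
    stabilizerSubmonoid (extRep ρ i) W = ⊤ := by
  refine stabilizer_eq_top hn (extRep ρ i) (fun A B x => exteriorPower.map i (Θ A B) x) i (k * i)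
    (fun g x => ?_) (fun c A B x => ?_) (fun s x => ?_) (fun A B hA hB x => ?_) W hW
  · rw [← hρ]; rfl
  · simp only [hsmul, exteriorPower_map_smul, LinearMap.smul_apply]
  · simp only [hone, exteriorPower_map_smul, LinearMap.smul_apply, exteriorPower.map_id, pow_mul,
      LinearMap.id_apply]
  · exact IsPoly.exteriorPower_map (hpoly A B hA hB) i x

/-- If an endomorphism `c` of `A` induces `ρ g` on the values of `τ`, then `c_*` on homology covers
the action of `g` on the image. -/
theorem mem_stabilizer_range_wedgeClass {A E G : Type} [Group A] [Group G] [AddCommGroup E]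
    [Module ℚ E] (τ : A →* Multiplicative E) (c : A →* A) (ρ : Representation ℚ G E) (g : G)
    (h : ∀ a, (τ (c a)).toAdd = ρ g (τ a).toAdd) (i : ℕ) :
    g ∈ stabilizerSubmonoid (extRep ρ i) (LinearMap.range (wedgeClass τ i)) := by
  rintro _ ⟨z, rfl⟩
  refine ⟨groupHMap c i z, ?_⟩
  rw [wedgeClass_groupHMap]
  exact wedgeClass_map (ρ g) _ _ h i z

theorem johnson_conj_nielsen {a b : Fin n} (h : a ≠ b) (φ : IA n) :
    (johnson n (MulAut.conjNormal (nielsen h) φ)).toAdd =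
      uRep n 1 (transvGL h 1) (johnson n φ).toAdd := by
  refine LinearMap.ext fun v => ?_
  have h1 := johnson_conj (nielsen h) (stdRep n (transvGL h 1)) (fun x => nielsen_lin h x) φ
    (stdRep n (transvGL h 1)⁻¹ v)
  rw [← Module.End.mul_apply, ← map_mul, mul_inv_cancel, map_one, Module.End.one_apply] at h1
  exact h1

theorem stabilizer_extRep_uRep_eq_top (hn : 2 ≤ n) (i : ℕ) (W : Submodule ℚ (⋀[ℚ]^i (U n 1)))
    (hW : ∀ (a b : Fin n) (h : a ≠ b),
      transvGL h 1 ∈ stabilizerSubmonoid (extRep (uRep n 1) i) W) :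
    stabilizerSubmonoid (extRep (uRep n 1) i) W = ⊤ := by
  have := stabilizer_extRep_eq_top (E := U n 1) hn (uRep n 1) twist 2 (fun g => rfl) twist_smul
    twist_scalar (fun A B hA hB x => twist_isPoly hA hB x) i W
  exact this hW

theorem transvGL_mem_stabilizer (i : ℕ) {a b : Fin n} (h : a ≠ b) :
    transvGL h 1 ∈ stabilizerSubmonoid (extRep (uRep n 1) i)
      (LinearMap.range (wedgeClass (W := U n 1) (johnson n) i)) := by
  have := mem_stabilizer_range_wedgeClass (E := U n 1) (johnson n)
    (MulAut.conjNormal (nielsen h)).toMonoidHom (uRep n 1) _ (johnson_conj_nielsen h) i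
  exact this

theorem stabilizer_range_albToWedge (hn : 2 ≤ n) (i : ℕ) :
    stabilizerSubmonoid (extRep (uRep n 1) i) (LinearMap.range (albToWedge n i)) = ⊤ := by
  have h1 := stabilizer_extRep_uRep_eq_top hn i
    (LinearMap.range (wedgeClass (W := U n 1) (johnson n) i))
  have h2 := h1 fun a b h => transvGL_mem_stabilizer i h
  rw [range_albToWedge]
  exact h2

/-- The image of `τ_*` in `⋀^i U` is stable under `GL(n, ℚ)`. -/
theorem range_albToWedge_stable (hn : 2 ≤ n) (i : ℕ) (g : GL (Fin n) ℚ)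
    {x : ⋀[ℚ]^i (U n 1)} (hx : x ∈ LinearMap.range (albToWedge n i)) :
    extRep (uRep n 1) i g x ∈ LinearMap.range (albToWedge n i) := by
  have h : g ∈ stabilizerSubmonoid (extRep (uRep n 1) i) (LinearMap.range (albToWedge n i)) := by
    rw [stabilizer_range_albToWedge hn]
    exact Submonoid.mem_top g
  exact h x hx

end Density

end AlbIA

namespace AlbIA

/-! ### Iterated contractions -/

section Chain
variable {V N N' : Type} [AddCommGroup V] [Module ℚ V] [AddCommGroup N] [Module ℚ N]
  [AddCommGroup N'] [Module ℚ N']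

/-- For linear maps `D_0, …, D_{i-1} : V → V ⊗ V` and an `(i+1)`-linear map `f`, the linear map
obtained from `f` by feeding the argument to `D_0`, using the first factor of the result as the
first argument of `f`, feeding the second factor to `D_1`, and so on. -/
noncomputable def chain : ∀ {i : ℕ} (_ : Fin i → V →ₗ[ℚ] V ⊗[ℚ] V),
    MultilinearMap ℚ (fun _ : Fin (i + 1) => V) N →ₗ[ℚ] (V →ₗ[ℚ] N)
  | 0, _ => (MultilinearMap.ofSubsingletonₗ ℚ ℚ V N (0 : Fin 1)).symm.toLinearMap
  | i + 1, D => LinearMap.lcomp ℚ N (D 0) ∘ₗ TensorProduct.uncurry (RingHom.id ℚ) V V N ∘ₗ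
      LinearMap.llcomp ℚ V _ _ (chain (i := i) fun j => D j.succ) ∘ₗ
      (multilinearCurryLeftEquiv ℚ (fun _ : Fin (i + 2) => V) N).toLinearMap

theorem chain_zero (D : Fin 0 → V →ₗ[ℚ] V ⊗[ℚ] V) (f : MultilinearMap ℚ (fun _ : Fin 1 => V) N)
    (v : V) : chain D f v = f fun _ => v := rfl

theorem chain_succ {i : ℕ} (D : Fin (i + 1) → V →ₗ[ℚ] V ⊗[ℚ] V)
    (f : MultilinearMap ℚ (fun _ : Fin (i + 2) => V) N) (v : V) :
    chain D f v = TensorProduct.lift ((chain fun j => D j.succ) ∘ₗ f.curryLeft) (D 0 v) := rfl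

theorem chain_comp (L : N →ₗ[ℚ] N') {i : ℕ} (D : Fin i → V →ₗ[ℚ] V ⊗[ℚ] V)
    (f : MultilinearMap ℚ (fun _ : Fin (i + 1) => V) N) (v : V) :
    chain D (L.compMultilinearMap f) v = L (chain D f v) := by
  induction i generalizing v with
  | zero => rfl
  | succ i ih =>
    rw [chain_succ, chain_succ]
    induction D 0 v using TensorProduct.induction_on with
    | zero => simp
    | add x y hx hy => simp only [map_add, hx, hy]
    | tmul a b => exact ih (fun j => D j.succ) (f.curryLeft a) b

/-- The map `g` is pushed through one `D_j` at a time: the first tensor factor becomes an argument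
of `f`, the second is the input `g b` of the next step. -/
theorem chain_equivariant (g : V →ₗ[ℚ] V) {i : ℕ} (D D' : Fin i → V →ₗ[ℚ] V ⊗[ℚ] V)
    (h : ∀ j v, D' j (g v) = TensorProduct.map g g (D j v))
    (f : MultilinearMap ℚ (fun _ : Fin (i + 1) => V) N) (v : V) :
    chain D' f (g v) = chain D (f.compLinearMap fun _ => g) v := by
  induction i generalizing v with
  | zero => rfl
  | succ i ih =>
    rw [chain_succ, chain_succ, h]
    induction D 0 v using TensorProduct.induction_on with
    | zero => simp
    | add x y hx hy => simp only [map_add, hx, hy]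
    | tmul a b =>
      refine (ih (fun j => D j.succ) (fun j => D' j.succ) (fun j => h j.succ)
        (f.curryLeft (g a)) b).trans ?_
      rw [TensorProduct.lift.tmul]
      change _ = chain (fun j => D j.succ) ((f.compLinearMap fun _ => g).curryLeft a) b
      congr 2
      ext m
      change f _ = f _
      congr 1
      funext k
      refine Fin.cases ?_ (fun k => ?_) k <;> rfl

/-- Multilinearity in the tuple `D` is what allows `chain` to descend to the tensor power `M_i`. -/
theorem chain_update_add {i : ℕ} (D : Fin i → V →ₗ[ℚ] V ⊗[ℚ] V) (j : Fin i)
    (x y : V →ₗ[ℚ] V ⊗[ℚ] V) : chain (N := N) (Function.update D j (x + y)) =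
      chain (Function.update D j x) + chain (Function.update D j y) := by
  induction i with
  | zero => exact j.elim0
  | succ i ih =>
    ext f v
    rw [LinearMap.add_apply, LinearMap.add_apply, chain_succ, chain_succ, chain_succ]
    refine Fin.cases ?_ (fun j => ?_) j
    · simp [Function.update_self]
    · have hz : ∀ z, (fun k : Fin i => Function.update D j.succ z k.succ) =
          Function.update (fun k : Fin i => D k.succ) j z := fun z => by
        funext k
        simp [Function.update_apply, Fin.succ_inj]
      simp only [hz, ih, Function.update_of_ne (Fin.succ_ne_zero j).symm]
      rw [LinearMap.add_comp]
      induction D 0 v using TensorProduct.induction_on with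
      | zero => simp
      | add x y hx hy => simp only [map_add, hx, hy]; abel
      | tmul a b => rfl

theorem chain_update_smul {i : ℕ} (D : Fin i → V →ₗ[ℚ] V ⊗[ℚ] V) (j : Fin i) (c : ℚ)
    (x : V →ₗ[ℚ] V ⊗[ℚ] V) : chain (N := N) (Function.update D j (c • x)) =
      c • chain (Function.update D j x) := by
  induction i with
  | zero => exact j.elim0
  | succ i ih =>
    ext f v
    rw [LinearMap.smul_apply, LinearMap.smul_apply, chain_succ, chain_succ]
    refine Fin.cases ?_ (fun j => ?_) j
    · simp [Function.update_self]
    · have hz : ∀ z, (fun k : Fin i => Function.update D j.succ z k.succ) =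
          Function.update (fun k : Fin i => D k.succ) j z := fun z => by
        funext k
        simp [Function.update_apply, Fin.succ_inj]
      simp only [hz, ih, Function.update_of_ne (Fin.succ_ne_zero j).symm]
      rw [LinearMap.smul_comp]
      induction D 0 v using TensorProduct.induction_on with
      | zero => simp
      | add x y hx hy => simp only [map_add, hx, hy, smul_add]
      | tmul a b => rfl

/-- `chain` as a multilinear map in the tuple `D`. -/
noncomputable def chainMultilinear (i : ℕ) : MultilinearMap ℚ (fun _ : Fin i => V →ₗ[ℚ] V ⊗[ℚ] V)
    (MultilinearMap ℚ (fun _ : Fin (i + 1) => V) N →ₗ[ℚ] (V →ₗ[ℚ] N)) where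
  toFun D := chain D
  map_update_add' := fun {inst} D j x y => by
    rw [Subsingleton.elim inst (instDecidableEqFin i)]
    exact chain_update_add D j x y
  map_update_smul' := fun {inst} D j c x => by
    rw [Subsingleton.elim inst (instDecidableEqFin i)]
    exact chain_update_smul D j c x

/-- On pure tensors the second factor `b_j` is fed to `d_{j+1}`, which yields exactly the pairings
of the contraction `c_i`. Only `b_i` remains, as the last argument of `f`. -/
theorem chain_rank_one {i : ℕ} (a b : Fin (i + 1) → V) (d : Fin (i + 1) → Module.Dual ℚ V)
    (f : MultilinearMap ℚ (fun _ : Fin (i + 2) => V) N) (v : V) :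
    chain (fun j => (d j).smulRight (a j ⊗ₜ[ℚ] b j)) f v =
      (d 0 v * ∏ j : Fin i, d j.succ (b j.castSucc)) •
        f (Fin.snoc (α := fun _ => V) a (b (Fin.last i))) := by
  induction i generalizing v with
  | zero =>
    rw [chain_succ]
    simp only [LinearMap.smulRight_apply, map_smul, TensorProduct.lift.tmul,
      Finset.univ_eq_empty, Finset.prod_empty, mul_one]
    congr 1
    change f _ = f _
    congr 1
    funext k
    fin_cases k <;> rfl
  | succ i ih =>
    rw [chain_succ]
    simp only [LinearMap.smulRight_apply, map_smul, TensorProduct.lift.tmul]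
    have := ih (fun j => a j.succ) (fun j => b j.succ) (fun j => d j.succ) (f.curryLeft (a 0)) (b 0)
    refine (congrArg (fun z => d 0 v • z) this).trans ?_
    rw [smul_smul, Fin.prod_univ_succ (n := i)]
    congr 1
    -- The vector `a_0` goes to the front and the last `b` stays at the end; the two insertions
    -- commute.
    rw [MultilinearMap.curryLeft_apply, Fin.cons_snoc_eq_snoc_cons]
    congr 2
    exact Fin.cons_self_tail a

end Chain

/-! ### Iterated contractions of the operators `e_l ↦ e_k ⊗ e_l - e_l ⊗ e_k` -/

section ChainBasis
variable {n : ℕ} {N : Type} [AddCommGroup N] [Module ℚ N]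

/-- The standard basis vectors of `H`. -/
abbrev stdE {n : ℕ} (k : Fin n) : H n := Pi.single k (1 : ℚ)

/-- Each step either records `e_κ` and keeps `e_l` running, or records `e_l` and lets `e_κ` run. For
alternating `f` the second branch differs by one transposition, whose sign cancels the minus in `D`.
All contributions therefore add up, and the coefficient is a natural number; it is positive when the
first branch survives to the end. -/
theorem chain_alternating {i : ℕ} (D : Fin i → H n →ₗ[ℚ] H n ⊗[ℚ] H n) (κ : Fin i → Fin n)
    (hD : ∀ j l, D j (stdE l) =
      if l < κ j then stdE (κ j) ⊗ₜ stdE l - stdE l ⊗ₜ stdE (κ j) else 0)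
    (f : H n [⋀^Fin (i + 1)]→ₗ[ℚ] N) (l : Fin n) :
    ∃ c : ℕ, chain D f.toMultilinearMap (stdE l) =
      c • f (Fin.snoc (α := fun _ => H n) (fun j => stdE (κ j)) (stdE l)) ∧
      ((∀ j, l < κ j) → 0 < c) ∧ (∀ h : 0 < i, ¬ l < κ ⟨0, h⟩ → c = 0) := by
  induction i generalizing l with
  | zero =>
    refine ⟨1, ?_, by simp, fun h => absurd h (lt_irrefl 0)⟩
    rw [chain_zero, one_smul]
    change f _ = f _
    congr 1
  | succ i ih =>
    rw [chain_succ, hD]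
    by_cases hl : l < κ 0
    · obtain ⟨c₁, h₁, p₁, -⟩ := ih (fun j => D j.succ) (fun j => κ j.succ) (fun j => hD j.succ)
        (f.curryLeft (stdE (κ 0))) l
      obtain ⟨c₂, h₂, -, -⟩ := ih (fun j => D j.succ) (fun j => κ j.succ) (fun j => hD j.succ)
        (f.curryLeft (stdE l)) (κ 0)
      refine ⟨c₁ + c₂, ?_, fun h => Nat.add_pos_left (p₁ fun j => h j.succ) _,
        fun _ h => absurd hl h⟩
      rw [if_pos hl, map_sub, TensorProduct.lift.tmul, TensorProduct.lift.tmul, add_smul]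
      refine (congrArg₂ (· - ·) h₁ h₂).trans ?_
      have e₁ : f.curryLeft (stdE (κ 0)) (Fin.snoc (α := fun _ => H n)
          (fun j : Fin i => stdE (κ j.succ)) (stdE l)) =
          f (Fin.snoc (α := fun _ => H n) (fun j => stdE (κ j)) (stdE l)) := by
        change f (Fin.cons _ _) = _
        rw [Fin.cons_snoc_eq_snoc_cons]
        congr 2
        exact Fin.cons_self_tail fun j => stdE (κ j)
      have e₂ : f.curryLeft (stdE l) (Fin.snoc (α := fun _ => H n)
          (fun j : Fin i => stdE (κ j.succ)) (stdE (κ 0))) =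
          - f (Fin.snoc (α := fun _ => H n) (fun j => stdE (κ j)) (stdE l)) := by
        -- The two branches differ by exchanging the first argument with the last, namely `e_{κ 0}`
        -- with `e_l`.
        have := f.map_swap (Fin.snoc (α := fun _ => H n) (fun j => stdE (κ j)) (stdE l))
          (i := 0) (j := Fin.last (i + 1)) (by simp [Fin.ext_iff])
        rw [← this]
        change f (Fin.cons _ _) = _
        congr 1
        rw [Fin.cons_snoc_eq_snoc_cons]
        funext k
        refine Fin.lastCases ?_ (fun k => ?_) k
        · rw [Fin.snoc_last, Function.comp_apply, Equiv.swap_apply_right]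
          exact (Fin.snoc_castSucc (α := fun _ => H n) (stdE l) (fun j => stdE (κ j)) 0).symm
        · rw [Fin.snoc_castSucc, Function.comp_apply]
          refine Fin.cases ?_ (fun k => ?_) k
          · rw [Fin.castSucc_zero, Equiv.swap_apply_left, Fin.snoc_last]
            rfl
          · rw [Equiv.swap_apply_of_ne_of_ne (by simp [Fin.ext_iff])
              (Fin.castSucc_lt_last _).ne, Fin.snoc_castSucc]
            rfl
      rw [e₁, e₂, smul_neg, sub_neg_eq_add]
    · refine ⟨0, ?_, fun h => absurd (h 0) hl, fun _ _ => rfl⟩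
      rw [if_neg hl, map_zero, zero_smul]

/-- The running index never decreases: from `l` it continues with `l` or with some `κ j > l`. So
only last arguments `e_b` with `b ≥ l` occur. -/
theorem chain_eq_zero {i : ℕ} (D : Fin i → H n →ₗ[ℚ] H n ⊗[ℚ] H n) (κ : Fin i → Fin n)
    (hD : ∀ j l, D j (stdE l) =
      if l < κ j then stdE (κ j) ⊗ₜ stdE l - stdE l ⊗ₜ stdE (κ j) else 0)
    (f : MultilinearMap ℚ (fun _ : Fin (i + 1) => H n) N) (l : Fin n)
    (hf : ∀ a b, l ≤ b → f (Fin.snoc (α := fun _ => H n) a (stdE b)) = 0) :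
    chain D f (stdE l) = 0 := by
  induction i generalizing l with
  | zero =>
    rw [chain_zero, ← hf (fun k => k.elim0) l le_rfl]
    congr 1
  | succ i ih =>
    have hstep : ∀ x l', l ≤ l' → chain (fun j => D j.succ) (f.curryLeft x) (stdE l') = 0 := by
      intro x l' hl'
      refine ih _ (fun j => κ j.succ) (fun j => hD j.succ) _ l' fun a b hb => ?_
      rw [MultilinearMap.curryLeft_apply, Fin.cons_snoc_eq_snoc_cons]
      exact hf _ b (hl'.trans hb)
    rw [chain_succ, hD]
    split_ifs with hl
    · rw [map_sub, TensorProduct.lift.tmul, TensorProduct.lift.tmul]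
      exact (congrArg₂ (· - ·) (hstep _ _ le_rfl) (hstep _ _ hl.le)).trans (sub_zero _)
    · rw [map_zero]

/-- Once the running index has grown it cannot return to `l`, so only the branch that keeps `l` at
every step survives. This computes the diagonal entries needed for the cyclic contraction. -/
theorem chain_triangular {i : ℕ} (D : Fin i → H n →ₗ[ℚ] H n ⊗[ℚ] H n) (κ : Fin i → Fin n)
    (hD : ∀ j l, D j (stdE l) =
      if l < κ j then stdE (κ j) ⊗ₜ stdE l - stdE l ⊗ₜ stdE (κ j) else 0)
    (f : MultilinearMap ℚ (fun _ : Fin (i + 1) => H n) N) (l : Fin n)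
    (hf : ∀ a b, l < b → f (Fin.snoc (α := fun _ => H n) a (stdE b)) = 0) :
    chain D f (stdE l) = if ∀ j, l < κ j then
      f (Fin.snoc (α := fun _ => H n) (fun j => stdE (κ j)) (stdE l)) else 0 := by
  induction i with
  | zero =>
    rw [chain_zero, if_pos fun j => j.elim0]
    congr 1
  | succ i ih =>
    rw [chain_succ, hD]
    by_cases hl : l < κ 0
    · rw [if_pos hl, map_sub, TensorProduct.lift.tmul, TensorProduct.lift.tmul]
      have h₁ := ih (fun j => D j.succ) (fun j => κ j.succ) (fun j => hD j.succ)
        (f.curryLeft (stdE (κ 0))) fun a b hb => by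
          rw [MultilinearMap.curryLeft_apply, Fin.cons_snoc_eq_snoc_cons]
          exact hf _ b hb
      -- The branch that runs on from `κ 0 > l` meets only last arguments larger than `l`.
      have h₂ := chain_eq_zero (fun j => D j.succ) (fun j => κ j.succ) (fun j => hD j.succ)
        (f.curryLeft (stdE l)) (κ 0) fun a b hb => by
          rw [MultilinearMap.curryLeft_apply, Fin.cons_snoc_eq_snoc_cons]
          exact hf _ b (hl.trans_le hb)
      refine (congrArg₂ (· - ·) h₁ h₂).trans ?_
      rw [sub_zero, MultilinearMap.curryLeft_apply, Fin.cons_snoc_eq_snoc_cons]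
      have h₃ : (∀ j : Fin (i + 1), l < κ j) ↔ ∀ j : Fin i, l < κ j.succ := by
        rw [Fin.forall_fin_succ]
        exact and_iff_right hl
      rw [if_congr h₃ rfl rfl]
      congr 3
      exact Fin.cons_self_tail fun j => stdE (κ j)
    · rw [if_neg hl, map_zero, if_neg fun h => hl (h 0)]

end ChainBasis

end AlbIA

namespace AlbIA

/-! ### The contractions in terms of iterated contractions -/

section Split
variable (V : Type) [AddCommGroup V] [Module ℚ V]

/-- The identification `V^{⊗2} → V ⊗ V`. -/
noncomputable def splitT : ⨂[ℚ]^2 V →ₗ[ℚ] V ⊗[ℚ] V :=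
  PiTensorProduct.lift
    { toFun := fun v => v 0 ⊗ₜ v 1
      map_update_add' := fun {inst} v k x y => by
        rw [Subsingleton.elim inst (instDecidableEqFin 2)]
        fin_cases k <;> simp [TensorProduct.add_tmul, TensorProduct.tmul_add]
      map_update_smul' := fun {inst} v k c x => by
        rw [Subsingleton.elim inst (instDecidableEqFin 2)]
        fin_cases k <;> simp [TensorProduct.smul_tmul'] }

variable {V}
theorem splitT_tprod (v : Fin 2 → V) : splitT V (PiTensorProduct.tprod ℚ v) = v 0 ⊗ₜ v 1 := by
  rw [splitT, PiTensorProduct.lift.tprod]; rfl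

variable (V) in
/-- The embedding `⋀² V → V ⊗ V`, `a ∧ b ↦ a ⊗ b - b ⊗ a`. -/
noncomputable def wedgeToTensor : ⋀[ℚ]^2 V →ₗ[ℚ] V ⊗[ℚ] V :=
  splitT V ∘ₗ exteriorPower.toTensorPower ℚ V 2

theorem toTensorPower_ιMulti {k : ℕ} (v : Fin k → V) :
    exteriorPower.toTensorPower ℚ V k (exteriorPower.ιMulti ℚ k v) =
      ∑ σ : Equiv.Perm (Fin k), ((Equiv.Perm.sign σ : ℤ) : ℚ) •
        PiTensorProduct.tprod ℚ fun j => v (σ j) := by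
  rw [exteriorPower.toTensorPower_apply_ιMulti]
  refine Finset.sum_congr rfl fun σ _ => ?_
  rw [Units.smul_def, Int.cast_smul_eq_zsmul]

theorem wedgeToTensor_ιMulti (v : Fin 2 → V) :
    wedgeToTensor V (exteriorPower.ιMulti ℚ 2 v) = v 0 ⊗ₜ v 1 - v 1 ⊗ₜ v 0 := by
  rw [wedgeToTensor, LinearMap.comp_apply, toTensorPower_ιMulti, map_sum,
    show (Finset.univ : Finset (Equiv.Perm (Fin 2))) = {1, Equiv.swap 0 1} by decide,
    Finset.sum_pair (by decide)]
  simp [splitT_tprod, sub_eq_add_neg]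

theorem wedgeToTensor_map (g : V →ₗ[ℚ] V) (w : ⋀[ℚ]^2 V) :
    wedgeToTensor V (exteriorPower.map 2 g w) = TensorProduct.map g g (wedgeToTensor V w) := by
  have : wedgeToTensor V ∘ₗ exteriorPower.map 2 g =
      TensorProduct.map g g ∘ₗ wedgeToTensor V := by
    refine exteriorPower.linearMap_ext (AlternatingMap.ext fun v => ?_)
    simp only [LinearMap.compAlternatingMap_apply, LinearMap.comp_apply,
      exteriorPower.map_apply_ιMulti, wedgeToTensor_ιMulti, map_sub, TensorProduct.map_tmul,
      Function.comp_apply]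
  exact LinearMap.congr_fun this w

end Split

variable {n : ℕ}

variable (n) in
/-- The identification `H^{⊗2} ⊗ H^* → Hom(H, H ⊗ H)`. -/
noncomputable def hhdHom : HHd n →ₗ[ℚ] (H n →ₗ[ℚ] H n ⊗[ℚ] H n) :=
  TensorProduct.lift ((LinearMap.smulRightₗ (R := ℚ) (M := H n ⊗[ℚ] H n) (M₂ := H n)).flip ∘ₗ splitT (H n))

theorem hhdHom_tmul (t : ⨂[ℚ]^2 (H n)) (d : Module.Dual ℚ (H n)) :
    hhdHom n (t ⊗ₜ d) = d.smulRight (splitT (H n) t) := rfl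

/-- This identifies `φ(u)` with `u` followed by `⋀² H ⊂ H ⊗ H`, the form in which `chain` takes its
operators. -/
theorem hhdHom_phi (u : U n 1) : hhdHom n (phi n u) = wedgeToTensor (H n) ∘ₗ u := by
  refine (Pi.basisFun ℚ (Fin n)).ext fun j => ?_
  rw [phi, LinearMap.sum_apply, map_sum, LinearMap.sum_apply]
  rw [Finset.sum_eq_single j]
  · simp [hhdHom_tmul, dualE, wedgeToTensor]
  · intro k _ hk
    simp [hhdHom_tmul, dualE, hk]
  · simp

theorem hhdHom_basis (K : (Fin 2 → Fin n) × Fin n) :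
    hhdHom n (((Basis.piTensorProduct fun _ => Pi.basisFun ℚ (Fin n)).tensorProduct
      (Pi.basisFun ℚ (Fin n)).dualBasis) K) =
      (dualE K.2).smulRight (stdE (K.1 0) ⊗ₜ stdE (K.1 1)) := by
  rw [Module.Basis.tensorProduct_apply', hhdHom_tmul, Basis.piTensorProduct_apply, splitT_tprod]
  ext
  simp [dualE, Pi.single_apply, eq_comm]

/-- The extension of `chain` to `M_i`. -/
noncomputable def chainM (i : ℕ) {N : Type} [AddCommGroup N] [Module ℚ N]
    (f : MultilinearMap ℚ (fun _ : Fin (i + 1) => H n) N) : M n i →ₗ[ℚ] H n →ₗ[ℚ] N :=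
  PiTensorProduct.lift (((LinearMap.applyₗ f).compMultilinearMap (chainMultilinear i)).compLinearMap
    fun _ => hhdHom n)

theorem chainM_tprod {i : ℕ} {N : Type} [AddCommGroup N] [Module ℚ N]
    (f : MultilinearMap ℚ (fun _ : Fin (i + 1) => H n) N) (m : Fin i → HHd n) :
    chainM i f (PiTensorProduct.tprod ℚ m) = chain (fun j => hhdHom n (m j)) f := by
  rw [chainM, PiTensorProduct.lift.tprod]; rfl

theorem basisM_apply (i : ℕ) (K : Fin i → (Fin 2 → Fin n) × Fin n) :
    basisM n i K = PiTensorProduct.tprod ℚ fun j =>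
      ((Basis.piTensorProduct fun _ => Pi.basisFun ℚ (Fin n)).tensorProduct
      (Pi.basisFun ℚ (Fin n)).dualBasis) (K j) := by
  rw [basisM, Basis.piTensorProduct_apply]

theorem chainM_basis {m : ℕ} {N : Type} [AddCommGroup N] [Module ℚ N]
    (f : MultilinearMap ℚ (fun _ : Fin (m + 2) => H n) N)
    (K : Fin (m + 1) → (Fin 2 → Fin n) × Fin n) (v : H n) :
    chainM (m + 1) f (basisM n (m + 1) K) v =
      (v (K 0).2 * ∏ j : Fin m, if (K j.succ).2 = (K j.castSucc).1 1 then (1 : ℚ) else 0) •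
        f (Fin.snoc (α := fun _ => H n) (fun j => stdE ((K j).1 0))
          (stdE ((K (Fin.last m)).1 1))) := by
  rw [basisM_apply, chainM_tprod]
  simp only [hhdHom_basis]
  rw [chain_rank_one]
  congr 2
  refine Finset.prod_congr rfl fun j _ => ?_
  simp [dualE, Pi.single_apply]

theorem fin_succ_sub_one {m : ℕ} (j : Fin m) : j.succ - 1 = j.castSucc := by
  rw [← Fin.coeSucc_eq_succ, add_sub_cancel_right]

theorem fin_zero_sub_one (m : ℕ) : (0 : Fin (m + 1)) - 1 = Fin.last m := by
  rw [sub_eq_iff_eq_add, Fin.last_add_one]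

theorem cMap_eq (n m : ℕ) :
    cMap n (m + 1) = chainM (m + 1) (exteriorPower.ιMulti ℚ (m + 2) (M := H n)).toMultilinearMap := by
  refine (basisM n (m + 1)).ext fun K => LinearMap.ext fun v => ?_
  rw [chainM_basis, cMap, Module.Basis.constr_basis, fin_zero_sub_one]
  -- The indices `j ≠ 0` are the successors, and there `j - 1` does not wrap around.
  have : (Finset.univ.erase (0 : Fin (m + 1))) = Finset.univ.map (Fin.succEmb m) := by
    ext j
    refine Fin.cases ?_ (fun j => ?_) j <;> simp [Fin.succ_ne_zero]
  rw [this, Finset.prod_map, LinearMap.smul_apply, LinearMap.smulRight_apply, smul_smul, mul_comm]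
  simp only [Fin.coe_succEmb, fin_succ_sub_one]
  rfl

/-- The multilinear map `(a, b) ↦ ξ(b) a_0 ∧ … ∧ a_{i-1}`. -/
noncomputable def wheelForm (i : ℕ) (ξ : Module.Dual ℚ (H n)) :
    MultilinearMap ℚ (fun _ : Fin (i + 1) => H n) (⋀[ℚ]^i (H n)) :=
  MultilinearMap.uncurryRight
    ((LinearMap.smulRightₗ (R := ℚ) (M := ⋀[ℚ]^i (H n)) ξ).compMultilinearMap
      (exteriorPower.ιMulti ℚ i (M := H n)).toMultilinearMap)

theorem wheelForm_snoc (i : ℕ) (ξ : Module.Dual ℚ (H n)) (a : Fin i → H n) (b : H n) :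
    wheelForm i ξ (Fin.snoc (α := fun _ => H n) a b) = ξ b • exteriorPower.ιMulti ℚ i a := by
  rw [wheelForm, MultilinearMap.uncurryRight_apply, Fin.init_snoc, Fin.snoc_last]; rfl

/-- The cycle is closed by a trace: the pairing missing in the open chain is `d_1(b_i) = ∑_l
d_1(e_l) e_l^*(b_i)`. -/
theorem cWheel_eq (n m : ℕ) :
    cWheel n (m + 1) =
      ∑ l : Fin n, LinearMap.applyₗ (stdE l) ∘ₗ chainM (m + 1) (wheelForm (m + 1) (dualE l)) := by
  refine (basisM n (m + 1)).ext fun K => ?_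
  rw [LinearMap.sum_apply, cWheel, Module.Basis.constr_basis, Finset.sum_eq_single (K 0).2]
  · rw [LinearMap.comp_apply, LinearMap.applyₗ_apply_apply, chainM_basis, wheelForm_snoc, smul_smul,
      Fin.prod_univ_succ, fin_zero_sub_one]
    simp only [fin_succ_sub_one]
    rw [mul_comm]
    simp [dualE, Pi.single_apply]
  · intro l _ hl
    rw [LinearMap.comp_apply, LinearMap.applyₗ_apply_apply, chainM_basis]
    simp [hl.symm]
  · simp

end AlbIA

namespace AlbIA

/-! ### Equivariance of the contractions -/

theorem exteriorPower_hom_ext {E N : Type} [AddCommGroup E] [Module ℚ E] [AddCommGroup N]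
    [Module ℚ N] {i : ℕ} {A B : ⋀[ℚ]^i E →ₗ[ℚ] N}
    (h : ∀ u, A (exteriorPower.ιMulti ℚ i u) = B (exteriorPower.ιMulti ℚ i u)) : A = B :=
  exteriorPower.linearMap_ext (AlternatingMap.ext h)

/-- The map `⋀^i E → E'^{⊗i}`, `u₁ ∧ … ∧ u_i ↦ ∑_σ sgn(σ) L(u_{σ(1)}) ⊗ … ⊗ L(u_{σ(i)})`. -/
noncomputable def wedgeToPi {E E' : Type} [AddCommGroup E] [Module ℚ E] [AddCommMonoid E']
    [Module ℚ E'] (i : ℕ) (L : E →ₗ[ℚ] E') : ⋀[ℚ]^i E →ₗ[ℚ] ⨂[ℚ]^i E' :=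
  PiTensorProduct.map (fun _ => L) ∘ₗ exteriorPower.toTensorPower ℚ E i

theorem wedgeToPi_ιMulti {E E' : Type} [AddCommGroup E] [Module ℚ E] [AddCommMonoid E']
    [Module ℚ E'] {i : ℕ} (L : E →ₗ[ℚ] E') (u : Fin i → E) :
    wedgeToPi i L (exteriorPower.ιMulti ℚ i u) =
      ∑ σ : Equiv.Perm (Fin i), ((Equiv.Perm.sign σ : ℤ) : ℚ) •
        PiTensorProduct.tprod ℚ fun j => L (u (σ j)) := by
  rw [wedgeToPi, LinearMap.comp_apply, toTensorPower_ιMulti, map_sum]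
  simp only [map_smul, PiTensorProduct.map_tprod]

variable {n : ℕ}

set_option maxHeartbeats 1000000 in
theorem iota_eq (i : ℕ) : iota n i = wedgeToPi (E := U n 1) i (phi n) := by
  unfold iota wedgeToPi
  congr 1

theorem iota_ιMulti (i : ℕ) (u : Fin i → U n 1) :
    iota n i (exteriorPower.ιMulti ℚ i (M := U n 1) u) =
      (∑ σ : Equiv.Perm (Fin i), ((Equiv.Perm.sign σ : ℤ) : ℚ) •
        PiTensorProduct.tprod ℚ fun j => phi n (u (σ j)) : M n i) := by
  have h₁ : iota n i (exteriorPower.ιMulti ℚ i (M := U n 1) u) =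
      wedgeToPi (E := U n 1) i (phi n) (exteriorPower.ιMulti ℚ i (M := U n 1) u) :=
    LinearMap.congr_fun (iota_eq i) _
  have h₂ := wedgeToPi_ιMulti (E := U n 1) (phi n) u
  exact h₁.trans h₂

variable {N : Type} [AddCommGroup N] [Module ℚ N]

/-- This reduces contractions of wedges in `⋀^i U` to signed sums of `chain`, in which equivariance
and explicit values are accessible. -/
theorem chainM_iota_ιMulti {i : ℕ} (f : MultilinearMap ℚ (fun _ : Fin (i + 1) => H n) N)
    (u : Fin i → U n 1) (v : H n) :
    chainM i f (iota n i (exteriorPower.ιMulti ℚ i (M := U n 1) u)) v =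
      ∑ σ : Equiv.Perm (Fin i), ((Equiv.Perm.sign σ : ℤ) : ℚ) •
        chain (fun j => wedgeToTensor (H n) ∘ₗ u (σ j)) f v := by
  rw [iota_ιMulti, map_sum, LinearMap.sum_apply]
  simp only [map_smul, chainM_tprod, hhdHom_phi, LinearMap.smul_apply]

theorem extRep_ιMulti {G V : Type} [Group G] [AddCommGroup V] [Module ℚ V]
    (ρ : Representation ℚ G V) (k : ℕ) (g : G) (v : Fin k → V) :
    extRep ρ k g (exteriorPower.ιMulti ℚ k v) = exteriorPower.ιMulti ℚ k fun j => ρ g (v j) :=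
  exteriorPower.map_apply_ιMulti _ _

theorem stdRep_inv_apply (g : GL (Fin n) ℚ) (v : H n) : stdRep n g⁻¹ (stdRep n g v) = v := by
  rw [← Module.End.mul_apply, ← map_mul, inv_mul_cancel, map_one, Module.End.one_apply]

theorem stdRep_apply_inv (g : GL (Fin n) ℚ) (v : H n) : stdRep n g (stdRep n g⁻¹ v) = v := by
  rw [← Module.End.mul_apply, ← map_mul, mul_inv_cancel, map_one, Module.End.one_apply]

theorem uRep_apply (i : ℕ) (g : GL (Fin n) ℚ) (u : U n i) (v : H n) :
    uRep n i g u v = extRep (stdRep n) (i + 1) g (u (stdRep n g⁻¹ v)) := rfl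

/-- `g` acts on `u` by `⋀²g ∘ u ∘ g⁻¹`, so the operators attached to `g u` and `u` are related as
`chain_equivariant` requires. -/
theorem chainM_iota_equivariant {i : ℕ} (f : MultilinearMap ℚ (fun _ : Fin (i + 1) => H n) N)
    (g : GL (Fin n) ℚ) (x : ⋀[ℚ]^i (U n 1)) (v : H n) :
    chainM i f (iota n i (extRep (uRep n 1) i g x)) (stdRep n g v) =
      chainM i (f.compLinearMap fun _ => stdRep n g) (iota n i x) v := by
  have h : LinearMap.applyₗ (stdRep n g v) ∘ₗ chainM i f ∘ₗ iota n i ∘ₗ extRep (uRep n 1) i g =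
      LinearMap.applyₗ v ∘ₗ chainM i (f.compLinearMap fun _ => stdRep n g) ∘ₗ iota n i := by
    refine exteriorPower_hom_ext (E := U n 1) fun u => ?_
    have h₁ := extRep_ιMulti (uRep n 1) i g u
    simp only [LinearMap.comp_apply, LinearMap.applyₗ_apply_apply]
    rw [h₁, chainM_iota_ιMulti, chainM_iota_ιMulti]
    refine Finset.sum_congr rfl fun σ _ => congrArg _ ?_
    refine chain_equivariant (stdRep n g) _ _ (fun j w => ?_) f v
    simp only [LinearMap.comp_apply, uRep_apply, stdRep_inv_apply]
    exact wedgeToTensor_map _ _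
  exact LinearMap.congr_fun h x

theorem chainM_comp {N' : Type} [AddCommGroup N'] [Module ℚ N'] (L : N →ₗ[ℚ] N') {i : ℕ}
    (f : MultilinearMap ℚ (fun _ : Fin (i + 1) => H n) N) (x : M n i) (v : H n) :
    chainM i (L.compMultilinearMap f) x v = L (chainM i f x v) := by
  have h : LinearMap.applyₗ v ∘ₗ chainM i (L.compMultilinearMap f) =
      L ∘ₗ LinearMap.applyₗ v ∘ₗ chainM i f := by
    refine PiTensorProduct.ext (MultilinearMap.ext fun m => ?_)
    change chainM i (L.compMultilinearMap f) (PiTensorProduct.tprod ℚ m) v =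
      L (chainM i f (PiTensorProduct.tprod ℚ m) v)
    rw [chainM_tprod, chainM_tprod, chain_comp]
  exact LinearMap.congr_fun h x

/-- The relation `y' = g y` in `M_i`, as seen by iterated contractions. -/
def ChainRelated {i : ℕ} (g : GL (Fin n) ℚ) (y y' : M n i) : Prop :=
  ∀ (N : Type) [AddCommGroup N] [Module ℚ N]
    (f : MultilinearMap ℚ (fun _ : Fin (i + 1) => H n) N) (v : H n),
    chainM i f y' (stdRep n g v) = chainM i (f.compLinearMap fun _ => stdRep n g) y v

theorem chainRelated_iota {i : ℕ} (g : GL (Fin n) ℚ) (x : ⋀[ℚ]^i (U n 1)) :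
    ChainRelated g (iota n i x) (iota n i (extRep (uRep n 1) i g x)) := by
  intro N _ _ f v
  exact chainM_iota_equivariant f g x v

/-- Here `f` is the wedge product, and precomposing it with `g` in every argument is postcomposing
with `⋀^{i+1} g`. -/
theorem ChainRelated.cMap {m : ℕ} {g : GL (Fin n) ℚ} {y y' : M n (m + 1)}
    (hy : ChainRelated g y y') :
    cMap n (m + 1) y' = uRep n (m + 1) g (cMap n (m + 1) y) := by
  refine LinearMap.ext fun v => ?_
  rw [uRep_apply, cMap_eq]
  have h := hy (⋀[ℚ]^(m + 2) (H n))
    (exteriorPower.ιMulti ℚ (m + 2) (M := H n)).toMultilinearMap (stdRep n g⁻¹ v)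
  rw [stdRep_apply_inv] at h
  have e : (exteriorPower.ιMulti ℚ (m + 2) (M := H n)).toMultilinearMap.compLinearMap
      (fun _ => stdRep n g) = (extRep (stdRep n) (m + 2) g).compMultilinearMap
        (exteriorPower.ιMulti ℚ (m + 2) (M := H n)).toMultilinearMap :=
    MultilinearMap.ext fun w => (extRep_ιMulti (stdRep n) (m + 2) g w).symm
  rw [h, e, chainM_comp]

theorem sum_dualE_smul (ξ : Module.Dual ℚ (H n)) : ξ = ∑ l, ξ (stdE l) • dualE l := by
  refine (Pi.basisFun ℚ (Fin n)).ext fun j => ?_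
  simp [dualE, Pi.single_apply]

theorem sum_stdE (v : H n) : v = ∑ l, v l • stdE l := by
  ext j
  simp [Pi.single_apply]

/-- The Casimir element `∑ e_l^* ⊗ e_l` is invariant. -/
theorem casimir (B : Module.Dual ℚ (H n) →ₗ[ℚ] H n →ₗ[ℚ] N) (g : GL (Fin n) ℚ) :
    ∑ l, B (dualE l ∘ₗ stdRep n g) (stdE l) = ∑ l, B (dualE l) (stdRep n g (stdE l)) := by
  have h₁ : ∀ l, B (dualE l ∘ₗ stdRep n g) (stdE l) =
      ∑ k, stdRep n g (stdE k) l • B (dualE k) (stdE l) := fun l => by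
    conv_lhs => rw [sum_dualE_smul (dualE l ∘ₗ stdRep n g), map_sum, LinearMap.sum_apply]
    simp only [map_smul, LinearMap.smul_apply]
    rfl
  have h₂ : ∀ l, B (dualE l) (stdRep n g (stdE l)) =
      ∑ k, stdRep n g (stdE l) k • B (dualE l) (stdE k) := fun l => by
    conv_lhs => rw [sum_stdE (stdRep n g (stdE l)), map_sum]
    simp only [map_smul]
  simp only [h₁, h₂]
  exact Finset.sum_comm

theorem wheelForm_comp (i : ℕ) (ξ : Module.Dual ℚ (H n)) (g : GL (Fin n) ℚ) :
    (wheelForm i ξ).compLinearMap (fun _ => stdRep n g) =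
      (extRep (stdRep n) i g).compMultilinearMap (wheelForm i (ξ ∘ₗ stdRep n g)) := by
  refine MultilinearMap.ext fun w => ?_
  rw [← Fin.snoc_init_self w]
  generalize Fin.init w = a
  generalize w (Fin.last i) = b
  rw [LinearMap.compMultilinearMap_apply, wheelForm_snoc, map_smul, extRep_ιMulti,
    MultilinearMap.compLinearMap_apply]
  refine Eq.trans ?_ (wheelForm_snoc i ξ _ _)
  congr 1
  funext k
  refine Fin.lastCases ?_ (fun k => ?_) k <;> simp

/-- Bilinearity in `ξ` and the starting vector is what the Casimir argument for the trace needs. -/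
theorem chainM_wheelForm_linear (i : ℕ) (x : M n i) :
    ∃ B : Module.Dual ℚ (H n) →ₗ[ℚ] H n →ₗ[ℚ] ⋀[ℚ]^i (H n),
      ∀ ξ, B ξ = chainM i (wheelForm i ξ) x := by
  have hadd : ∀ ξ ξ' : Module.Dual ℚ (H n),
      wheelForm i (ξ + ξ') = wheelForm i ξ + wheelForm i ξ' := fun ξ ξ' => by
    refine MultilinearMap.ext fun w => ?_
    rw [← Fin.snoc_init_self w, add_apply, wheelForm_snoc, wheelForm_snoc,
      wheelForm_snoc, LinearMap.add_apply, add_smul]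
  have hsmul : ∀ (c : ℚ) (ξ : Module.Dual ℚ (H n)),
      wheelForm i (c • ξ) = c • wheelForm i ξ := fun c ξ => by
    refine MultilinearMap.ext fun w => ?_
    rw [← Fin.snoc_init_self w, smul_apply, wheelForm_snoc, wheelForm_snoc,
      LinearMap.smul_apply, smul_assoc]
  have hM : ∀ f f' : MultilinearMap ℚ (fun _ : Fin (i + 1) => H n) (⋀[ℚ]^i (H n)),
      chainM i (f + f') = chainM i f + chainM i f' := fun f f' => by
    refine PiTensorProduct.ext (MultilinearMap.ext fun m => ?_)
    change chainM i (f + f') (PiTensorProduct.tprod ℚ m) =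
      chainM i f (PiTensorProduct.tprod ℚ m) + chainM i f' (PiTensorProduct.tprod ℚ m)
    rw [chainM_tprod, chainM_tprod, chainM_tprod, map_add]
  have hM' : ∀ (c : ℚ) (f : MultilinearMap ℚ (fun _ : Fin (i + 1) => H n) (⋀[ℚ]^i (H n))),
      chainM i (c • f) = c • chainM i f := fun c f => by
    refine PiTensorProduct.ext (MultilinearMap.ext fun m => ?_)
    change chainM i (c • f) (PiTensorProduct.tprod ℚ m) =
      c • chainM i f (PiTensorProduct.tprod ℚ m)
    rw [chainM_tprod, chainM_tprod, map_smul]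
  exact ⟨{  toFun := fun ξ => chainM i (wheelForm i ξ) x
            map_add' := fun ξ ξ' => by rw [hadd, hM]; rfl
            map_smul' := fun c ξ => by rw [hsmul, hM']; rfl }, fun _ => rfl⟩

theorem ChainRelated.cWheel {m : ℕ} {g : GL (Fin n) ℚ} {y y' : M n (m + 1)}
    (hy : ChainRelated g y y') :
    cWheel n (m + 1) y' = extRep (stdRep n) (m + 1) g (cWheel n (m + 1) y) := by
  rw [cWheel_eq, LinearMap.sum_apply, LinearMap.sum_apply, map_sum]
  simp only [LinearMap.comp_apply, LinearMap.applyₗ_apply_apply]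
  have h₁ : ∀ ξ v, chainM (m + 1) (wheelForm (m + 1) ξ)
      y' (stdRep n g v) =
      extRep (stdRep n) (m + 1) g
        (chainM (m + 1) (wheelForm (m + 1) (ξ ∘ₗ stdRep n g)) y v) := by
    intro ξ v
    rw [hy, wheelForm_comp, chainM_comp]
  obtain ⟨B, hB⟩ := chainM_wheelForm_linear (m + 1) y
  simp only [← hB] at h₁ ⊢
  have h₂ : ∀ l, chainM (m + 1) (wheelForm (m + 1) (dualE l)) y' (stdE l) =
      extRep (stdRep n) (m + 1) g (B (dualE l ∘ₗ stdRep n g) (stdRep n g⁻¹ (stdE l))) := by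
    intro l
    rw [← h₁, stdRep_apply_inv]
  simp only [h₂, ← map_sum]
  congr 1
  obtain ⟨B', hB'⟩ : ∃ B' : Module.Dual ℚ (H n) →ₗ[ℚ] H n →ₗ[ℚ] ⋀[ℚ]^(m + 1) (H n),
      ∀ ξ v, B' ξ v = B (ξ ∘ₗ stdRep n g) v :=
    ⟨B ∘ₗ LinearMap.lcomp ℚ ℚ (stdRep n g), fun _ _ => rfl⟩
  simp only [← hB']
  -- Invariance of the Casimir element moves `g⁻¹` from the vector to the form, where it cancels
  -- `g`.
  rw [← casimir B' g⁻¹]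
  simp only [hB']
  refine Finset.sum_congr rfl fun l _ => ?_
  congr 2
  ext v
  simp

end AlbIA

namespace AlbIA

/-! ### The contractions of the abelian cycle -/

variable {n : ℕ}

/-- For `j < k`, `x_j⁻¹ h(x_j)` is the commutator of `x_j⁻¹` and `x_k`, whose class is `-e_j ∧ e_k =
e_k ∧ e_j`. -/
theorem johnson_hIA (k j : Fin n) : (johnson n (hIA k)).toAdd (stdE j) =
    if j < k then wedge2 n (stdE k) (stdE j) else 0 := by
  have h₁ : (johnson n (hIA k)).toAdd (stdE j) =
      (toNil2 n ((FreeGroup.of j)⁻¹ * conjBelow k (FreeGroup.of j))).quad := by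
    have := (Pi.basisFun ℚ (Fin n)).constr_basis ℚ
      (fun j => (johnsonHom (hIA k) (FreeGroup.of j)).toAdd) j
    rw [Pi.basisFun_apply] at this
    exact this
  rw [h₁]
  by_cases h : j < k
  · rw [if_pos h]
    have h₂ : (FreeGroup.of j)⁻¹ * conjBelow k (FreeGroup.of j) =
        (FreeGroup.of j)⁻¹ * FreeGroup.of k * ((FreeGroup.of j)⁻¹)⁻¹ * (FreeGroup.of k)⁻¹ := by
      simp [conjBelow, h, mul_assoc]
    rw [h₂]
    simp only [map_mul, map_inv]
    have h₃ := Nil2.commutator_quad (toNil2 n (FreeGroup.of j))⁻¹ (toNil2 n (FreeGroup.of k))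
    rw [h₃, Nil2.inv_lin]
    have h₄ : ∀ l : Fin n, (toNil2 n (FreeGroup.of l)).lin = stdE l := fun l => by simp [toNil2]
    have h₅ := wedge2_self (stdE j + stdE k : H n)
    simp only [map_add, LinearMap.add_apply, wedge2_self, zero_add, add_zero] at h₅
    rw [h₄, h₄, map_neg, LinearMap.neg_apply]
    exact (eq_neg_of_add_eq_zero_left h₅).symm
  · rw [if_neg h]
    have h₂ : (FreeGroup.of j)⁻¹ * conjBelow k (FreeGroup.of j) = 1 := by
      simp [conjBelow, h]
    rw [h₂, map_one, Nil2.one_quad]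

theorem wedgeToTensor_johnson_hIA (k l : Fin n) :
    (wedgeToTensor (H n) ∘ₗ (johnson n (hIA k)).toAdd) (stdE l) =
      if l < k then stdE k ⊗ₜ stdE l - stdE l ⊗ₜ stdE k else 0 := by
  rw [LinearMap.comp_apply, johnson_hIA]
  split_ifs
  · exact wedgeToTensor_ιMulti _
  · exact map_zero _

/-- Fixing the last argument of an alternating map. -/
def AlternatingMap.snocRight {V N : Type} [AddCommGroup V] [Module ℚ V] [AddCommGroup N]
    [Module ℚ N] {i : ℕ} (f : V [⋀^Fin (i + 1)]→ₗ[ℚ] N) (b : V) : V [⋀^Fin i]→ₗ[ℚ] N where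
  toMultilinearMap := (LinearMap.applyₗ b).compMultilinearMap f.toMultilinearMap.curryRight
  map_eq_zero_of_eq' v j k h hjk :=
    f.map_eq_zero_of_eq (Fin.snoc (α := fun _ => V) v b) (i := j.castSucc) (j := k.castSucc)
      (by simpa using h) (by simpa using hjk)

/-- With the last argument fixed, an alternating map is alternating in the others, so a permutation
contributes only its sign. -/
theorem snoc_perm {V N : Type} [AddCommGroup V] [Module ℚ V] [AddCommGroup N]
    [Module ℚ N] {i : ℕ} (f : V [⋀^Fin (i + 1)]→ₗ[ℚ] N) (a : Fin i → V) (b : V)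
    (σ : Equiv.Perm (Fin i)) :
    f (Fin.snoc (α := fun _ => V) (fun j => a (σ j)) b) =
      Equiv.Perm.sign σ • f (Fin.snoc (α := fun _ => V) a b) :=
  (AlternatingMap.snocRight f b).map_perm a σ

theorem sign_smul_sign_smul {N : Type} [AddCommGroup N] [Module ℚ N] {i : ℕ}
    (σ : Equiv.Perm (Fin i)) (x : N) :
    ((Equiv.Perm.sign σ : ℤ) : ℚ) • Equiv.Perm.sign σ • x = x := by
  rcases Int.units_eq_one_or (Equiv.Perm.sign σ) with h | h <;> simp [h]

section Alpha
variable {i : ℕ} (hn : i + 1 ≤ n)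

/-- The index `k - 1` of the generator `x_k` in `h_{k,1}` for the `j`-th element of the cycle. -/
def cycleIdx (j : Fin i) : Fin n := ⟨j + 1, by omega⟩

theorem iota_alphaAlb : iota n i (albToWedge n i (alphaAlb n i hn)) =
    iota n i (exteriorPower.ιMulti ℚ i (M := U n 1)
      fun j => (johnson n (hIA (cycleIdx hn j))).toAdd) := by
  rw [albToWedge_alphaAlb]
  rfl

/-- For each `σ`, reordering the wedge cancels `sgn(σ)`, so the nonnegative multiplicities of
`chain_alternating` add without cancellation. They are positive at `e_1`, whose index lies below all
those of the cycle. At every other `e_l` the value is zero. -/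
theorem cMap_alpha [NeZero i] : ∃ C : ℕ, 0 < C ∧ ∀ l : Fin n,
    cMap n i (iota n i (albToWedge n i (alphaAlb n i hn))) (stdE l) =
      if (l : ℕ) = 0 then C • exteriorPower.ιMulti ℚ (i + 1)
        (Fin.snoc (α := fun _ => H n) (fun j => stdE (cycleIdx hn j)) (stdE l)) else 0 := by
  obtain ⟨m, rfl⟩ := Nat.exists_eq_succ_of_ne_zero (NeZero.ne i)
  have key : ∀ (σ : Equiv.Perm (Fin (m + 1))) (l : Fin n), ∃ c : ℕ,
      chain (fun j => wedgeToTensor (H n) ∘ₗ (johnson n (hIA (cycleIdx hn (σ j)))).toAdd)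
        (exteriorPower.ιMulti ℚ (m + 2) (M := H n)).toMultilinearMap (stdE l) =
      c • exteriorPower.ιMulti ℚ (m + 2)
        (Fin.snoc (α := fun _ => H n) (fun j => stdE (cycleIdx hn (σ j))) (stdE l)) ∧
      ((∀ j, l < cycleIdx hn (σ j)) → 0 < c) ∧
        (∀ h : 0 < m + 1, ¬ l < cycleIdx hn (σ ⟨0, h⟩) → c = 0) := fun σ l =>
    chain_alternating (fun j => wedgeToTensor (H n) ∘ₗ (johnson n (hIA (cycleIdx hn (σ j)))).toAdd)
      (fun j => cycleIdx hn (σ j)) (fun j l => wedgeToTensor_johnson_hIA _ l)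
      (exteriorPower.ιMulti ℚ (m + 2) (M := H n)) l
  choose c h₁ h₂ h₃ using key
  have h₀ : (0 : ℕ) < n := by omega
  refine ⟨∑ σ, c σ ⟨0, h₀⟩, Finset.sum_pos (fun σ _ => h₂ σ _ fun j => ?_)
    Finset.univ_nonempty, fun l => ?_⟩
  · simp [cycleIdx, Fin.lt_def]
  · rw [iota_alphaAlb, cMap_eq, chainM_iota_ιMulti]
    simp only [h₁]
    have h₄ : ∀ σ : Equiv.Perm (Fin (m + 1)), ((Equiv.Perm.sign σ : ℤ) : ℚ) • c σ l •
        exteriorPower.ιMulti ℚ (m + 2)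
          (Fin.snoc (α := fun _ => H n) (fun j => stdE (cycleIdx hn (σ j))) (stdE l)) =
        c σ l • exteriorPower.ιMulti ℚ (m + 2)
          (Fin.snoc (α := fun _ => H n) (fun j => stdE (cycleIdx hn j)) (stdE l)) := by
      intro σ
      rw [snoc_perm _ (fun j => stdE (cycleIdx hn j)), smul_comm, sign_smul_sign_smul]
    simp only [h₄, ← Finset.sum_smul]
    split_ifs with hl
    · have : l = ⟨0, h₀⟩ := Fin.ext hl
      rw [this]
    -- If `1 ≤ l ≤ m + 1`, then `e_l` already occurs in the wedge, as entry `l - 1` of the cycle. If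
    -- `l` is larger, no index of the cycle exceeds it and the first contraction gives zero.
    · by_cases hl' : (l : ℕ) ≤ m + 1
      · have h₅ : exteriorPower.ιMulti ℚ (m + 2) (M := H n)
            (Fin.snoc (α := fun _ => H n) (fun j => stdE (cycleIdx hn j)) (stdE l)) = 0 := by
          refine AlternatingMap.map_eq_zero_of_eq _ _
            (i := Fin.castSucc ⟨l - 1, by omega⟩) (j := Fin.last _) ?_ (Fin.castSucc_lt_last _).ne
          rw [Fin.snoc_castSucc, Fin.snoc_last]
          congr 1
          ext
          simp only [cycleIdx]
          omega
        rw [h₅, smul_zero]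
      · have h₅ : ∀ σ, c σ l = 0 := fun σ => h₃ σ l (Nat.succ_pos m) fun h => by
          rw [Fin.lt_def] at h
          simp only [cycleIdx] at h
          omega
        simp [h₅]

/-- Only the diagonal term of the trace at index `0` survives, and every permutation contributes the
same wedge there, whence `i!`. -/
theorem cWheel_alpha [NeZero i] :
    cWheel n i (iota n i (albToWedge n i (alphaAlb n i hn))) =
      i.factorial • exteriorPower.ιMulti ℚ i fun j => (stdE (cycleIdx hn j) : H n) := by
  obtain ⟨m, rfl⟩ := Nat.exists_eq_succ_of_ne_zero (NeZero.ne i)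
  have key : ∀ (l : Fin n) (σ : Equiv.Perm (Fin (m + 1))),
      ((Equiv.Perm.sign σ : ℤ) : ℚ) •
      chain (fun j => wedgeToTensor (H n) ∘ₗ (johnson n (hIA (cycleIdx hn (σ j)))).toAdd)
        (wheelForm (m + 1) (dualE l)) (stdE l) =
      if (l : ℕ) = 0 then
        exteriorPower.ιMulti ℚ (m + 1) fun j => (stdE (cycleIdx hn j) : H n) else 0 := by
    intro l σ
    have h₁ := chain_triangular
      (fun j => wedgeToTensor (H n) ∘ₗ (johnson n (hIA (cycleIdx hn (σ j)))).toAdd)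
      (fun j => cycleIdx hn (σ j)) (fun j l => wedgeToTensor_johnson_hIA _ l)
      (wheelForm (m + 1) (dualE l)) l fun a b hb => by
        rw [wheelForm_snoc]
        simp [dualE, hb.ne]
    have h₂ : (∀ j, l < cycleIdx hn (σ j)) ↔ (l : ℕ) = 0 := by
      constructor
      · intro h
        -- Position `σ⁻¹ 0` carries `h_{2,1}`, whose index is `1`, so `l < 1`.
        have := h (σ⁻¹ 0)
        simpa [cycleIdx, Fin.lt_def] using this
      · intro h j
        simp [cycleIdx, Fin.lt_def, h]
    have h₃ := (exteriorPower.ιMulti ℚ (m + 1) (M := H n)).map_perm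
      (fun j => stdE (cycleIdx hn j)) σ
    rw [h₁, if_congr h₂ rfl rfl]
    split_ifs
    · rw [wheelForm_snoc]
      have h₄ : dualE l (stdE l : H n) = 1 := by simp [dualE]
      rw [h₄, one_smul]
      refine (congrArg _ h₃).trans ?_
      exact sign_smul_sign_smul _ _
    · rw [smul_zero]
  have h₀ : (0 : ℕ) < n := by omega
  rw [iota_alphaAlb, cWheel_eq, LinearMap.sum_apply]
  simp only [LinearMap.comp_apply, LinearMap.applyₗ_apply_apply, chainM_iota_ιMulti, key]
  rw [Finset.sum_eq_single (⟨0, h₀⟩ : Fin n)]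
  · simp [Finset.card_univ, Fintype.card_perm]
  · intro l _ hl
    have : ¬ (l : ℕ) = 0 := fun h => hl (Fin.ext h)
    simp [this]
  · simp

end Alpha

end AlbIA

namespace AlbIA

/-! ### The decomposition into tree part and wheel part -/

variable {n : ℕ}

theorem wheelIncl_ιMulti (i : ℕ) (a : Fin i → H n) (v : H n) :
    wheelIncl n i (exteriorPower.ιMulti ℚ i a) v =
      exteriorPower.ιMulti ℚ (i + 1) (Fin.cons (α := fun _ => H n) v a) := by
  rw [wheelIncl, LinearMap.flip_apply, LinearMap.comp_apply, LinearEquiv.coe_coe,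
    exteriorPower.alternatingMapLinearEquiv_apply_ιMulti]
  rfl

theorem interior_ιMulti (i : ℕ) (f : Module.Dual ℚ (H n)) (v : Fin (i + 1) → H n) :
    interior i f (exteriorPower.ιMulti ℚ (i + 1) v) =
      ∑ k : Fin (i + 1), (-1 : ℤ) ^ (k : ℕ) • f (v k) •
        exteriorPower.ιMulti ℚ i (Fin.removeNth k v) := by
  rw [interior, exteriorPower.alternatingMapLinearEquiv_apply_ιMulti,
    AlternatingMap.alternatizeUncurryFin_apply]
  rfl

/-- The interior product is an antiderivation; the first summand removes `v` itself. -/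
theorem interior_wheelIncl (m : ℕ) (f : Module.Dual ℚ (H n)) (w : ⋀[ℚ]^(m + 1) (H n)) (v : H n) :
    interior (m + 1) f (wheelIncl n (m + 1) w v) =
      f v • w - wheelIncl n m (interior m f w) v := by
  have h : interior (m + 1) f ∘ₗ LinearMap.applyₗ v ∘ₗ wheelIncl n (m + 1) =
      f v • LinearMap.id - LinearMap.applyₗ v ∘ₗ wheelIncl n m ∘ₗ interior m f := by
    refine exteriorPower_hom_ext fun a => ?_
    simp only [LinearMap.comp_apply, LinearMap.applyₗ_apply_apply, LinearMap.sub_apply,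
      LinearMap.smul_apply, LinearMap.id_apply]
    rw [wheelIncl_ιMulti, interior_ιMulti, Fin.sum_univ_succ, interior_ιMulti, map_sum,
      LinearMap.sum_apply, sub_eq_add_neg, ← Finset.sum_neg_distrib]
    congr 1
    · simp only [Fin.val_zero, pow_zero, one_smul, Fin.cons_zero]
      rfl
    · refine Finset.sum_congr rfl fun k _ => ?_
      rw [map_zsmul, map_smul, LinearMap.smul_apply, LinearMap.smul_apply, wheelIncl_ιMulti,
        Fin.cons_succ, Fin.val_succ, pow_succ, mul_neg_one, neg_smul]
      congr 4
      funext l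
      refine Fin.cases ?_ (fun l => ?_) l
      · rfl
      · simp [Fin.removeNth, Fin.succ_succAbove_succ]
  exact LinearMap.congr_fun h w

/-- Euler's formula: removing one factor and wedging it back in front restores `w`, once for each of
the `m + 1` positions. -/
theorem sum_wheelIncl_interior (m : ℕ) (w : ⋀[ℚ]^(m + 1) (H n)) :
    ∑ k, wheelIncl n m (interior m (dualE k) w) (stdE k) = ((m : ℚ) + 1) • w := by
  have h : ∑ k, LinearMap.applyₗ (stdE k) ∘ₗ wheelIncl n m ∘ₗ interior m (dualE k) =
      ((m : ℚ) + 1) • LinearMap.id := by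
    refine exteriorPower_hom_ext fun a => ?_
    simp only [LinearMap.comp_apply, LinearMap.sum_apply, LinearMap.applyₗ_apply_apply,
      LinearMap.smul_apply, LinearMap.id_apply, interior_ιMulti, map_sum, map_zsmul, map_smul,
      wheelIncl_ιMulti]
    rw [Finset.sum_comm]
    have key : ∀ l : Fin (m + 1), ∑ k, ((-1 : ℤ) ^ (l : ℕ) • dualE k (a l) •
        exteriorPower.ιMulti ℚ (m + 1)
          (Fin.cons (α := fun _ => H n) (stdE k) (Fin.removeNth l a))) =
        exteriorPower.ιMulti ℚ (m + 1) a := by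
      intro l
      simp only [← wheelIncl_ιMulti, ← map_smul]
      rw [← Finset.smul_sum, ← map_sum]
      have : ∑ k, dualE k (a l) • stdE k = a l := (sum_stdE (a l)).symm
      rw [this, wheelIncl_ιMulti]
      -- Moving `a l` from the front back to place `l` produces the sign `(-1)^l`, which cancels
      -- that of the interior product.
      have h₁ := AlternatingMap.neg_one_pow_smul_map_insertNth (exteriorPower.ιMulti ℚ (m + 1)) l
        (a l) (Fin.removeNth l a)
      rw [Fin.insertNth_removeNth, Function.update_eq_self] at h₁
      rw [Matrix.vecCons] at h₁
      rw [← h₁, smul_smul, ← mul_pow]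
      simp
    rw [Finset.sum_congr rfl fun l _ => key l]
    rw [Finset.sum_const, Finset.card_univ, Fintype.card_fin, ← Nat.cast_smul_eq_nsmul ℚ]
    push_cast
    rfl
  have := LinearMap.congr_fun h w
  rw [LinearMap.sum_apply] at this
  exact this

theorem traceMap_apply (i : ℕ) (u : U n i) :
    traceMap n i u = ∑ k, interior i (dualE k) (u (stdE k)) := by
  rw [traceMap, LinearMap.sum_apply]
  rfl

/-- The antiderivation rule gives `n` from `∑ e_k^*(e_k)` and subtracts the degree `m + 1` by
Euler's formula. For `n > i` this scalar is nonzero, which splits `U_i`. -/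
theorem traceMap_wheelIncl (m : ℕ) (w : ⋀[ℚ]^(m + 1) (H n)) :
    traceMap n (m + 1) (wheelIncl n (m + 1) w) = ((n : ℚ) - (m + 1)) • w := by
  rw [traceMap_apply]
  simp only [interior_wheelIncl]
  rw [Finset.sum_sub_distrib, sum_wheelIncl_interior]
  refine Eq.trans ?_ (sub_smul (n : ℚ) ((m : ℚ) + 1) w).symm
  congr 1
  have : ∀ k : Fin n, dualE k (stdE k : H n) = 1 := fun k => by simp [dualE]
  simp only [this, one_smul, Finset.sum_const, Finset.card_univ, Fintype.card_fin,
    Nat.cast_smul_eq_nsmul]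

theorem interior_extRep (i : ℕ) (f : Module.Dual ℚ (H n)) (g : GL (Fin n) ℚ)
    (w : ⋀[ℚ]^(i + 1) (H n)) : interior i f (extRep (stdRep n) (i + 1) g w) =
      extRep (stdRep n) i g (interior i (f ∘ₗ stdRep n g) w) := by
  have h : interior i f ∘ₗ extRep (stdRep n) (i + 1) g =
      extRep (stdRep n) i g ∘ₗ interior i (f ∘ₗ stdRep n g) := by
    refine exteriorPower_hom_ext fun a => ?_
    simp only [LinearMap.comp_apply, extRep_ιMulti, interior_ιMulti, map_sum, map_zsmul, map_smul]
    rfl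
  exact LinearMap.congr_fun h w

theorem interior_linear (i : ℕ) (u : U n i) :
    ∃ B : Module.Dual ℚ (H n) →ₗ[ℚ] H n →ₗ[ℚ] ⋀[ℚ]^i (H n),
      ∀ ξ v, B ξ v = interior i ξ (u v) := by
  have hadd : ∀ ξ ξ' : Module.Dual ℚ (H n),
      interior i (ξ + ξ') = interior i ξ + interior i ξ' := fun ξ ξ' => by
    refine exteriorPower_hom_ext fun a => ?_
    simp only [interior_ιMulti, LinearMap.add_apply, add_smul, smul_add, Finset.sum_add_distrib]
  have hsmul : ∀ (c : ℚ) (ξ : Module.Dual ℚ (H n)),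
      interior i (c • ξ) = c • interior i ξ := fun c ξ => by
    refine exteriorPower_hom_ext fun a => ?_
    simp only [interior_ιMulti, LinearMap.smul_apply, Finset.smul_sum, smul_eq_mul, mul_smul]
    exact Finset.sum_congr rfl fun k _ => smul_comm _ _ _
  exact ⟨{  toFun := fun ξ => interior i ξ ∘ₗ u
            map_add' := fun ξ ξ' => by rw [hadd]; rfl
            map_smul' := fun c ξ => by rw [hsmul]; rfl }, fun _ _ => rfl⟩

/-- The contraction is a pairing with the Casimir element, so its equivariance is again an instance
of `casimir`. -/
theorem traceMap_uRep (i : ℕ) (g : GL (Fin n) ℚ) (u : U n i) :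
    traceMap n i (uRep n i g u) = extRep (stdRep n) i g (traceMap n i u) := by
  obtain ⟨B, hB⟩ := interior_linear i u
  simp only [traceMap_apply, uRep_apply, interior_extRep, ← map_sum, ← hB]
  congr 1
  obtain ⟨B', hB'⟩ : ∃ B' : Module.Dual ℚ (H n) →ₗ[ℚ] H n →ₗ[ℚ] ⋀[ℚ]^i (H n),
      ∀ ξ v, B' ξ v = B (ξ ∘ₗ stdRep n g) v :=
    ⟨B ∘ₗ LinearMap.lcomp ℚ ℚ (stdRep n g), fun _ _ => rfl⟩
  simp only [← hB']
  rw [← casimir B' g⁻¹]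
  simp only [hB']
  refine Finset.sum_congr rfl fun l _ => ?_
  congr 2
  ext v
  simp

theorem uRep_wheelIncl (i : ℕ) (g : GL (Fin n) ℚ) (w : ⋀[ℚ]^i (H n)) :
    uRep n i g (wheelIncl n i w) = wheelIncl n i (extRep (stdRep n) i g w) := by
  refine LinearMap.ext fun v => ?_
  have h : LinearMap.applyₗ v ∘ₗ uRep n i g ∘ₗ wheelIncl n i =
      LinearMap.applyₗ v ∘ₗ wheelIncl n i ∘ₗ extRep (stdRep n) i g := by
    refine exteriorPower_hom_ext fun a => ?_
    simp only [LinearMap.comp_apply, LinearMap.applyₗ_apply_apply, uRep_apply, wheelIncl_ιMulti,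
      extRep_ιMulti]
    congr 1
    funext k
    refine Fin.cases ?_ (fun k => ?_) k
    · exact stdRep_apply_inv g v
    · rfl
  exact LinearMap.congr_fun h w

/-! ### Splittings from maps `T`, `J` with `T ∘ J` a nonzero scalar -/

section Retraction
variable {E F : Type} [AddCommGroup E] [Module ℚ E] [AddCommGroup F] [Module ℚ F]
  {T : E →ₗ[ℚ] F} {J : F →ₗ[ℚ] E} {c : ℚ}

theorem injective_of_retraction (hc : c ≠ 0) (h : ∀ w, T (J w) = c • w) :
    Function.Injective J := by
  rw [injective_iff_map_eq_zero]
  intro w hw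
  have := h w
  rw [hw, map_zero] at this
  exact (smul_eq_zero.mp this.symm).resolve_left hc

theorem sub_mem_ker_of_retraction (hc : c ≠ 0) (h : ∀ w, T (J w) = c • w) (u : E) :
    u - c⁻¹ • J (T u) ∈ LinearMap.ker T := by
  rw [LinearMap.mem_ker, map_sub, map_smul, h, inv_smul_smul₀ hc, sub_self]

theorem isCompl_of_retraction (hc : c ≠ 0) (h : ∀ w, T (J w) = c • w) :
    IsCompl (LinearMap.ker T) (LinearMap.range J) := by
  constructor
  · rw [Submodule.disjoint_def]
    rintro _ h' ⟨w, rfl⟩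
    rw [LinearMap.mem_ker, h] at h'
    rw [(smul_eq_zero.mp h').resolve_left hc, map_zero]
  · rw [codisjoint_iff, eq_top_iff]
    intro u _
    rw [Submodule.mem_sup]
    exact ⟨_, sub_mem_ker_of_retraction hc h u, _,
      Submodule.smul_mem _ c⁻¹ ⟨T u, rfl⟩, sub_add_cancel _ _⟩

/-- The projection is `u ↦ u - c⁻¹ J(T u)`; its equivariance then follows from that of `T` and `J`.
-/
theorem projection_of_retraction (hc : c ≠ 0) (h : ∀ w, T (J w) = c • w)
    (hcompl : IsCompl (LinearMap.ker T) (LinearMap.range J)) (u : E) :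
    Submodule.projection (LinearMap.ker T) (LinearMap.range J) hcompl u + c⁻¹ • J (T u) = u := by
  have h' : u = (u - c⁻¹ • J (T u)) + c⁻¹ • J (T u) := (sub_add_cancel _ _).symm
  have h₁ : Submodule.projection (LinearMap.ker T) (LinearMap.range J) hcompl u =
      u - c⁻¹ • J (T u) := by
    conv_lhs => rw [h']
    rw [map_add, Submodule.projection_apply_of_mem_left hcompl (sub_mem_ker_of_retraction hc h u),
      Submodule.projection_apply_of_mem_right hcompl
        (Submodule.smul_mem _ _ ⟨T u, rfl⟩), add_zero]
  rw [h₁, sub_add_cancel]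

theorem projection_of_retraction_comm (hc : c ≠ 0) (h : ∀ w, T (J w) = c • w)
    (hcompl : IsCompl (LinearMap.ker T) (LinearMap.range J)) (g : E →ₗ[ℚ] E) (g' : F →ₗ[ℚ] F)
    (hT : ∀ u, T (g u) = g' (T u)) (hJ : ∀ w, g (J w) = J (g' w)) (u : E) :
    Submodule.projection (LinearMap.ker T) (LinearMap.range J) hcompl (g u) =
      g (Submodule.projection (LinearMap.ker T) (LinearMap.range J) hcompl u) := by
  have h₁ := projection_of_retraction hc h hcompl (g u)
  have h₂ := congrArg g (projection_of_retraction hc h hcompl u)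
  rw [map_add, map_smul, hJ, ← hT] at h₂
  exact add_right_cancel (h₁.trans h₂.symm)

end Retraction

section Split
variable {i : ℕ} [NeZero i]

theorem traceMap_wheelIncl' (w : ⋀[ℚ]^i (H n)) :
    traceMap n i (wheelIncl n i w) = ((n : ℚ) - i) • w := by
  obtain ⟨m, rfl⟩ := Nat.exists_eq_succ_of_ne_zero (NeZero.ne i)
  have h := traceMap_wheelIncl m w
  rw [h]
  simp

theorem cast_sub_cast_ne_zero {n i : ℕ} (hn : i + 1 ≤ n) : (n : ℚ) - i ≠ 0 := by
  have : (i : ℚ) + 1 ≤ n := by exact_mod_cast hn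
  linarith

theorem wheelIncl_injective (hn : i + 1 ≤ n) : Function.Injective (wheelIncl n i) :=
  injective_of_retraction (E := U n i) (cast_sub_cast_ne_zero hn) traceMap_wheelIncl'

theorem isCompl_treePart_wheelPart (hn : i + 1 ≤ n) :
    IsCompl (treePart n i) (wheelPart n i) := by
  have h := @isCompl_of_retraction (U n i) (⋀[ℚ]^i (H n)) _ _ _ _ (traceMap n i) (wheelIncl n i)
    ((n : ℚ) - i) (cast_sub_cast_ne_zero hn) traceMap_wheelIncl'
  unfold treePart wheelPart
  exact h

theorem projection_treePart (hn : i + 1 ≤ n) (hc : IsCompl (treePart n i) (wheelPart n i))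
    (u : U n i) : Submodule.projection (R := ℚ) (E := U n i) (treePart n i) (wheelPart n i) hc u +
      ((n : ℚ) - i)⁻¹ • wheelIncl n i (traceMap n i u) = u := by
  have h := @projection_of_retraction (U n i) (⋀[ℚ]^i (H n)) _ _ _ _ (traceMap n i)
    (wheelIncl n i) ((n : ℚ) - i) (cast_sub_cast_ne_zero hn) traceMap_wheelIncl'
  unfold treePart wheelPart at hc
  exact h hc u

theorem projection_treePart_uRep (hn : i + 1 ≤ n) (hc : IsCompl (treePart n i) (wheelPart n i))
    (g : GL (Fin n) ℚ) (u : U n i) :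
    Submodule.projection (R := ℚ) (E := U n i) (treePart n i) (wheelPart n i) hc (uRep n i g u) =
      uRep n i g (Submodule.projection (R := ℚ) (E := U n i) (treePart n i) (wheelPart n i) hc u) := by
  have h := @projection_of_retraction_comm (U n i) (⋀[ℚ]^i (H n)) _ _ _ _ (traceMap n i)
    (wheelIncl n i) ((n : ℚ) - i) (cast_sub_cast_ne_zero hn) traceMap_wheelIncl'
  unfold treePart wheelPart at hc
  have h₁ := h hc (uRep n i g) (extRep (stdRep n) i g) (traceMap_uRep i g)
    (fun w => uRep_wheelIncl i g w) u
  exact h₁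

end Split

end AlbIA

namespace AlbIA

/-! ### Generation of the tree part and of the wheel part -/

variable {n : ℕ}

/-- Permutation matrices. -/
noncomputable def permGL (p : Equiv.Perm (Fin n)) : GL (Fin n) ℚ :=
  Matrix.GeneralLinearGroup.toLin.symm
    (LinearMap.GeneralLinearGroup.ofLinearEquiv (LinearEquiv.funCongrLeft ℚ ℚ p.symm))

theorem stdRep_permGL (p : Equiv.Perm (Fin n)) (j : Fin n) :
    stdRep n (permGL p) (stdE j) = stdE (p j) := by
  have h : stdRep n (permGL p) (stdE j) =
      (Matrix.GeneralLinearGroup.toLin (permGL p)).1 (stdE j) := rfl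
  rw [h, permGL, MulEquiv.apply_symm_apply]
  change (stdE j : H n) ∘ p.symm = stdE (p j)
  funext l
  simp [Pi.single_apply, Equiv.symm_apply_eq]

theorem permGL_inv (p : Equiv.Perm (Fin n)) (j : Fin n) :
    stdRep n (permGL p)⁻¹ (stdE j) = stdE (p⁻¹ j) := by
  have := stdRep_inv_apply (permGL p) (stdE (p⁻¹ j))
  rw [stdRep_permGL] at this
  simpa using this

theorem exists_perm_extending {k : ℕ} {κ κ' : Fin k → Fin n} (hκ : Function.Injective κ)
    (hκ' : Function.Injective κ') : ∃ p : Equiv.Perm (Fin n), ∀ j, p (κ j) = κ' j := by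
  obtain ⟨p, hp⟩ := MulAction.isMultiplyPretransitive_iff.mp
    (Equiv.Perm.isMultiplyPretransitive (Fin n) k) ⟨κ, hκ⟩ ⟨κ', hκ'⟩
  exact ⟨p, fun j => DFunLike.congr_fun hp j⟩

/-- The exterior product of standard basis vectors. -/
noncomputable def eWedge {k : ℕ} (κ : Fin k → Fin n) : ⋀[ℚ]^k (H n) :=
  exteriorPower.ιMulti ℚ k fun j => stdE (κ j)

/-- The minor on the coordinates `κ` is an alternating form that takes the value `1` on this wedge.
-/
theorem eWedge_ne_zero {k : ℕ} {κ : Fin k → Fin n} (hκ : Function.Injective κ) :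
    eWedge κ ≠ 0 := by
  intro h
  have h₁ := exteriorPower.alternatingMapLinearEquiv_apply_ιMulti
    ((Matrix.detRowAlternating (R := ℚ) (n := Fin k)).compLinearMap (LinearMap.funLeft ℚ ℚ κ))
    (fun j => stdE (κ j))
  have h₂ : (fun j : Fin k => LinearMap.funLeft ℚ ℚ κ (stdE (κ j))) =
      (1 : Matrix (Fin k) (Fin k) ℚ) := by
    ext j l
    simp [LinearMap.funLeft_apply, Pi.single_apply, Matrix.one_apply, hκ.eq_iff, eq_comm]
  have h₃ : ((Matrix.detRowAlternating (R := ℚ) (n := Fin k)).compLinearMap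
      (LinearMap.funLeft ℚ ℚ κ)) (fun j => stdE (κ j)) = 1 := by
    rw [AlternatingMap.compLinearMap_apply, h₂]
    exact Matrix.det_one
  rw [h₃] at h₁
  unfold eWedge at h
  rw [h, map_zero] at h₁
  exact zero_ne_one h₁

theorem eWedge_eq_zero {k : ℕ} {κ : Fin k → Fin n} (hκ : ¬ Function.Injective κ) :
    eWedge κ = 0 := by
  rw [Function.Injective] at hκ
  push Not at hκ
  obtain ⟨a, b, h, hab⟩ := hκ
  exact AlternatingMap.map_eq_zero_of_eq _ _ (by simp only [h]) hab

theorem eWedge_hom_ext {k : ℕ} {N : Type} [AddCommGroup N] [Module ℚ N]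
    {A B : ⋀[ℚ]^k (H n) →ₗ[ℚ] N}
    (h : ∀ κ : Fin k → Fin n, Function.Injective κ → A (eWedge κ) = B (eWedge κ)) : A = B := by
  refine exteriorPower.linearMap_ext (Module.Basis.ext_alternating (Pi.basisFun ℚ (Fin n))
    fun κ hκ => ?_)
  simp only [Pi.basisFun_apply]
  exact h κ hκ

theorem extRep_permGL {k : ℕ} (p : Equiv.Perm (Fin n)) (κ : Fin k → Fin n) :
    extRep (stdRep n) k (permGL p) (eWedge κ) = eWedge (p ∘ κ) := by
  rw [eWedge, extRep_ιMulti, eWedge]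
  simp only [stdRep_permGL, Function.comp_apply]

/-- The element `(e_{κ 0} ∧ … ∧ e_{κ i}) ⊗ e_k^*` of `U_i`. -/
noncomputable def eU {i : ℕ} (κ : Fin (i + 1) → Fin n) (k : Fin n) : U n i :=
  (dualE k).smulRight (eWedge κ)

theorem eU_stdE {i : ℕ} (κ : Fin (i + 1) → Fin n) (k l : Fin n) :
    eU κ k (stdE l) = if l = k then eWedge κ else 0 := by
  rw [eU, LinearMap.smulRight_apply]
  by_cases h : l = k <;> simp [dualE, h]

theorem eU_eq_zero {i : ℕ} {κ : Fin (i + 1) → Fin n} (hκ : ¬ Function.Injective κ) (k : Fin n) :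
    eU κ k = 0 := by
  refine (Pi.basisFun ℚ (Fin n)).ext fun l => ?_
  rw [Pi.basisFun_apply, eU_stdE, eWedge_eq_zero hκ, ite_self, LinearMap.zero_apply]

theorem eU_hom_ext {i : ℕ} {N : Type} [AddCommGroup N] [Module ℚ N] {A B : U n i →ₗ[ℚ] N}
    (h : ∀ (κ : Fin (i + 1) → Fin n) (k : Fin n), Function.Injective κ →
      A (eU κ k) = B (eU κ k)) : A = B := by
  have h₁ : ∀ k, A ∘ₗ LinearMap.smulRightₗ (R := ℚ) (M := ⋀[ℚ]^(i + 1) (H n)) (dualE k) =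
      B ∘ₗ LinearMap.smulRightₗ (R := ℚ) (M := ⋀[ℚ]^(i + 1) (H n)) (dualE k) := fun k =>
    eWedge_hom_ext fun κ hκ => h κ k hκ
  refine LinearMap.ext fun u => ?_
  have h₂ : u = ∑ k, LinearMap.smulRightₗ (R := ℚ) (M := ⋀[ℚ]^(i + 1) (H n)) (dualE k)
      (u (stdE k)) := by
    refine LinearMap.ext fun v => ?_
    conv_lhs => rw [sum_stdE v, map_sum]
    rw [LinearMap.sum_apply]
    refine Finset.sum_congr rfl fun k _ => ?_
    rw [map_smul]
    rfl
  rw [h₂, map_sum, map_sum]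
  exact Finset.sum_congr rfl fun k _ => LinearMap.congr_fun (h₁ k) _

theorem uRep_smulRight {i : ℕ} (g : GL (Fin n) ℚ) (f : Module.Dual ℚ (H n))
    (w : ⋀[ℚ]^(i + 1) (H n)) : uRep n i g (f.smulRight w) =
      (f ∘ₗ stdRep n g⁻¹).smulRight (extRep (stdRep n) (i + 1) g w) := by
  refine LinearMap.ext fun v => ?_
  rw [uRep_apply, LinearMap.smulRight_apply, LinearMap.smulRight_apply, map_smul]
  rfl

theorem uRep_permGL {i : ℕ} (p : Equiv.Perm (Fin n)) (κ : Fin (i + 1) → Fin n) (k : Fin n) :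
    uRep n i (permGL p) (eU κ k) = eU (p ∘ κ) (p k) := by
  rw [eU, uRep_smulRight, extRep_permGL, eU]
  congr 1
  refine (Pi.basisFun ℚ (Fin n)).ext fun l => ?_
  rw [Pi.basisFun_apply, LinearMap.comp_apply, permGL_inv]
  simp [dualE, Pi.single_apply, Equiv.Perm.inv_def, Equiv.eq_symm_apply]

theorem stdRep_transvGL_same {a b : Fin n} (h : a ≠ b) :
    stdRep n (transvGL h 1) (stdE b) = stdE a + stdE b := by
  rw [stdRep_transvGL]
  simp [add_comm]

theorem stdRep_transvGL_ne {a b c : Fin n} (h : a ≠ b) (hc : c ≠ b) :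
    stdRep n (transvGL h 1) (stdE c) = stdE c := by
  rw [stdRep_transvGL]
  simp [hc.symm]

theorem dualE_transvGL_inv {a b : Fin n} (h : a ≠ b) (k : Fin n) :
    dualE k ∘ₗ stdRep n (transvGL h 1)⁻¹ = dualE k + if k = a then - dualE b else 0 := by
  refine LinearMap.ext fun v => ?_
  rw [transvGL_inv, LinearMap.comp_apply, stdRep_transvGL, LinearMap.add_apply]
  by_cases hk : k = a
  · subst hk; simp [dualE]
  · simp [dualE, hk]

theorem extRep_transvGL_eq {k : ℕ} {a b : Fin n} (h : a ≠ b) {κ : Fin k → Fin n}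
    (hκ : ∀ j, κ j ≠ b) : extRep (stdRep n) k (transvGL h 1) (eWedge κ) = eWedge κ := by
  rw [eWedge, extRep_ιMulti]
  congr 1
  funext j
  exact stdRep_transvGL_ne h (hκ j)

theorem extRep_transvGL_cons {k : ℕ} {a b : Fin n} (h : a ≠ b) {κ : Fin k → Fin n}
    (hκ : ∀ j, κ j ≠ b) : extRep (stdRep n) (k + 1) (transvGL h 1)
      (eWedge (Fin.cons (α := fun _ => Fin n) b κ)) =
      eWedge (Fin.cons (α := fun _ => Fin n) a κ) + eWedge (Fin.cons (α := fun _ => Fin n) b κ) := by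
  have h₀ : ∀ c : Fin n, (fun j => (stdE ((Fin.cons (α := fun _ => Fin n) c κ : Fin (k + 1) → Fin n) j) : H n)) =
      Fin.cons (α := fun _ => H n) (stdE c) fun j => stdE (κ j) := fun c => by
    funext j
    refine Fin.cases ?_ (fun j => ?_) j <;> rfl
  have h₁ : (fun j => stdRep n (transvGL h 1)
      (stdE ((Fin.cons (α := fun _ => Fin n) b κ : Fin (k + 1) → Fin n) j))) =
      Fin.cons (α := fun _ => H n) (stdE a + stdE b) fun j => stdE (κ j) := by
    funext j
    refine Fin.cases ?_ (fun j => ?_) j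
    · exact stdRep_transvGL_same h
    · exact stdRep_transvGL_ne h (hκ j)
  unfold eWedge
  rw [extRep_ιMulti, h₁, h₀, h₀]
  exact (exteriorPower.ιMulti ℚ (k + 1) (M := H n)).toMultilinearMap.cons_add _ _ _

/-- Expanding `f` in the dual basis shows that contracting `w ⊗ f` is the interior product with `f`.
-/
theorem traceMap_smulRight {i : ℕ} (f : Module.Dual ℚ (H n)) (w : ⋀[ℚ]^(i + 1) (H n)) :
    traceMap n i (f.smulRight w) = interior i f w := by
  rw [traceMap_apply]
  have h₁ : ∑ k, interior i (dualE k) (f.smulRight w (stdE k)) =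
      ∑ k, f (stdE k) • interior i (dualE k) w := by simp
  have h₂ : ∀ a, ∑ k, f (stdE k) • interior i (dualE k) (exteriorPower.ιMulti ℚ (i + 1) a) =
      interior i f (exteriorPower.ιMulti ℚ (i + 1) a) := fun a => by
    simp only [interior_ιMulti, Finset.smul_sum]
    rw [Finset.sum_comm]
    refine Finset.sum_congr rfl fun l _ => ?_
    have : f (a l) = ∑ k, f (stdE k) * dualE k (a l) := by
      conv_lhs => rw [sum_stdE (a l), map_sum]
      simp [dualE, mul_comm]
    rw [this, Finset.sum_smul, Finset.smul_sum]
    refine Finset.sum_congr rfl fun k _ => ?_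
    rw [smul_comm, mul_smul]
  have h₃ : ∑ k, f (stdE k) • interior i (dualE k) = interior i f :=
    exteriorPower_hom_ext fun a => by
      rw [LinearMap.sum_apply]
      exact h₂ a
  rw [h₁, ← h₃, LinearMap.sum_apply]
  rfl

theorem traceMap_eU_of_notMem {i : ℕ} {κ : Fin (i + 1) → Fin n} {k : Fin n} (h : ∀ j, κ j ≠ k) :
    traceMap n i (eU κ k) = 0 := by
  rw [eU, traceMap_smulRight, eWedge, interior_ιMulti]
  refine Finset.sum_eq_zero fun j _ => ?_
  simp [dualE, (h j)]

/-- Only the removal of the first factor pairs nontrivially with `e_k^*`, since `k` does not occur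
in `κ`. -/
theorem traceMap_eU_cons {i : ℕ} {κ : Fin i → Fin n} {k : Fin n} (h : ∀ j, κ j ≠ k) :
    traceMap n i (eU (Fin.cons (α := fun _ => Fin n) k κ) k) = eWedge κ := by
  rw [eU, traceMap_smulRight, eWedge, interior_ιMulti, Fin.sum_univ_succ, Finset.sum_eq_zero]
  · have h₁ : dualE k (stdE k : H n) = 1 := by simp [dualE]
    rw [Fin.cons_zero, h₁, one_smul, Fin.val_zero, pow_zero, one_smul, add_zero]
    rfl
  · intro j _
    rw [Fin.cons_succ]
    simp [dualE, (h j)]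

/-- This is `∑_b (e_b ∧ w) ⊗ e_b^*`, from expanding the identity of `H` in the standard basis. -/
theorem wheelIncl_eWedge {i : ℕ} (κ : Fin i → Fin n) :
    wheelIncl n i (eWedge κ) = ∑ b, eU (Fin.cons (α := fun _ => Fin n) b κ) b := by
  refine (Pi.basisFun ℚ (Fin n)).ext fun l => ?_
  rw [Pi.basisFun_apply, eWedge, wheelIncl_ιMulti, LinearMap.sum_apply]
  simp only [eU_stdE, Finset.sum_ite_eq, Finset.mem_univ, if_true]
  rw [eWedge]
  congr 1
  funext j
  refine Fin.cases ?_ (fun j => ?_) j <;> rfl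

theorem neg_one_pow_zsmul {N : Type} [AddCommGroup N] [Module ℚ N] (k : ℕ) (x : N) :
    (-1 : ℤ) ^ k • x = (-1 : ℚ) ^ k • x := by
  rcases Nat.even_or_odd k with hk | hk <;> simp [hk.neg_one_pow]

theorem eU_eq_cons {i : ℕ} (κ : Fin (i + 1) → Fin n) (j : Fin (i + 1)) (k : Fin n) :
    eU κ k = (-1 : ℚ) ^ (j : ℕ) •
      eU (Fin.cons (α := fun _ => Fin n) (κ j) (Fin.removeNth j κ)) k := by
  have h : eWedge κ = (-1 : ℚ) ^ (j : ℕ) •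
      eWedge (Fin.cons (α := fun _ => Fin n) (κ j) (Fin.removeNth j κ)) := by
    have h₁ := AlternatingMap.map_insertNth (exteriorPower.ιMulti ℚ (i + 1)) j
        (stdE (κ j)) (Fin.removeNth (α := fun _ => H n) j fun l => stdE (κ l))
    have h₂ := Fin.insertNth_removeNth (α := fun _ => H n) j (stdE (κ j)) fun l => stdE (κ l)
    rw [h₂, Function.update_eq_self] at h₁
    rw [eWedge, h₁, eWedge]
    have h₃ : (Matrix.vecCons (stdE (κ j)) (Fin.removeNth (α := fun _ => H n) j fun l => stdE (κ l))) =
        fun l => (stdE ((Fin.cons (α := fun _ => Fin n) (κ j) (Fin.removeNth j κ) : Fin (i + 1) → Fin n) l) : H n) := by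
      funext l
      refine Fin.cases ?_ (fun l => ?_) l <;> rfl
    rw [h₃]
    exact neg_one_pow_zsmul _ _
  refine (Pi.basisFun ℚ (Fin n)).ext fun l => ?_
  rw [Pi.basisFun_apply, LinearMap.smul_apply, eU_stdE, eU_stdE]
  split_ifs
  · exact h
  · rw [smul_zero]

/-- A linear map on `U_i` that kills the traceless monomials and identifies all the other ones with
the same trace factors, up to a scalar, through the trace. -/
theorem eq_of_kills_traceless {i : ℕ} {N : Type} [AddCommGroup N] [Module ℚ N]
    (φ : U n i →ₗ[ℚ] N)
    (h₁ : ∀ (κ : Fin (i + 1) → Fin n) (k : Fin n), Function.Injective κ → (∀ j, κ j ≠ k) →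
      φ (eU κ k) = 0)
    (h₂ : ∀ (κ : Fin i → Fin n) (k b : Fin n), Function.Injective κ → (∀ j, κ j ≠ k) →
      (∀ j, κ j ≠ b) → k ≠ b → φ (eU (Fin.cons (α := fun _ => Fin n) k κ) k) =
        φ (eU (Fin.cons (α := fun _ => Fin n) b κ) b)) (u : U n i) :
    ((n : ℚ) - i) • φ u = φ (wheelIncl n i (traceMap n i u)) := by
  have h : ((n : ℚ) - i) • φ = φ ∘ₗ wheelIncl n i ∘ₗ traceMap n i := by
    refine eU_hom_ext fun κ k hκ => ?_
    rw [LinearMap.smul_apply, LinearMap.comp_apply, LinearMap.comp_apply]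
    by_cases hk : ∀ j, κ j ≠ k
    · rw [h₁ κ k hκ hk, traceMap_eU_of_notMem hk, map_zero, map_zero, smul_zero]
    · push Not at hk
      obtain ⟨j, rfl⟩ := hk
      rw [eU_eq_cons κ j]
      have hinj : Function.Injective (Fin.removeNth j κ) :=
        hκ.comp (Fin.succAbove_right_injective (p := j))
      have hne : ∀ l, Fin.removeNth j κ l ≠ κ j := fun l hl =>
        Fin.succAbove_ne j l (hκ hl)
      rw [map_smul, map_smul, map_smul, map_smul, traceMap_eU_cons hne, smul_comm]
      congr 1
      generalize Fin.removeNth j κ = μ at hinj hne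
      generalize κ j = c at hne
      rw [wheelIncl_eWedge, map_sum]
      -- An index `b` that occurs in `μ` gives a wedge with a repeated factor. All the others, `n -
      -- i` in number, give the same value by `h₂`.
      have h₃ : ∀ b, φ (eU (Fin.cons (α := fun _ => Fin n) b μ) b) =
          if b ∈ Finset.univ.image μ then 0 else
            φ (eU (Fin.cons (α := fun _ => Fin n) c μ) c) := by
        intro b
        split_ifs with hb
        · obtain ⟨l, -, rfl⟩ := Finset.mem_image.mp hb
          rw [eU_eq_zero, map_zero]
          intro hi
          have := @hi 0 l.succ rfl
          exact Fin.succ_ne_zero l this.symm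
        · by_cases hbc : c = b
          · rw [hbc]
          · refine (h₂ μ c b hinj hne (fun l hl => hb ?_) hbc).symm
            exact Finset.mem_image.mpr ⟨l, Finset.mem_univ _, hl⟩
      rw [Finset.sum_congr rfl fun b _ => h₃ b, Finset.sum_ite, Finset.sum_const_zero, zero_add, Finset.sum_const,
        Finset.filter_not, Finset.filter_mem_eq_inter, Finset.univ_inter,
        Finset.card_sdiff_of_subset (Finset.subset_univ _), Finset.card_univ, Fintype.card_fin,
        Finset.card_image_of_injective _ hinj, Finset.card_univ, Fintype.card_fin,
        ← Nat.cast_smul_eq_nsmul ℚ, Nat.cast_sub]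
      have := Fintype.card_le_of_injective _ hinj
      rwa [Fintype.card_fin, Fintype.card_fin] at this
  exact LinearMap.congr_fun h u

end AlbIA

/-! ### Stable subspaces of `U_i` and of `⋀^k H` -/

namespace AlbIA

section Generic
variable {E : Type} [AddCommGroup E] [Module ℚ E]

theorem exists_ker_eq (R : Submodule ℚ E) : ∃ (Q : Type) (_ : AddCommGroup Q) (_ : Module ℚ Q)
    (φ : E →ₗ[ℚ] Q), ∀ x, φ x = 0 ↔ x ∈ R :=
  ⟨_, _, _, R.mkQ, fun _ => Submodule.Quotient.mk_eq_zero R⟩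

theorem mem_of_add_mem {R : Submodule ℚ E} {x y : E} (hx : x ∈ R) (h : x + y ∈ R) : y ∈ R :=
  (Submodule.add_mem_iff_right R hx).mp h

theorem mem_of_add_mem' {R : Submodule ℚ E} {x y : E} (hy : y ∈ R) (h : x + y ∈ R) : x ∈ R :=
  (Submodule.add_mem_iff_left R hy).mp h

theorem add_neg_smul_add (a b : ℚ) (x y : E) :
    (a + -b) • (x + y) = a • x + a • y + (-1 : ℚ) • b • x + (-1 : ℚ) • b • y := by
  module

end Generic

variable {n : ℕ}

theorem exists_ker_eq_U {i : ℕ} (R : Submodule ℚ (U n i)) :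
    ∃ (Q : Type) (_ : AddCommGroup Q) (_ : Module ℚ Q) (φ : U n i →ₗ[ℚ] Q),
      ∀ x, φ x = 0 ↔ x ∈ R := by
  have h := @exists_ker_eq (U n i) _ _ R
  exact h

/-- The image is `((e_k + e_b) ∧ κ) ⊗ (e_k^* - e_b^*)`, expanded. -/
theorem uRep_transvGL_eU {i : ℕ} {k b : Fin n} (h : k ≠ b) {κ : Fin i → Fin n}
    (hb : ∀ j, κ j ≠ b) :
    uRep n i (transvGL h 1) (eU (Fin.cons (α := fun _ => Fin n) b κ) k) =
      eU (Fin.cons (α := fun _ => Fin n) k κ) k + eU (Fin.cons (α := fun _ => Fin n) b κ) k +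
      (-1 : ℚ) • eU (Fin.cons (α := fun _ => Fin n) k κ) b +
      (-1 : ℚ) • eU (Fin.cons (α := fun _ => Fin n) b κ) b := by
  rw [eU, uRep_smulRight, extRep_transvGL_cons h hb, dualE_transvGL_inv, if_pos rfl]
  refine LinearMap.ext fun v => ?_
  exact add_neg_smul_add (v k) (v b) _ _

theorem uRep_transvGL_eU_cons {z b : Fin n} (h : b ≠ z) {κ : Fin i → Fin n}
    (hz : ∀ j, κ j ≠ z) :
    uRep n i (transvGL h 1) (eU (Fin.cons (α := fun _ => Fin n) z κ) z) =
      eU (Fin.cons (α := fun _ => Fin n) z κ) z + eU (Fin.cons (α := fun _ => Fin n) b κ) z := by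
  rw [eU, uRep_smulRight, extRep_transvGL_cons h hz, dualE_transvGL_inv, if_neg h.symm, add_zero]
  refine LinearMap.ext fun v => ?_
  exact (smul_add _ _ _).trans (add_comm _ _)

theorem injective_cons {i : ℕ} {κ : Fin i → Fin n} {k : Fin n} (hκ : Function.Injective κ)
    (hk : ∀ j, κ j ≠ k) : Function.Injective (Fin.cons (α := fun _ => Fin n) k κ) :=
  Fin.cons_injective_iff.mpr ⟨fun ⟨j, hj⟩ => hk j hj, hκ⟩

/-- In the quotient by `R`, permutations kill every traceless monomial, and transvections identify
the monomials `(e_k ∧ κ) ⊗ e_k^*` for different `k`. The quotient map then factors through the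
trace, up to the scalar `n - i ≠ 0`. A traceless monomial needs `i + 2` distinct indices; for `n = i
+ 1` there is none, so `hmem` is conditional. -/
theorem treePart_le {i : ℕ} [NeZero i] (hn : i + 1 ≤ n) (R : Submodule ℚ (U n i))
    (hR : ∀ g, ∀ x ∈ R, uRep n i g x ∈ R)
    (hmem : i + 2 ≤ n → ∃ (κ : Fin (i + 1) → Fin n) (k : Fin n), Function.Injective κ ∧
      (∀ j, κ j ≠ k) ∧ eU κ k ∈ R) : treePart n i ≤ R := by
  obtain ⟨Q, _, _, φ, hφ⟩ := exists_ker_eq_U R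
  have h₁ : ∀ (κ : Fin (i + 1) → Fin n) (k : Fin n), Function.Injective κ → (∀ j, κ j ≠ k) →
      φ (eU κ k) = 0 := by
    intro κ k hκ hk
    have hinj := injective_cons hκ hk
    have hle := Fintype.card_le_of_injective _ hinj
    rw [Fintype.card_fin, Fintype.card_fin] at hle
    obtain ⟨κ₀, k₀, hκ₀, hk₀, hm⟩ := hmem hle
    obtain ⟨p, hp⟩ := exists_perm_extending (injective_cons hκ₀ hk₀) hinj
    have hp₀ : p k₀ = k := hp 0
    have hp₁ : p ∘ κ₀ = κ := funext fun j => hp j.succ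
    have := hR (permGL p) _ hm
    rw [uRep_permGL, hp₀, hp₁] at this
    exact (hφ _).mpr this
  have h₂ : ∀ (κ : Fin i → Fin n) (k b : Fin n), Function.Injective κ → (∀ j, κ j ≠ k) →
      (∀ j, κ j ≠ b) → k ≠ b → φ (eU (Fin.cons (α := fun _ => Fin n) k κ) k) =
        φ (eU (Fin.cons (α := fun _ => Fin n) b κ) b) := by
    intro κ k b hκ hk hb hkb
    have e₁ := h₁ _ k (injective_cons hκ hb) (Fin.cases hkb.symm hk)
    have e₂ := h₁ _ b (injective_cons hκ hk) (Fin.cases hkb hb)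
    have := (hφ _).mpr (hR (transvGL hkb 1) _ ((hφ _).mp e₁))
    -- Of the four terms of the transvected monomial, the two mixed ones are traceless monomials, so
    -- the remaining two have equal images.
    rw [uRep_transvGL_eU hkb hb, map_add, map_add, map_add, map_smul, map_smul, e₁, e₂, add_zero,
      smul_zero, add_zero, neg_one_smul, ← sub_eq_add_neg, sub_eq_zero] at this
    exact this
  intro u hu
  rw [treePart, LinearMap.mem_ker] at hu
  have := eq_of_kills_traceless φ h₁ h₂ u
  rw [hu, map_zero, map_zero] at this
  exact (hφ _).mp ((smul_eq_zero.mp this).resolve_left (cast_sub_cast_ne_zero hn))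

/-- Permutation matrices act transitively on the wedges of distinct basis vectors, and these span.
-/
theorem eq_top_of_eWedge_mem {k : ℕ} (R : Submodule ℚ (⋀[ℚ]^k (H n)))
    (hR : ∀ g, ∀ x ∈ R, extRep (stdRep n) k g x ∈ R) {κ : Fin k → Fin n}
    (hκ : Function.Injective κ) (hmem : eWedge κ ∈ R) : R = ⊤ := by
  obtain ⟨Q, _, _, φ, hφ⟩ := exists_ker_eq R
  have h : φ = 0 := eWedge_hom_ext fun κ' hκ' => by
    obtain ⟨p, hp⟩ := exists_perm_extending hκ hκ'
    have := hR (permGL p) _ hmem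
    rw [extRep_permGL, show p ∘ κ = κ' from funext hp] at this
    rw [(hφ _).mpr this, LinearMap.zero_apply]
  rw [eq_top_iff]
  intro x _
  rw [← hφ, h, LinearMap.zero_apply]

section Surjectivity
variable {i : ℕ} [NeZero i]

theorem projection_treePart_eU (hn : i + 1 ≤ n) (hc : IsCompl (treePart n i) (wheelPart n i))
    {κ : Fin (i + 1) → Fin n} {k : Fin n} (hk : ∀ j, κ j ≠ k) :
    Submodule.projection (R := ℚ) (E := U n i) (treePart n i) (wheelPart n i) hc (eU κ k) =
      eU κ k := by
  have h := projection_treePart hn hc (eU κ k)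
  rwa [traceMap_eU_of_notMem hk, map_zero, smul_zero, add_zero] at h

/-- If the tree component vanished, so would that of its image under `e_z ↦ e_z + e_b`. The
difference of the two monomials is `(e_b ∧ κ) ⊗ e_z^*`, which is traceless and nonzero. -/
theorem projection_treePart_ne_zero (hn : i + 1 ≤ n)
    (hc : IsCompl (treePart n i) (wheelPart n i)) {z b : Fin n} {κ : Fin i → Fin n}
    (hκ : Function.Injective κ) (hz : ∀ j, κ j ≠ z) (hb : ∀ j, κ j ≠ b) (hbz : b ≠ z) :
    Submodule.projection (R := ℚ) (E := U n i) (treePart n i) (wheelPart n i) hc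
      (eU (Fin.cons (α := fun _ => Fin n) z κ) z) ≠ 0 := by
  intro h
  have h₁ := projection_treePart_uRep hn hc (transvGL hbz 1)
    (eU (Fin.cons (α := fun _ => Fin n) z κ) z)
  rw [h, map_zero, uRep_transvGL_eU_cons hbz hz, map_add, h, zero_add,
    projection_treePart_eU hn hc (Fin.cases hbz hz)] at h₁
  have h₂ := LinearMap.congr_fun h₁ (stdE z)
  rw [eU_stdE, if_pos rfl, LinearMap.zero_apply] at h₂
  exact eWedge_ne_zero (injective_cons hκ hb) h₂

theorem eq_top_of_wheel_add_tree_mem (hn : i + 1 ≤ n)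
    (hc : IsCompl (treePart n i) (wheelPart n i)) (R : Submodule ℚ (U n i))
    (hR : ∀ g, ∀ x ∈ R, uRep n i g x ∈ R) {z : Fin n} {κ : Fin i → Fin n}
    (hκ : Function.Injective κ) (hz : ∀ j, κ j ≠ z) {c C : ℚ} (hc₀ : c ≠ 0) (hC : C ≠ 0)
    (hmem : wheelIncl n i (c • eWedge κ) +
      Submodule.projection (R := ℚ) (E := U n i) (treePart n i) (wheelPart n i) hc
        (C • eU (Fin.cons (α := fun _ => Fin n) z κ) z) ∈ R) : R = ⊤ := by
  have htree : treePart n i ≤ R := by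
    refine treePart_le hn R hR fun hn' => ?_
    -- As `i + 2 ≤ n`, some index `b` lies outside the `i + 1` indices `z, κ`.
    obtain ⟨b, hb⟩ : ∃ b, b ∉ Finset.univ.image (Fin.cons (α := fun _ => Fin n) z κ) := by
      by_contra! h
      have h₁ : Function.Surjective (Fin.cons (α := fun _ => Fin n) z κ : Fin (i + 1) → Fin n) :=
        fun b => by simpa using h b
      have := Fintype.card_le_of_surjective _ h₁
      rw [Fintype.card_fin, Fintype.card_fin] at this
      omega
    have hbz : b ≠ z := fun h => hb (Finset.mem_image.mpr ⟨0, Finset.mem_univ _, h.symm⟩)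
    have hbκ : ∀ j, κ j ≠ b := fun j h =>
      hb (Finset.mem_image.mpr ⟨j.succ, Finset.mem_univ _, h⟩)
    refine ⟨_, z, injective_cons hκ hbκ, Fin.cases hbz hz, ?_⟩
    have h₁ := hR (transvGL hbz 1) _ hmem
    have hω : extRep (stdRep n) i (transvGL hbz 1) (c • eWedge κ) = c • eWedge κ := by
      rw [map_smul, extRep_transvGL_eq hbz hz]
    have hx : uRep n i (transvGL hbz 1) (C • eU (Fin.cons (α := fun _ => Fin n) z κ) z) =
        C • eU (Fin.cons (α := fun _ => Fin n) z κ) z +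
          C • eU (Fin.cons (α := fun _ => Fin n) b κ) z := by
      rw [map_smul, uRep_transvGL_eU_cons hbz hz, smul_add]
    -- The transvection fixes the wheel term and adds the traceless monomial `C · (e_b ∧ κ) ⊗
    -- e_z^*`; subtracting the original vector isolates it.
    rw [map_add, uRep_wheelIncl, hω, ← projection_treePart_uRep hn, hx, map_add,
      ← add_assoc] at h₁
    have h₂ := @mem_of_add_mem (U n i) _ _ R _ _ hmem h₁
    rw [map_smul, projection_treePart_eU hn hc (Fin.cases hbz hz)] at h₂
    have h₃ := R.smul_mem C⁻¹ h₂
    rwa [inv_smul_smul₀ hC] at h₃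
  have hwheel : wheelPart n i ≤ R := by
    -- With the tree part inside `R`, the tree component can be subtracted.
    have h₁ : wheelIncl n i (c • eWedge κ) ∈ R := by
      have h₀ := Submodule.projection_apply_mem (R := ℚ) (E := U n i) hc
        (C • eU (Fin.cons (α := fun _ => Fin n) z κ) z)
      exact @mem_of_add_mem' (U n i) _ _ R _ _ (htree h₀) hmem
    have h₂ : R.comap (wheelIncl n i) = ⊤ := by
      refine eq_top_of_eWedge_mem _ (fun g x hx => ?_) hκ ?_
      · rw [Submodule.mem_comap, ← uRep_wheelIncl]
        exact hR g _ hx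
      · have h₃ := R.smul_mem c⁻¹ h₁
        rw [map_smul, inv_smul_smul₀ hc₀] at h₃
        exact h₃
    rintro _ ⟨w, rfl⟩
    have : w ∈ R.comap (wheelIncl n i) := by rw [h₂]; trivial
    exact this
  rw [eq_top_iff, ← hc.sup_eq_top]
  exact sup_le htree hwheel

end Surjectivity

end AlbIA

namespace AlbIA

/-! ### The comparison map -/

theorem cycleIdx_injective {n i : ℕ} (hn : i + 1 ≤ n) : Function.Injective (cycleIdx hn) := fun a b h => by
  have := congrArg Fin.val h
  simp only [cycleIdx] at this
  exact Fin.ext (by omega)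

theorem cycleIdx_ne_zero {n i : ℕ} (hn : i + 1 ≤ n) (j : Fin i) : cycleIdx hn j ≠ ⟨0, by omega⟩ := fun h => by
  have := congrArg Fin.val h
  simp [cycleIdx] at this

variable {n i : ℕ} [NeZero i]

theorem cMap_equivariant {g : GL (Fin n) ℚ} {y y' : M n i} (h : ChainRelated g y y') :
    cMap n i y' = uRep n i g (cMap n i y) := by
  obtain ⟨m, rfl⟩ := Nat.exists_eq_succ_of_ne_zero (NeZero.ne i)
  exact h.cMap

theorem cWheel_equivariant {g : GL (Fin n) ℚ} {y y' : M n i} (h : ChainRelated g y y') :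
    cWheel n i y' = extRep (stdRep n) i g (cWheel n i y) := by
  obtain ⟨m, rfl⟩ := Nat.exists_eq_succ_of_ne_zero (NeZero.ne i)
  exact h.cWheel

/-- The map `M_i → U_i`, `c_i^wheel + c_i^tree`. -/
noncomputable def cSum (n i : ℕ) [NeZero i] (hc : IsCompl (treePart n i) (wheelPart n i)) :
    M n i →ₗ[ℚ] U n i := wheelIncl n i ∘ₗ cWheel n i + cTree n i hc

theorem cTree_apply (hc : IsCompl (treePart n i) (wheelPart n i)) (y : M n i) :
    cTree n i hc y = Submodule.projection (R := ℚ) (E := U n i) (treePart n i) (wheelPart n i) hc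
      (cMap n i y) := rfl

theorem cSum_apply (hc : IsCompl (treePart n i) (wheelPart n i)) (y : M n i) :
    cSum n i hc y = wheelIncl n i (cWheel n i y) + cTree n i hc y := rfl

theorem cSum_equivariant (hn : i + 1 ≤ n) (hc : IsCompl (treePart n i) (wheelPart n i))
    {g : GL (Fin n) ℚ} {y y' : M n i} (h : ChainRelated g y y') :
    cSum n i hc y' = uRep n i g (cSum n i hc y) := by
  rw [cSum_apply, cSum_apply, map_add, cTree_apply, cTree_apply, cMap_equivariant h,
    cWheel_equivariant h, uRep_wheelIncl, projection_treePart_uRep hn]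

section Alpha
variable (hn : i + 1 ≤ n)

theorem cMap_alpha_eq : ∃ C : ℚ, C ≠ 0 ∧
    cMap n i (iota n i (albToWedge n i (alphaAlb n i hn))) =
      C • eU (Fin.cons (α := fun _ => Fin n) ⟨0, by omega⟩ (cycleIdx hn)) ⟨0, by omega⟩ := by
  obtain ⟨C, hC, h⟩ := cMap_alpha hn
  -- The sign comes from moving `e_1` from the last place of the wedge to the first, past `i`
  -- factors.
  refine ⟨C * (-1) ^ i, mul_ne_zero (Nat.cast_ne_zero.mpr hC.ne')
    (pow_ne_zero _ (by norm_num)), ?_⟩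
  have h₁ := eU_eq_cons (Fin.snoc (α := fun _ => Fin n) (cycleIdx hn) ⟨0, by omega⟩) (Fin.last i)
    (⟨0, by omega⟩ : Fin n)
  have h₂ : Fin.removeNth (Fin.last i)
      (Fin.snoc (α := fun _ => Fin n) (cycleIdx hn) (⟨0, by omega⟩ : Fin n)) = cycleIdx hn := by
    funext j
    simp [Fin.removeNth]
  rw [Fin.snoc_last, h₂, Fin.val_last] at h₁
  have h₃ : cMap n i (iota n i (albToWedge n i (alphaAlb n i hn))) =
      (C : ℚ) • eU (Fin.snoc (α := fun _ => Fin n) (cycleIdx hn) ⟨0, by omega⟩)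
        ⟨0, by omega⟩ := by
    refine (Pi.basisFun ℚ (Fin n)).ext fun l => ?_
    rw [Pi.basisFun_apply, h, LinearMap.smul_apply, eU_stdE]
    by_cases hl : (l : ℕ) = 0
    · have : l = ⟨0, by omega⟩ := Fin.ext hl
      rw [this, if_pos rfl, if_pos rfl, Nat.cast_smul_eq_nsmul, eWedge]
      congr 2
      funext j
      refine Fin.lastCases ?_ (fun j => ?_) j
      · rw [Fin.snoc_last, Fin.snoc_last]
      · rw [Fin.snoc_castSucc, Fin.snoc_castSucc]
    · rw [if_neg hl, if_neg fun h => hl (congrArg Fin.val h), smul_zero]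
  rw [h₃, h₁, smul_smul]

theorem cWheel_alpha_eq : cWheel n i (iota n i (albToWedge n i (alphaAlb n i hn))) =
    (i.factorial : ℚ) • eWedge (cycleIdx hn) := by
  rw [cWheel_alpha, Nat.cast_smul_eq_nsmul]
  rfl

theorem cWheel_alpha_ne_zero :
    cWheel n i (iota n i (albToWedge n i (alphaAlb n i hn))) ≠ 0 := by
  rw [cWheel_alpha_eq]
  exact smul_ne_zero (Nat.cast_ne_zero.mpr i.factorial_ne_zero)
    (eWedge_ne_zero (cycleIdx_injective hn))

theorem cTree_alpha_ne_zero (hc : IsCompl (treePart n i) (wheelPart n i)) (hn' : i + 2 ≤ n) :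
    cTree n i hc (iota n i (albToWedge n i (alphaAlb n i hn))) ≠ 0 := by
  obtain ⟨C, hC, h⟩ := cMap_alpha_eq hn
  rw [cTree_apply, h, map_smul]
  -- `b = i + 1` is the first index used neither by the cycle nor by `e_1`; it exists because `i + 2
  -- ≤ n`.
  refine smul_ne_zero hC (projection_treePart_ne_zero hn hc (b := ⟨i + 1, by omega⟩)
    (cycleIdx_injective hn) (cycleIdx_ne_zero hn) (fun j h => ?_) (fun h => ?_))
  · have h₁ := congrArg Fin.val h
    have h₂ := j.isLt
    simp only [cycleIdx] at h₁
    omega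
  · have h₁ := congrArg Fin.val h
    simp at h₁

theorem eq_top_of_cSum_alpha_mem (hc : IsCompl (treePart n i) (wheelPart n i))
    (R : Submodule ℚ (U n i)) (hR : ∀ g, ∀ x ∈ R, uRep n i g x ∈ R)
    (hmem : cSum n i hc (iota n i (albToWedge n i (alphaAlb n i hn))) ∈ R) : R = ⊤ := by
  obtain ⟨C, hC, h⟩ := cMap_alpha_eq hn
  rw [cSum_apply, cTree_apply, cWheel_alpha_eq, h] at hmem
  exact eq_top_of_wheel_add_tree_mem hn hc R hR (cycleIdx_injective hn) (cycleIdx_ne_zero hn)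
    (Nat.cast_ne_zero.mpr i.factorial_ne_zero) hC hmem

end Alpha

/-- The image is stable under `GL(n, ℚ)` because that of `Λ` is, and it contains the value at the
abelian cycle. -/
theorem map_range_albToWedge_eq_top (hn : i + 1 ≤ n)
    (hc : IsCompl (treePart n i) (wheelPart n i)) (u : U n i) :
    ∃ x, cSum n i hc (iota n i (albToWedge n i x)) = u := by
  have hi : 1 ≤ i := NeZero.one_le
  have h : LinearMap.range (cSum n i hc ∘ₗ iota n i ∘ₗ albToWedge n i) = ⊤ := by
    refine eq_top_of_cSum_alpha_mem hn hc _ ?_ ⟨alphaAlb n i hn, rfl⟩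
    rintro g _ ⟨x, rfl⟩
    -- `x'` is merely some preimage of `g Λ(x)`; no action on `H^A_i` is used at this point.
    obtain ⟨x', hx'⟩ := range_albToWedge_stable (n := n) (by omega) i g ⟨x, rfl⟩
    refine ⟨x', ?_⟩
    have h₁ := chainRelated_iota g (albToWedge n i x)
    rw [← hx'] at h₁
    exact cSum_equivariant hn hc h₁
  have hu : u ∈ LinearMap.range (cSum n i hc ∘ₗ iota n i ∘ₗ albToWedge n i) := by
    rw [h]; trivial
  obtain ⟨x, hx⟩ := hu
  exact ⟨x, hx⟩

end AlbIA

namespace AlbIA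

/-! ### Complete reducibility through contravariant forms -/

section Transpose
variable {n : ℕ}

/-- The transpose of an invertible matrix. -/
def transposeGL (g : GL (Fin n) ℚ) : GL (Fin n) ℚ :=
  ⟨(g : Matrix (Fin n) (Fin n) ℚ).transpose, ((g⁻¹ : GL (Fin n) ℚ) : Matrix _ _ ℚ).transpose,
    by rw [← Matrix.transpose_mul, ← Units.val_mul, inv_mul_cancel, Units.val_one,
      Matrix.transpose_one],
    by rw [← Matrix.transpose_mul, ← Units.val_mul, mul_inv_cancel, Units.val_one,
      Matrix.transpose_one]⟩

theorem transposeGL_inv (g : GL (Fin n) ℚ) : (transposeGL g)⁻¹ = transposeGL g⁻¹ :=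
  Units.ext rfl

/-- `ρ` has a basis in which the matrices of `g` and of the transpose of `g` are transposes of each
other. -/
def HasTransposeBasis {E : Type} [AddCommGroup E] [Module ℚ E]
    (ρ : Representation ℚ (GL (Fin n) ℚ) E) : Prop :=
  ∃ (ι : Type) (_ : Fintype ι) (b : Module.Basis ι ℚ E), ∀ g p q,
    b.coord q (ρ g (b p)) = b.coord p (ρ (transposeGL g) (b q))

theorem stdRep_apply_stdE (g : GL (Fin n) ℚ) (k l : Fin n) :
    stdRep n g (stdE k) l = (g : Matrix (Fin n) (Fin n) ℚ) l k := by
  change Matrix.mulVec (g : Matrix (Fin n) (Fin n) ℚ) (Pi.single k 1) l = _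
  rw [Matrix.mulVec_single_one]
  rfl

theorem stdRep_transpose (g : GL (Fin n) ℚ) (k l : Fin n) :
    stdRep n g (stdE k) l = stdRep n (transposeGL g) (stdE l) k := by
  rw [stdRep_apply_stdE, stdRep_apply_stdE]
  rfl

theorem hasTransposeBasis_stdRep : HasTransposeBasis (stdRep n) := by
  refine ⟨Fin n, inferInstance, Pi.basisFun ℚ (Fin n), fun g p q => ?_⟩
  rw [Module.Basis.coord_apply, Module.Basis.coord_apply, Pi.basisFun_apply, Pi.basisFun_apply,
    Pi.basisFun_repr, Pi.basisFun_repr]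
  exact stdRep_transpose g p q

variable {E : Type} [AddCommGroup E] [Module ℚ E] {ρ : Representation ℚ (GL (Fin n) ℚ) E}

/-- The matrix entries of the exterior power are minors, and transposition does not change
determinants. -/
theorem HasTransposeBasis.extRep (h : HasTransposeBasis ρ) (k : ℕ) :
    HasTransposeBasis (extRep ρ k) := by
  obtain ⟨ι, _, b, hb⟩ := h
  -- An arbitrary order on the index set, needed to index the basis of the exterior power by
  -- subsets.
  let _ : LinearOrder ι := LinearOrder.lift' (Fintype.equivFin ι) (Fintype.equivFin ι).injective
  refine ⟨_, Fintype.ofFinite _, b.exteriorPower k, fun g p q => ?_⟩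
  rw [exteriorPower.basis_apply, exteriorPower.basis_apply, exteriorPower.basis_coord,
    exteriorPower.basis_coord, exteriorPower.ιMulti_family, exteriorPower.ιMulti_family,
    extRep_ιMulti, extRep_ιMulti, exteriorPower.ιMultiDual_apply_ιMulti,
    exteriorPower.ιMultiDual_apply_ιMulti, ← Matrix.det_transpose]
  congr 1
  ext r s
  exact hb g _ _

/-- In the basis of elementary maps, the entries are products of an entry of `g⁻¹` and one of `ρ g`.
Both transpose, and inversion commutes with transposition. -/
theorem HasTransposeBasis.linHom_stdRep (h : HasTransposeBasis ρ) :
    HasTransposeBasis ((stdRep n).linHom ρ) := by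
  classical
  obtain ⟨ι, _, b, hb⟩ := h
  refine ⟨_, inferInstance, (Pi.basisFun ℚ (Fin n)).linearMap b, ?_⟩
  rintro g ⟨s, k⟩ ⟨t, l⟩
  have hcoord : ∀ (u : H n →ₗ[ℚ] E) (t : ι) (l : Fin n),
      ((Pi.basisFun ℚ (Fin n)).linearMap b).coord (t, l) u = b.coord t (u (stdE l)) := by
    intro u t l
    have : ((Pi.basisFun ℚ (Fin n)).linearMap b).coord (t, l) =
        b.coord t ∘ₗ LinearMap.applyₗ (stdE l) := by
      refine ((Pi.basisFun ℚ (Fin n)).linearMap b).ext ?_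
      rintro ⟨s, k⟩
      have hl : (stdE l : H n) = Pi.basisFun ℚ (Fin n) l := (Pi.basisFun_apply _ _ _).symm
      rw [LinearMap.comp_apply, LinearMap.applyₗ_apply_apply, hl,
        Module.Basis.linearMap_apply_apply, Module.Basis.coord_apply, Module.Basis.repr_self]
      by_cases hk : k = l
      · subst hk
        simp [Finsupp.single_apply]
      · simp [hk]
    rw [this]
    rfl
  have hval : ∀ (s : ι) (k : Fin n) (v : H n),
      (Pi.basisFun ℚ (Fin n)).linearMap b (s, k) v = v k • b s := by
    intro s k v
    have : (Pi.basisFun ℚ (Fin n)).linearMap b (s, k) = (dualE k).smulRight (b s) := by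
      refine (Pi.basisFun ℚ (Fin n)).ext fun j => ?_
      rw [Module.Basis.linearMap_apply_apply]
      simp [dualE, Pi.single_apply]
    rw [this]
    rfl
  have hrep : ∀ (g : GL (Fin n) ℚ) (u : H n →ₗ[ℚ] E) (v : H n),
      (stdRep n).linHom ρ g u v = ρ g (u (stdRep n g⁻¹ v)) := fun _ _ _ => rfl
  rw [hcoord, hcoord, hrep, hrep, hval, hval, map_smul, map_smul, map_smul, map_smul, hb,
    stdRep_transpose, transposeGL_inv]

/-- For the scalar product that makes the basis orthonormal, the adjoint of `ρ g` is `ρ` of the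
transpose. Hence orthogonal complements of stable subspaces are stable, and positivity makes them
complementary. -/
theorem isCompl_of_hasTransposeBasis (h : HasTransposeBasis ρ) (K : Submodule ℚ E)
    (hK : ∀ g, ∀ x ∈ K, ρ g x ∈ K) :
    ∃ K' : Submodule ℚ E, (∀ g, ∀ x ∈ K', ρ g x ∈ K') ∧ IsCompl K K' := by
  obtain ⟨ι, _, b, hb⟩ := h
  have : FiniteDimensional ℚ E := b.finiteDimensional_of_finite
  let B : LinearMap.BilinForm ℚ E := ∑ p, (b.coord p).smulRight (b.coord p)
  have hB : ∀ x y, B x y = ∑ p, b.coord p x * b.coord p y := fun x y => by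
    simp [B, LinearMap.sum_apply]
  have hsymm : B.IsRefl := fun x y hxy => by
    rw [hB] at hxy ⊢
    rw [← hxy]
    exact Finset.sum_congr rfl fun p _ => mul_comm _ _
  have hpos : ∀ x, B x x = 0 → x = 0 := fun x hx => by
    rw [hB, Finset.sum_eq_zero_iff_of_nonneg fun p _ => mul_self_nonneg _] at hx
    exact b.ext_elem fun p => by simpa using hx p (Finset.mem_univ p)
  have hadj : ∀ g x y, B (ρ g x) y = B x (ρ (transposeGL g) y) := by
    intro g x y
    have : B ∘ₗ ρ g = B.compl₂ (ρ (transposeGL g)) := b.ext fun p => b.ext fun q => by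
      rw [LinearMap.comp_apply, LinearMap.compl₂_apply, hB, hB, Finset.sum_eq_single q,
        Finset.sum_eq_single p]
      · simp only [Module.Basis.coord_apply, Module.Basis.repr_self, Finsupp.single_eq_same,
          mul_one, one_mul]
        exact hb g p q
      · intro r _ hr; simp [hr]
      · simp
      · intro r _ hr; simp [hr]
      · simp
    exact LinearMap.congr_fun (LinearMap.congr_fun this x) y
  refine ⟨B.orthogonal K, fun g x hx y hy => ?_, ?_⟩
  · have h₁ := hx (ρ (transposeGL g) y) (hK _ _ hy)
    have h₂ : transposeGL (transposeGL g) = g := Units.ext rfl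
    change B y (ρ g x) = 0
    rw [← h₂, ← hadj]
    exact h₁
  · rw [LinearMap.BilinForm.isCompl_orthogonal_iff_disjoint hsymm, Submodule.disjoint_def]
    exact fun x hx hx' => hpos x (hx' x hx)

theorem exists_equivariant_section {F : Type} [AddCommGroup F] [Module ℚ F]
    {ρF : Representation ℚ (GL (Fin n) ℚ) F} (h : HasTransposeBasis ρ) (W : Submodule ℚ E)
    (hW : ∀ g, ∀ x ∈ W, ρ g x ∈ W) (f : E →ₗ[ℚ] F) (hf : ∀ g x, f (ρ g x) = ρF g (f x))
    (hsurj : ∀ u, ∃ x ∈ W, f x = u) :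
    ∃ s : F →ₗ[ℚ] E, (∀ u, s u ∈ W) ∧ (∀ u, f (s u) = u) ∧
      ∀ g u, s (ρF g u) = ρ g (s u) := by
  -- With `K'` complementary to `W ∩ ker f`, the map `f` sends the stable subspace `W ∩ K'`
  -- isomorphically onto `F`; the section is its inverse.
  obtain ⟨K', hK', hc⟩ := isCompl_of_hasTransposeBasis h (W ⊓ LinearMap.ker f)
    fun g x hx => ⟨hW g x hx.1, by
      have h₀ : f x = 0 := hx.2
      change f (ρ g x) = 0
      rw [hf, h₀, map_zero]⟩
  have hinj : Function.Injective (f.domRestrict (W ⊓ K')) := by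
    rw [injective_iff_map_eq_zero]
    rintro ⟨x, hxW, hxK⟩ hx
    exact Subtype.ext (Submodule.disjoint_def.mp hc.disjoint x ⟨hxW, hx⟩ hxK)
  have hsurj' : Function.Surjective (f.domRestrict (W ⊓ K')) := by
    intro u
    obtain ⟨x, hxW, rfl⟩ := hsurj u
    have hx : x ∈ (W ⊓ LinearMap.ker f) ⊔ K' := by rw [hc.sup_eq_top]; trivial
    obtain ⟨y, hy, z, hz, rfl⟩ := Submodule.mem_sup.mp hx
    refine ⟨⟨z, (Submodule.add_mem_iff_right W hy.1).mp hxW, hz⟩, ?_⟩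
    have h₀ : f y = 0 := hy.2
    rw [map_add, h₀, zero_add]
    rfl
  let e := LinearEquiv.ofBijective (f.domRestrict (W ⊓ K')) ⟨hinj, hsurj'⟩
  have he : ∀ u, f (e.symm u : E) = u := fun u => e.apply_symm_apply u
  refine ⟨(W ⊓ K').subtype ∘ₗ e.symm.toLinearMap, fun u => (e.symm u).2.1, he, fun g u => ?_⟩
  have hm : ρ g (e.symm u : E) ∈ W ⊓ K' := ⟨hW g _ (e.symm u).2.1, hK' g _ (e.symm u).2.2⟩
  have : e.symm (ρF g u) = ⟨_, hm⟩ := by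
    rw [LinearEquiv.symm_apply_eq]
    change _ = f (ρ g (e.symm u : E))
    rw [hf, he]
  exact congrArg Subtype.val this

end Transpose

theorem hasTransposeBasis_extRep_uRep (n i : ℕ) :
    HasTransposeBasis (E := ⋀[ℚ]^i (U n 1)) (extRep (uRep n 1) i) := by
  have h₁ : HasTransposeBasis (extRep (stdRep n) 2) := hasTransposeBasis_stdRep.extRep 2
  have h₂ := h₁.linHom_stdRep
  exact h₂.extRep i

theorem exists_section_albToWedge {n i : ℕ} [NeZero i] (hn : i + 1 ≤ n)
    (hc : IsCompl (treePart n i) (wheelPart n i)) :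
    ∃ s : U n i →ₗ[ℚ] ⋀[ℚ]^i (U n 1), (∀ u, s u ∈ LinearMap.range (albToWedge n i)) ∧
      (∀ u, cSum n i hc (iota n i (s u)) = u) ∧
      ∀ g u, s (uRep n i g u) = extRep (uRep n 1) i g (s u) := by
  have hi : 1 ≤ i := NeZero.one_le
  have hT := hasTransposeBasis_extRep_uRep n i
  have hW : ∀ g, ∀ x ∈ LinearMap.range (albToWedge n i),
      extRep (uRep n 1) i g x ∈ LinearMap.range (albToWedge n i) :=
    fun g x hx => range_albToWedge_stable (by omega) i g hx
  have hf : ∀ g x, (cSum n i hc ∘ₗ iota n i) (extRep (uRep n 1) i g x) =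
      uRep n i g ((cSum n i hc ∘ₗ iota n i) x) :=
    fun g x => cSum_equivariant hn hc (chainRelated_iota g x)
  have hsurj : ∀ u, ∃ x ∈ LinearMap.range (albToWedge n i),
      (cSum n i hc ∘ₗ iota n i) x = u := fun u => by
    obtain ⟨x, hx⟩ := map_range_albToWedge_eq_top hn hc u
    exact ⟨_, ⟨x, rfl⟩, hx⟩
  have h₁ := @exists_equivariant_section n (⋀[ℚ]^i (U n 1)) _ _ (extRep (uRep n 1) i)
  have h₂ := @h₁ (U n i) _ _ (uRep n i)
  have h₃ := h₂ hT
  have h₄ := h₃ (LinearMap.range (albToWedge n i)) hW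
  have h₅ := h₄ (cSum n i hc ∘ₗ iota n i) hf hsurj
  exact h₅
end AlbIA

namespace AlbIA

/-! ### The action on Albanese homology -/

section Pullback
variable {G X E F : Type} [Group G] [AddCommGroup X] [Module ℚ X] [AddCommGroup E] [Module ℚ E]
  [AddCommGroup F] [Module ℚ F]

/-- An action on the range of a linear map `L` lifts to the source of `L`, and equivariant maps to
the range lift as well. -/
theorem exists_lift_action (L : X →ₗ[ℚ] E) (ρE : Representation ℚ G E)
    (ρF : Representation ℚ G F)
    (hL : ∀ g, ∀ y ∈ LinearMap.range L, ρE g y ∈ LinearMap.range L) (s : F →ₗ[ℚ] E)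
    (hs : ∀ u, s u ∈ LinearMap.range L) (hsg : ∀ g u, s (ρF g u) = ρE g (s u))
    (hinj : Function.Injective s) :
    ∃ ρ : Representation ℚ G X, (∀ g x, L (ρ g x) = ρE g (L x)) ∧
      ∃ s' : ρF.IntertwiningMap ρ, Function.Injective s' := by
  -- `σ` is a linear section of `L` over its range, extended arbitrarily to `E`; only its values on
  -- the range matter.
  obtain ⟨σ₀, hσ₀⟩ := L.rangeRestrict.exists_rightInverse_of_surjective L.range_rangeRestrict
  obtain ⟨σ, hσ⟩ := LinearMap.exists_extend σ₀
  have h₁ : ∀ y ∈ LinearMap.range L, L (σ y) = y := fun y hy => by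
    have e₁ := congrArg Subtype.val (LinearMap.congr_fun hσ₀ ⟨y, hy⟩)
    rw [← hσ] at e₁
    exact e₁
  have h₂ : ∀ x, L (σ (L x)) = L x := fun x => h₁ _ ⟨x, rfl⟩
  have h₃ : ∀ g x, L (σ (ρE g (L x))) = ρE g (L x) := fun g x => h₁ _ (hL g _ ⟨x, rfl⟩)
  let ρ : Representation ℚ G X :=
    -- The source splits as `σ(range L) ⊕ ker L`. The group acts by transport through `σ` on the
    -- first summand and trivially on the second.
    { toFun := fun g => σ ∘ₗ ρE g ∘ₗ L + (LinearMap.id - σ ∘ₗ L)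
      map_one' := by
        refine LinearMap.ext fun x => ?_
        simp
      map_mul' := fun g h => by
        refine LinearMap.ext fun x => ?_
        simp only [map_mul, LinearMap.add_apply, LinearMap.comp_apply, LinearMap.sub_apply,
          LinearMap.id_apply, Module.End.mul_apply, map_add, map_sub, h₂, h₃, sub_self, add_zero]
        abel }
  have hρ : ∀ g x, ρ g x = σ (ρE g (L x)) + (x - σ (L x)) := fun _ _ => rfl
  refine ⟨ρ, fun g x => ?_, (σ ∘ₗ s).intertwiningMap_of_isIntertwiningMap _ _ fun g u => ?_, ?_⟩
  · rw [hρ, map_add, map_sub, h₂, h₃, sub_self, add_zero]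
  · rw [hρ, LinearMap.comp_apply, LinearMap.comp_apply, h₁ _ (hs u), hsg, sub_self, add_zero]
  · intro u v huv
    have e₁ : σ (s u) = σ (s v) := huv
    have e₂ := congrArg L e₁
    rw [h₁ _ (hs u), h₁ _ (hs v)] at e₂
    exact hinj e₂

end Pullback

variable {n i : ℕ} [NeZero i]

theorem exists_albaneseAction (hn : i + 1 ≤ n) :
    ∃ ρ : Representation ℚ (GL (Fin n) ℚ) (AlbaneseHomology (IA n) i),
      IsAlbaneseAction n i ρ ∧ ∃ s : (uRep n i).IntertwiningMap ρ, Function.Injective s := by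
  have hi : 1 ≤ i := NeZero.one_le
  obtain ⟨s, hs, hcs, hsg⟩ := exists_section_albToWedge hn (isCompl_treePart_wheelPart hn)
  have hinj : Function.Injective s := fun u v huv => by
    rw [← hcs u, huv, hcs]
  have hW : ∀ g, ∀ x ∈ LinearMap.range (albToWedge n i),
      extRep (uRep n 1) i g x ∈ LinearMap.range (albToWedge n i) :=
    fun g x hx => range_albToWedge_stable (by omega) i g hx
  have h₁ := @exists_lift_action (GL (Fin n) ℚ) (AlbaneseHomology (IA n) i) (⋀[ℚ]^i (U n 1))
    (U n i) _ _ _ _ _ _ _ (albToWedge n i)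
  have h₂ := h₁ (extRep (uRep n 1) i) (uRep n i)
  have h₃ := h₂ hW s hs hsg hinj
  exact h₃

theorem exists_comparison (hn : i + 1 ≤ n) (hc : IsCompl (treePart n i) (wheelPart n i))
    (ρ : Representation ℚ (GL (Fin n) ℚ) (AlbaneseHomology (IA n) i))
    (hρ : IsAlbaneseAction n i ρ) :
    ∃ f : ρ.IntertwiningMap (uRep n i), Function.Surjective f ∧
      ∀ x, f x = wheelIncl n i (cWheel n i (iota n i (albToWedge n i x))) +
        cTree n i hc (iota n i (albToWedge n i x)) := by
  have h : ∀ g x, (cSum n i hc ∘ₗ iota n i ∘ₗ albToWedge n i) (ρ g x) =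
      uRep n i g ((cSum n i hc ∘ₗ iota n i ∘ₗ albToWedge n i) x) := fun g x => by
    have h₁ := chainRelated_iota g (albToWedge n i x)
    rw [← hρ g x] at h₁
    exact cSum_equivariant hn hc h₁
  exact ⟨(cSum n i hc ∘ₗ iota n i ∘ₗ albToWedge n i).intertwiningMap_of_isIntertwiningMap _ _ h,
    fun u => map_range_albToWedge_eq_top hn hc u, fun x => rfl⟩

/-- The class of `α_{(0,i)}` is nonzero, since its wheel contraction is. -/
theorem nontrivial_albaneseHomology (hn : i + 1 ≤ n) :
    Nontrivial (AlbaneseHomology (IA n) i) := by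
  refine ⟨alphaAlb n i hn, 0, fun h => cWheel_alpha_ne_zero hn ?_⟩
  rw [h, map_zero, map_zero, map_zero]

end AlbIA

namespace AlbIA

/-! ### Schur functors of columns -/

section Column

/-- The sign of a permutation as a rational number. -/
def signQ (α : Type) [Fintype α] [DecidableEq α] : Equiv.Perm α →* ℚ :=
  (Int.castRingHom ℚ).toMonoidHom.comp ((Units.coeHom ℤ).comp Equiv.Perm.sign)

theorem signQ_apply {α : Type} [Fintype α] [DecidableEq α] (σ : Equiv.Perm α) :
    signQ α σ = ((Equiv.Perm.sign σ : ℤ) : ℚ) := rfl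

theorem signQ_mul_self {α : Type} [Fintype α] [DecidableEq α] (σ : Equiv.Perm α) :
    signQ α σ * signQ α σ = 1 := by
  rw [signQ_apply]
  rcases Int.units_eq_one_or (Equiv.Perm.sign σ) with h | h <;> simp [h]

variable {μ : YoungDiagram}

/-- When all boxes lie in one column, a permutation that preserves rows is the identity, so the
Young symmetrizer is the full signed sum. -/
theorem rowSum_eq_one (hμ : ∀ c d : μ.cells, c.1.2 = d.1.2) : rowSum μ = 1 := by
  classical
  have h : (Finset.univ.filter fun σ : Equiv.Perm μ.cells => ∀ c, (σ c).1.1 = c.1.1) = {1} := by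
    ext σ
    simp only [Finset.mem_filter, Finset.mem_univ, true_and, Finset.mem_singleton]
    refine ⟨fun h => Equiv.ext fun c => Subtype.ext (Prod.ext (h c) (hμ _ _)), ?_⟩
    rintro rfl c
    rfl
  unfold rowSum
  rw [Finset.filter_congr_decidable, h, Finset.sum_singleton, MonoidAlgebra.one_def]

theorem colSum_eq (hμ : ∀ c d : μ.cells, c.1.2 = d.1.2) :
    colSum μ = ∑ σ : Equiv.Perm μ.cells, MonoidAlgebra.single σ (signQ _ σ) := by
  classical
  have h : (Finset.univ.filter fun σ : Equiv.Perm μ.cells => ∀ c, (σ c).1.2 = c.1.2) =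
      Finset.univ := Finset.filter_true_of_mem fun σ _ c => hμ _ _
  unfold colSum
  rw [Finset.filter_congr_decidable, h]
  rfl

theorem single_mul_colSum (hμ : ∀ c d : μ.cells, c.1.2 = d.1.2) (σ : Equiv.Perm μ.cells) (r : ℚ) :
    MonoidAlgebra.single σ r * colSum μ = (r * signQ _ σ) • colSum μ := by
  rw [colSum_eq hμ, Finset.mul_sum, Finset.smul_sum,
    ← Equiv.sum_comp (Equiv.mulLeft σ) fun τ => (r * signQ _ σ) • MonoidAlgebra.single τ (signQ _ τ)]
  refine Finset.sum_congr rfl fun τ _ => ?_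
  rw [MonoidAlgebra.single_mul_single, MonoidAlgebra.smul_single, Equiv.coe_mulLeft, map_mul,
    smul_eq_mul]
  congr 1
  have := signQ_mul_self σ
  linear_combination (-r * signQ _ τ) * this

/-- Left multiplication by a permutation only changes the signed sum by its sign, so the left ideal
is a line. -/
theorem mem_specht (hμ : ∀ c d : μ.cells, c.1.2 = d.1.2) (x : MonoidAlgebra ℚ (Equiv.Perm μ.cells)) :
    x ∈ specht μ ↔ ∃ r : ℚ, x = r • colSum μ := by
  have h₀ : ∀ x, x ∈ specht μ ↔ ∃ a, a * colSum μ = x := fun x => by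
    rw [specht, Submodule.restrictScalars_mem, youngSymmetrizer, rowSum_eq_one hμ, mul_one,
      Ideal.mem_span_singleton']
  rw [h₀]
  constructor
  · rintro ⟨a, rfl⟩
    induction a using MonoidAlgebra.induction_linear with
    | zero => exact ⟨0, by simp⟩
    | add f g hf hg =>
      obtain ⟨r, hr⟩ := hf
      obtain ⟨s, hs⟩ := hg
      exact ⟨r + s, by rw [add_mul, hr, hs, add_smul]⟩
    | single σ r => exact ⟨_, single_mul_colSum hμ σ r⟩
  · rintro ⟨r, rfl⟩
    refine ⟨MonoidAlgebra.single 1 r, ?_⟩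
    rw [single_mul_colSum hμ, map_one, mul_one]

/-- The generator of the Specht module of a column. -/
noncomputable def colGen (hμ : ∀ c d : μ.cells, c.1.2 = d.1.2) : specht μ :=
  ⟨colSum μ, (mem_specht hμ _).mpr ⟨1, (one_smul _ _).symm⟩⟩

theorem exists_smul_colGen (hμ : ∀ c d : μ.cells, c.1.2 = d.1.2) (s : specht μ) :
    ∃ r : ℚ, s = r • colGen hμ := by
  obtain ⟨r, hr⟩ := (mem_specht hμ _).mp s.2
  exact ⟨r, Subtype.ext hr⟩

theorem spechtRep_colGen (hμ : ∀ c d : μ.cells, c.1.2 = d.1.2) (σ : Equiv.Perm μ.cells) :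
    spechtRep μ σ (colGen hμ) = signQ _ σ • colGen hμ := by
  refine Subtype.ext ?_
  have := single_mul_colSum hμ σ 1
  rw [one_mul] at this
  exact this

variable (μ) in
/-- The linear extension of the sign character to the Specht module. -/
noncomputable def spechtSign : specht μ →ₗ[ℚ] ℚ :=
  (MonoidAlgebra.lift ℚ ℚ (Equiv.Perm μ.cells) (signQ _)).toLinearMap ∘ₗ (specht μ).subtype

theorem spechtSign_spechtRep (σ : Equiv.Perm μ.cells) (s : specht μ) :
    spechtSign μ (spechtRep μ σ s) = signQ _ σ * spechtSign μ s := by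
  have h : spechtSign μ (spechtRep μ σ s) = MonoidAlgebra.lift ℚ ℚ (Equiv.Perm μ.cells) (signQ _)
      (MonoidAlgebra.single σ 1 * s.1) := rfl
  rw [h, map_mul, MonoidAlgebra.lift_single, one_smul]
  rfl

/-- The value is `∑_σ sgn(σ)²`, the order of the symmetric group. -/
theorem spechtSign_colGen (hμ : ∀ c d : μ.cells, c.1.2 = d.1.2) :
    spechtSign μ (colGen hμ) ≠ 0 := by
  have h : spechtSign μ (colGen hμ) =
      MonoidAlgebra.lift ℚ ℚ (Equiv.Perm μ.cells) (signQ _) (colSum μ) := rfl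
  rw [h, colSum_eq hμ, map_sum]
  simp only [MonoidAlgebra.lift_single, smul_eq_mul, signQ_mul_self]
  rw [Finset.sum_const, nsmul_eq_mul, mul_one]
  exact Nat.cast_ne_zero.mpr (Finset.card_pos.mpr Finset.univ_nonempty).ne'

end Column

end AlbIA

namespace AlbIA

/-! ### `V_{λ,μ}` for a column `λ` and at most one box in `μ` -/

section ColumnFunctor

theorem exists_coinvariants_lift {G X E : Type} [Group G] [AddCommGroup X] [Module ℚ X]
    [AddCommMonoid E] [Module ℚ E] (ρ : Representation ℚ G X) (f : X →ₗ[ℚ] E)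
    (h : ∀ g, f ∘ₗ ρ g = f) :
    ∃ F : ρ.Coinvariants →ₗ[ℚ] E, ∀ x, F (Representation.Coinvariants.mk ρ x) = f x := by
  let _ : AddCommGroup E := Module.addCommMonoidToAddCommGroup ℚ
  exact ⟨Representation.Coinvariants.lift ρ f h, fun _ => rfl⟩

variable {n : ℕ} {lam mu : YoungDiagram}

/-- The class of `t ⊗ (s ⊗ s')` in `V_{λ,μ}`. -/
noncomputable def vMk (t : traceless n lam.cells mu.cells) (s : specht lam) (s' : specht mu) :
    V n lam mu :=
  Representation.Coinvariants.mk (balancing n lam mu) (t ⊗ₜ[ℚ] (s ⊗ₜ[ℚ] s'))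

theorem vRep_vMk (g : GL (Fin n) ℚ) (t : traceless n lam.cells mu.cells) (s : specht lam)
    (s' : specht mu) :
    vRep n lam mu g (vMk t s s') = vMk (tracelessRep n lam.cells mu.cells g t) s s' := rfl

theorem vMk_permRep (p : Equiv.Perm lam.cells × Equiv.Perm mu.cells)
    (t : traceless n lam.cells mu.cells) (s : specht lam) (s' : specht mu) :
    vMk (tracelessPermRep n lam.cells mu.cells p t) (spechtRep lam p.1 s) (spechtRep mu p.2 s') =
      vMk t s s' :=
  Representation.Coinvariants.mk_self_apply (balancing n lam mu) p (t ⊗ₜ[ℚ] (s ⊗ₜ[ℚ] s'))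

theorem exists_eq_vMk (hlam : ∀ c d : lam.cells, c.1.2 = d.1.2)
    (hmu : ∀ c d : mu.cells, c.1.2 = d.1.2) (v : V n lam mu) :
    ∃ t, v = vMk t (colGen hlam) (colGen hmu) := by
  obtain ⟨x, rfl⟩ := Representation.Coinvariants.mk_surjective _ v
  induction x using TensorProduct.induction_on with
  | zero => exact ⟨0, by rw [vMk, TensorProduct.zero_tmul]⟩
  | add x y hx hy =>
    obtain ⟨a, ha⟩ := hx
    obtain ⟨b, hb⟩ := hy
    exact ⟨a + b, by rw [map_add, ha, hb, vMk, vMk, vMk, ← map_add, TensorProduct.add_tmul]⟩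
  | tmul t z =>
    induction z using TensorProduct.induction_on with
    | zero => exact ⟨0, by rw [vMk, TensorProduct.zero_tmul, TensorProduct.tmul_zero]⟩
    | add x y hx hy =>
      obtain ⟨a, ha⟩ := hx
      obtain ⟨b, hb⟩ := hy
      exact ⟨a + b, by
        rw [TensorProduct.tmul_add, map_add, ha, hb, vMk, vMk, vMk, ← map_add,
          TensorProduct.add_tmul]⟩
    | tmul s s' =>
      obtain ⟨r, rfl⟩ := exists_smul_colGen hlam s
      obtain ⟨r', rfl⟩ := exists_smul_colGen hmu s'
      exact ⟨(r * r') • t, by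
        rw [vMk, TensorProduct.smul_tmul, smul_smul, TensorProduct.tmul_smul,
          TensorProduct.tmul_smul, TensorProduct.smul_tmul']⟩

/-- A model `E` with projection `π` and antisymmetrization `A` receives `V_{λ,μ}` by `t ⊗ s ⊗ s' ↦
sgn(s) sgn(s') π(t)`. If `π(t) = 0`, then `∑ sgn(σ) σt = A(π t) = 0`; but each `sgn(σ) σt` has the
same class as `t` in the coinvariants, so that class is zero. Since `A ∘ π` preserves tracelessness
and `π ∘ A` is a nonzero scalar, the image is the set of `e` with `A e` traceless. -/
theorem exists_vRep_intertwiner (hlam : ∀ c d : lam.cells, c.1.2 = d.1.2)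
    [Subsingleton mu.cells] {E : Type} [AddCommMonoid E] [Module ℚ E]
    (ρ : Representation ℚ (GL (Fin n) ℚ) E)
    (π : MixedTensor n lam.cells mu.cells →ₗ[ℚ] E) (A : E →ₗ[ℚ] MixedTensor n lam.cells mu.cells)
    (hg : ∀ g x, π (mixedRep n lam.cells mu.cells g x) = ρ g (π x))
    (hperm : ∀ σ x, π (permRep n lam.cells mu.cells (σ, 1) x) = signQ _ σ • π x)
    (hA : ∀ x, A (π x) = ∑ σ, signQ _ σ • permRep n lam.cells mu.cells (σ, 1) x)
    {N : ℚ} (hN : N ≠ 0) (hπA : ∀ e, π (A e) = N • e) :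
    ∃ a : (vRep n lam mu).IntertwiningMap ρ, Function.Injective a ∧
      ∀ e, e ∈ LinearMap.range a.toLinearMap ↔ A e ∈ traceless n lam.cells mu.cells := by
  have hmu : ∀ c d : mu.cells, c.1.2 = d.1.2 := fun c d => by rw [Subsingleton.elim c d]
  let f : traceless n lam.cells mu.cells ⊗[ℚ] (specht lam ⊗[ℚ] specht mu) →ₗ[ℚ] E :=
    (TensorProduct.rid ℚ E).toLinearMap ∘ₗ
      TensorProduct.map (π ∘ₗ (traceless n lam.cells mu.cells).subtype)
        ((TensorProduct.lid ℚ ℚ).toLinearMap ∘ₗ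
          TensorProduct.map (spechtSign lam) (spechtSign mu))
  have hf : ∀ t s s', f (t ⊗ₜ (s ⊗ₜ s')) = (spechtSign lam s * spechtSign mu s') • π t.1 :=
    fun t s s' => by simp [f]
  have hinv : ∀ p, f ∘ₗ balancing n lam mu p = f := by
    rintro ⟨σ, τ⟩
    obtain rfl : τ = 1 := Subsingleton.elim _ _
    refine TensorProduct.ext' fun t z => ?_
    induction z using TensorProduct.induction_on with
    | zero => rw [TensorProduct.tmul_zero, map_zero, map_zero]
    | add x y hx hy => rw [TensorProduct.tmul_add, map_add, map_add, hx, hy]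
    | tmul s s' =>
      have h : balancing n lam mu (σ, 1) (t ⊗ₜ (s ⊗ₜ s')) =
        tracelessPermRep n lam.cells mu.cells (σ, 1) t ⊗ₜ
          (spechtRep lam σ s ⊗ₜ spechtRep mu 1 s') := rfl
      have h' : (tracelessPermRep n lam.cells mu.cells (σ, 1) t).1 =
        permRep n lam.cells mu.cells (σ, 1) t.1 := rfl
      rw [LinearMap.comp_apply, h, hf, hf, h', hperm, spechtSign_spechtRep, map_one,
        Module.End.one_apply, smul_smul]
      congr 1
      linear_combination (spechtSign lam s * spechtSign mu s') * signQ_mul_self σ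
  obtain ⟨F, hF⟩ := exists_coinvariants_lift (balancing n lam mu) f hinv
  have hF' : ∀ t, F (vMk t (colGen hlam) (colGen hmu)) =
      (spechtSign lam (colGen hlam) * spechtSign mu (colGen hmu)) • π t.1 := fun t => by
    rw [vMk, hF, hf]
  have hr : spechtSign lam (colGen hlam) * spechtSign mu (colGen hmu) ≠ 0 :=
    mul_ne_zero (spechtSign_colGen hlam) (spechtSign_colGen hmu)
  generalize spechtSign lam (colGen hlam) * spechtSign mu (colGen hmu) = r at hF' hr
  have hcomm : ∀ g v, F (vRep n lam mu g v) = ρ g (F v) := by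
    intro g v
    obtain ⟨t, rfl⟩ := exists_eq_vMk hlam hmu v
    have h : (tracelessRep n lam.cells mu.cells g t).1 = mixedRep n lam.cells mu.cells g t.1 := rfl
    rw [vRep_vMk, hF', hF', h, hg, map_smul]
  refine ⟨LinearMap.intertwiningMap_of_isIntertwiningMap _ _ F hcomm, ?_, fun e => ?_⟩
  · change Function.Injective F
    rw [injective_iff_map_eq_zero]
    intro v hv
    obtain ⟨t, rfl⟩ := exists_eq_vMk hlam hmu v
    rw [hF', smul_eq_zero_iff_right hr] at hv
    have h₁ := hA t.1
    rw [hv, map_zero] at h₁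
    have h₂ : ∑ σ, signQ _ σ • tracelessPermRep n lam.cells mu.cells (σ, 1) t = 0 := by
      refine Subtype.ext ?_
      rw [AddSubmonoidClass.coe_finsetSum]
      exact h₁.symm
    -- In the coinvariants, `σ` may be moved from `t` to the generator of the Specht module, where
    -- it acts by its sign.
    have h₃ : ∀ σ : Equiv.Perm lam.cells, vMk t (colGen hlam) (colGen hmu) =
        vMk (signQ _ σ • tracelessPermRep n lam.cells mu.cells (σ, 1) t)
          (colGen hlam) (colGen hmu) := fun σ => by
      rw [← vMk_permRep (σ, 1), spechtRep_colGen, map_one, Module.End.one_apply, vMk, vMk,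
        TensorProduct.smul_tmul, TensorProduct.tmul_smul, TensorProduct.tmul_smul,
        TensorProduct.smul_tmul']
    have h₄ : ∑ _σ : Equiv.Perm lam.cells, vMk t (colGen hlam) (colGen hmu) = 0 := by
      rw [Finset.sum_congr rfl fun σ _ => h₃ σ]
      simp only [vMk]
      rw [← map_sum, ← TensorProduct.sum_tmul, h₂, TensorProduct.zero_tmul, map_zero]
    rw [Finset.sum_const, ← Nat.cast_smul_eq_nsmul ℚ] at h₄
    exact (smul_eq_zero.mp h₄).resolve_left
      (Nat.cast_ne_zero.mpr (Finset.card_pos.mpr Finset.univ_nonempty).ne')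
  · constructor
    · rintro ⟨v, rfl⟩
      obtain ⟨t, rfl⟩ := exists_eq_vMk hlam hmu v
      change A (F _) ∈ _
      rw [hF', map_smul, hA]
      exact Submodule.smul_mem _ _ (Submodule.sum_mem _ fun σ _ =>
        Submodule.smul_mem _ _ (permRep_traceless (σ, 1) t.2))
    · intro h
      -- The factor `r⁻¹` undoes the sign functional on the generators, and `N⁻¹` undoes `π ∘ A =
      -- N`.
      refine ⟨(r⁻¹ * N⁻¹) • vMk ⟨A e, h⟩ (colGen hlam) (colGen hmu), ?_⟩
      change F _ = e
      rw [map_smul, hF', hπA, smul_smul, smul_smul]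
      field_simp
      exact one_smul _ _

end ColumnFunctor

end AlbIA

namespace AlbIA

/-! ### Projection to `⋀^p H` and antisymmetrization -/

section WedgeProjection
variable {n p : ℕ} {ι κ : Type}

/-- The projection `H^{⊗p} → ⋀^p H`, for tensor factors indexed by `ι ≃ Fin p`. -/
noncomputable def wedgeProj (n : ℕ) (e : ι ≃ Fin p) : (⨂[ℚ] _ : ι, H n) →ₗ[ℚ] ⋀[ℚ]^p (H n) :=
  PiTensorProduct.lift (exteriorPower.ιMulti ℚ p (M := H n)).toMultilinearMap ∘ₗ
    (PiTensorProduct.reindex ℚ (fun _ : ι => H n) e).toLinearMap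

/-- The antisymmetrization `⋀^p H → H^{⊗p}`, for tensor factors indexed by `ι ≃ Fin p`. -/
noncomputable def wedgeAnti (n : ℕ) (e : ι ≃ Fin p) : ⋀[ℚ]^p (H n) →ₗ[ℚ] (⨂[ℚ] _ : ι, H n) :=
  (PiTensorProduct.reindex ℚ (fun _ : Fin p => H n) e.symm).toLinearMap ∘ₗ
    exteriorPower.toTensorPower ℚ (H n) p

theorem wedgeProj_tprod (e : ι ≃ Fin p) (v : ι → H n) :
    wedgeProj n e (PiTensorProduct.tprod ℚ v) = exteriorPower.ιMulti ℚ p fun j => v (e.symm j) := by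
  rw [wedgeProj, LinearMap.comp_apply, LinearEquiv.coe_coe, PiTensorProduct.reindex_tprod,
    PiTensorProduct.lift.tprod]
  rfl

theorem wedgeAnti_ιMulti (e : ι ≃ Fin p) (v : Fin p → H n) :
    wedgeAnti n e (exteriorPower.ιMulti ℚ p v) = ∑ σ : Equiv.Perm (Fin p), signQ _ σ •
      PiTensorProduct.tprod ℚ fun a => v (σ (e a)) := by
  rw [wedgeAnti, LinearMap.comp_apply, toTensorPower_ιMulti, map_sum]
  refine Finset.sum_congr rfl fun σ _ => ?_
  rw [map_smul, LinearEquiv.coe_coe, PiTensorProduct.reindex_tprod]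
  rfl

theorem wedgeProj_map (e : ι ≃ Fin p) (g : GL (Fin n) ℚ) (v : ι → H n) :
    wedgeProj n e (PiTensorProduct.tprod ℚ fun a => stdRep n g (v a)) =
      extRep (stdRep n) p g (wedgeProj n e (PiTensorProduct.tprod ℚ v)) := by
  rw [wedgeProj_tprod, wedgeProj_tprod, extRep_ιMulti]

theorem ιMulti_perm (σ : Equiv.Perm (Fin p)) (v : Fin p → H n) :
    exteriorPower.ιMulti ℚ p (fun j => v (σ j)) = signQ _ σ • exteriorPower.ιMulti ℚ p v := by
  have := AlternatingMap.map_perm (exteriorPower.ιMulti ℚ p (M := H n)) v σ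
  refine this.trans ?_
  rw [signQ_apply, Units.smul_def]
  exact (Int.cast_smul_eq_zsmul ℚ _ _).symm

theorem wedgeProj_wedgeAnti (e : ι ≃ Fin p) (w : ⋀[ℚ]^p (H n)) :
    wedgeProj n e (wedgeAnti n e w) = (p.factorial : ℚ) • w := by
  have h : wedgeProj n e ∘ₗ wedgeAnti n e = (p.factorial : ℚ) • LinearMap.id := by
    refine exteriorPower_hom_ext fun v => ?_
    rw [LinearMap.comp_apply, wedgeAnti_ιMulti, map_sum, LinearMap.smul_apply, LinearMap.id_apply]
    have : ∀ σ : Equiv.Perm (Fin p), wedgeProj n e (signQ _ σ •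
        PiTensorProduct.tprod ℚ fun a => v (σ (e a))) = exteriorPower.ιMulti ℚ p v := fun σ => by
      rw [map_smul, wedgeProj_tprod]
      simp only [Equiv.apply_symm_apply]
      rw [ιMulti_perm, smul_smul, signQ_mul_self, one_smul]
    rw [Finset.sum_congr rfl fun σ _ => this σ, Finset.sum_const, Finset.card_univ,
      Fintype.card_perm, Fintype.card_fin, Nat.cast_smul_eq_nsmul]
  exact LinearMap.congr_fun h w

variable [Fintype ι] [DecidableEq ι]

theorem signQ_permCongr (e : ι ≃ Fin p) (σ : Equiv.Perm ι) :
    signQ _ (e.permCongr σ) = signQ _ σ := by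
  rw [signQ_apply, signQ_apply, Equiv.Perm.sign_permCongr]

theorem signQ_inv (σ : Equiv.Perm ι) : signQ _ σ⁻¹ = signQ _ σ := by
  rw [signQ_apply, signQ_apply, Equiv.Perm.sign_inv]

theorem wedgeProj_perm (e : ι ≃ Fin p) (σ : Equiv.Perm ι) (v : ι → H n) :
    wedgeProj n e (PiTensorProduct.tprod ℚ fun a => v (σ⁻¹ a)) =
      signQ _ σ • wedgeProj n e (PiTensorProduct.tprod ℚ v) := by
  rw [wedgeProj_tprod, wedgeProj_tprod, ← signQ_inv, ← signQ_permCongr e, ← ιMulti_perm]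
  simp [Equiv.permCongr_apply]

theorem wedgeAnti_wedgeProj (e : ι ≃ Fin p) (v : ι → H n) :
    wedgeAnti n e (wedgeProj n e (PiTensorProduct.tprod ℚ v)) =
      ∑ σ : Equiv.Perm ι, signQ _ σ • PiTensorProduct.tprod ℚ fun a => v (σ⁻¹ a) := by
  -- Permutations of `Fin p` are matched with inverses of permutations of `ι`, transported along
  -- `e`; signs are unaffected.
  rw [wedgeProj_tprod, wedgeAnti_ιMulti, ← Equiv.sum_comp ((Equiv.inv _).trans e.permCongr)]
  refine Finset.sum_congr rfl fun σ _ => ?_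
  rw [Equiv.trans_apply, Equiv.inv_apply, signQ_permCongr, signQ_inv]
  simp [Equiv.permCongr_apply]

end WedgeProjection

/-! ### The model `⋀^p H`, without dual factors -/

section WedgeModel
variable {n p : ℕ} {ι κ : Type} [IsEmpty κ]

/-- The projection `H^{⊗p} ⊗ (H^*)^{⊗0} → ⋀^p H`. -/
noncomputable def mixedToWedge (n : ℕ) (κ : Type) [IsEmpty κ] (e : ι ≃ Fin p) :
    MixedTensor n ι κ →ₗ[ℚ] ⋀[ℚ]^p (H n) :=
  (TensorProduct.rid ℚ _).toLinearMap ∘ₗ TensorProduct.map (wedgeProj n e)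
    (PiTensorProduct.isEmptyEquiv (R := ℚ) (s := fun _ : κ => Module.Dual ℚ (H n)) κ).toLinearMap

theorem mixedToWedge_tprod (e : ι ≃ Fin p) (v : ι → H n) (f : κ → Module.Dual ℚ (H n)) :
    mixedToWedge n κ e (PiTensorProduct.tprod ℚ v ⊗ₜ PiTensorProduct.tprod ℚ f) =
      wedgeProj n e (PiTensorProduct.tprod ℚ v) := by
  simp [mixedToWedge]

/-- The antisymmetrization `⋀^p H → H^{⊗p} ⊗ (H^*)^{⊗0}`. -/
noncomputable def wedgeToMixed (n : ℕ) (κ : Type) [IsEmpty κ] (e : ι ≃ Fin p) :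
    ⋀[ℚ]^p (H n) →ₗ[ℚ] MixedTensor n ι κ :=
  (TensorProduct.mk ℚ _ _).flip (PiTensorProduct.tprod ℚ fun _ => 0) ∘ₗ wedgeAnti n e

theorem wedgeToMixed_apply (e : ι ≃ Fin p) (w : ⋀[ℚ]^p (H n)) (f : κ → Module.Dual ℚ (H n)) :
    wedgeToMixed n κ e w = wedgeAnti n e w ⊗ₜ PiTensorProduct.tprod ℚ f := by
  rw [Subsingleton.elim f fun _ => 0]
  rfl

theorem mixedToWedge_mixedRep (e : ι ≃ Fin p) (g : GL (Fin n) ℚ) (x : MixedTensor n ι κ) :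
    mixedToWedge n κ e (mixedRep n ι κ g x) =
      extRep (stdRep n) p g (mixedToWedge n κ e x) := by
  have h : mixedToWedge n κ e ∘ₗ mixedRep n ι κ g =
      extRep (stdRep n) p g ∘ₗ mixedToWedge n κ e := mixed_ext fun v f => by
    rw [LinearMap.comp_apply, LinearMap.comp_apply, mixedRep_tprod, mixedToWedge_tprod,
      mixedToWedge_tprod, wedgeProj_map]
  exact LinearMap.congr_fun h x

theorem mixedToWedge_wedgeToMixed (e : ι ≃ Fin p) (w : ⋀[ℚ]^p (H n)) :
    mixedToWedge n κ e (wedgeToMixed n κ e w) = (p.factorial : ℚ) • w := by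
  rw [wedgeToMixed_apply e w fun _ => 0, mixedToWedge, LinearMap.comp_apply,
    TensorProduct.map_tmul, wedgeProj_wedgeAnti]
  simp

variable [Fintype ι] [DecidableEq ι]

theorem mixedToWedge_permRep (e : ι ≃ Fin p) (σ : Equiv.Perm ι) (x : MixedTensor n ι κ) :
    mixedToWedge n κ e (permRep n ι κ (σ, 1) x) = signQ _ σ • mixedToWedge n κ e x := by
  have h : mixedToWedge n κ e ∘ₗ permRep n ι κ (σ, 1) = signQ _ σ • mixedToWedge n κ e :=
    mixed_ext fun v f => by
      rw [LinearMap.comp_apply, LinearMap.smul_apply, permRep_tprod, mixedToWedge_tprod,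
        mixedToWedge_tprod, wedgeProj_perm]
  exact LinearMap.congr_fun h x

theorem wedgeToMixed_mixedToWedge (e : ι ≃ Fin p) (x : MixedTensor n ι κ) :
    wedgeToMixed n κ e (mixedToWedge n κ e x) =
      ∑ σ, signQ _ σ • permRep n ι κ (σ, 1) x := by
  have h : wedgeToMixed n κ e ∘ₗ mixedToWedge n κ e = ∑ σ, signQ _ σ • permRep n ι κ (σ, 1) :=
    mixed_ext fun v f => by
      rw [LinearMap.comp_apply, mixedToWedge_tprod, wedgeToMixed_apply e _ f, wedgeAnti_wedgeProj,
        LinearMap.sum_apply, TensorProduct.sum_tmul]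
      refine Finset.sum_congr rfl fun σ _ => ?_
      rw [LinearMap.smul_apply, permRep_tprod, TensorProduct.smul_tmul']
      rfl
  rw [← LinearMap.comp_apply, h, LinearMap.sum_apply]
  rfl

end WedgeModel

/-! ### The model `U_i`, with one dual factor -/

section TreeModel
variable {n i : ℕ} {ι κ : Type}

variable (κ) in
/-- The antisymmetrization `U_i → H^{⊗(i+1)} ⊗ H^*`. -/
noncomputable def uToMixed (n : ℕ) (e : ι ≃ Fin (i + 1)) : U n i →ₗ[ℚ] MixedTensor n ι κ :=
  ∑ k, (TensorProduct.mk ℚ _ _).flip (PiTensorProduct.tprod ℚ fun _ => dualE k) ∘ₗ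
    wedgeAnti n e ∘ₗ LinearMap.applyₗ (stdE k)

theorem uToMixed_apply (e : ι ≃ Fin (i + 1)) (u : U n i) : uToMixed κ n e u =
    ∑ k, wedgeAnti n e (u (stdE k)) ⊗ₜ PiTensorProduct.tprod ℚ fun _ : κ => dualE k := by
  rw [uToMixed, LinearMap.sum_apply]
  rfl

variable [Subsingleton κ]

/-- The projection `H^{⊗(i+1)} ⊗ H^* → U_i`. -/
noncomputable def mixedToU (n : ℕ) (e : ι ≃ Fin (i + 1)) (b : κ) : MixedTensor n ι κ →ₗ[ℚ] U n i :=
  dualTensorHom ℚ (H n) (⋀[ℚ]^(i + 1) (H n)) ∘ₗ (TensorProduct.comm ℚ _ _).toLinearMap ∘ₗ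
    TensorProduct.map (wedgeProj n e)
      (PiTensorProduct.subsingletonEquiv (R := ℚ) (s := fun _ : κ => Module.Dual ℚ (H n)) b).toLinearMap

theorem mixedToU_tmul (e : ι ≃ Fin (i + 1)) (b : κ) (t : ⨂[ℚ] _ : ι, H n)
    (f : κ → Module.Dual ℚ (H n)) : mixedToU n e b (t ⊗ₜ PiTensorProduct.tprod ℚ f) =
      (f b).smulRight (wedgeProj n e t) := by
  refine LinearMap.ext fun v => ?_
  simp only [mixedToU, LinearMap.comp_apply, TensorProduct.map_tmul, LinearEquiv.coe_coe,
    TensorProduct.comm_tmul, PiTensorProduct.subsingletonEquiv_apply_tprod]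
  rfl

theorem uToMixed_smulRight (e : ι ≃ Fin (i + 1)) (b : κ) (f : κ → Module.Dual ℚ (H n))
    (w : ⋀[ℚ]^(i + 1) (H n)) : uToMixed κ n e ((f b).smulRight w) =
      wedgeAnti n e w ⊗ₜ PiTensorProduct.tprod ℚ f := by
  let T := (PiTensorProduct.subsingletonEquiv (R := ℚ) (s := fun _ : κ => Module.Dual ℚ (H n)) b).symm
  have hT : ∀ ξ, PiTensorProduct.tprod ℚ (fun _ : κ => ξ) = T ξ := fun ξ =>
    (PiTensorProduct.subsingletonEquiv_symm_apply' b ξ).symm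
  have hf : f = fun _ => f b := funext fun c => by rw [Subsingleton.elim c b]
  rw [uToMixed_apply, hf, hT, sum_dualE_smul (f b), map_sum, TensorProduct.tmul_sum]
  refine Finset.sum_congr rfl fun k _ => ?_
  rw [← sum_dualE_smul (f b), hT, LinearMap.smulRight_apply, map_smul, map_smul,
    TensorProduct.smul_tmul]

theorem mixedToU_mixedRep (e : ι ≃ Fin (i + 1)) (b : κ) (g : GL (Fin n) ℚ)
    (x : MixedTensor n ι κ) :
    mixedToU n e b (mixedRep n ι κ g x) = uRep n i g (mixedToU n e b x) := by
  have h : mixedToU n e b ∘ₗ mixedRep n ι κ g = uRep n i g ∘ₗ mixedToU n e b :=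
    mixed_ext fun v f => by
      rw [LinearMap.comp_apply, LinearMap.comp_apply, mixedRep_tprod, mixedToU_tmul,
        mixedToU_tmul, wedgeProj_map, uRep_smulRight]
      rfl
  exact LinearMap.congr_fun h x

theorem mixedToU_uToMixed (e : ι ≃ Fin (i + 1)) (b : κ) (u : U n i) :
    mixedToU n e b (uToMixed κ n e u) = ((i + 1).factorial : ℚ) • u := by
  rw [uToMixed_apply, map_sum]
  refine (Pi.basisFun ℚ (Fin n)).ext fun l => ?_
  rw [Pi.basisFun_apply, LinearMap.sum_apply, Finset.sum_eq_single l]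
  · rw [mixedToU_tmul, LinearMap.smulRight_apply, wedgeProj_wedgeAnti]
    simp [dualE]
  · intro k _ hk
    rw [mixedToU_tmul, LinearMap.smulRight_apply]
    simp [dualE, hk]
  · simp

variable [Fintype ι] [DecidableEq ι]

theorem mixedToU_permRep (e : ι ≃ Fin (i + 1)) (b : κ) (σ : Equiv.Perm ι)
    (x : MixedTensor n ι κ) :
    mixedToU n e b (permRep n ι κ (σ, 1) x) = signQ _ σ • mixedToU n e b x := by
  have h : mixedToU n e b ∘ₗ permRep n ι κ (σ, 1) = signQ _ σ • mixedToU n e b :=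
    mixed_ext fun v f => by
      rw [LinearMap.comp_apply, LinearMap.smul_apply, permRep_tprod, mixedToU_tmul,
        mixedToU_tmul, wedgeProj_perm]
      refine LinearMap.ext fun v => ?_
      exact smul_comm _ _ _
  exact LinearMap.congr_fun h x

theorem uToMixed_mixedToU (e : ι ≃ Fin (i + 1)) (b : κ) (x : MixedTensor n ι κ) :
    uToMixed κ n e (mixedToU n e b x) = ∑ σ, signQ _ σ • permRep n ι κ (σ, 1) x := by
  have h : uToMixed κ n e ∘ₗ mixedToU n e b = ∑ σ, signQ _ σ • permRep n ι κ (σ, 1) :=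
    mixed_ext fun v f => by
      rw [LinearMap.comp_apply, mixedToU_tmul, uToMixed_smulRight, wedgeAnti_wedgeProj,
        LinearMap.sum_apply, TensorProduct.sum_tmul]
      refine Finset.sum_congr rfl fun σ _ => ?_
      rw [LinearMap.smul_apply, permRep_tprod, TensorProduct.smul_tmul']
      rfl
  rw [← LinearMap.comp_apply, h, LinearMap.sum_apply]
  rfl

end TreeModel

/-! ### Traceless tensors and the contraction of `U_i` -/

section TreeTrace
variable {n i : ℕ} {ι κ : Type} [Subsingleton κ] [DecidableEq ι]

/-- The numbering of the tensor factors other than the one with number `m`. -/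
def omitEquiv {i : ℕ} {ι : Type} (e : ι ≃ Fin (i + 1)) (m : Fin (i + 1)) : {a // a ≠ e.symm m} ≃ Fin i :=
  (e.subtypeEquiv (q := fun j => j ≠ m) fun _ => (Equiv.eq_symm_apply e).not).trans
    (finSuccAboveEquiv m).symm

/-- The projection `U_i → ⋀^i H` in terms of contractions of mixed tensors. -/
theorem traceMap_mixedToU (e : ι ≃ Fin (i + 1)) (b : κ) [DecidableEq κ] [IsEmpty {c : κ // c ≠ b}]
    (x : MixedTensor n ι κ) :
    traceMap n i (mixedToU n e b x) = ∑ m : Fin (i + 1), (-1 : ℚ) ^ (m : ℕ) •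
      mixedToWedge n {c : κ // c ≠ b} (omitEquiv e m) (contract n ι κ (e.symm m) b x) := by
  have h : traceMap n i ∘ₗ mixedToU n e b = ∑ m : Fin (i + 1), (-1 : ℚ) ^ (m : ℕ) •
      mixedToWedge n {c : κ // c ≠ b} (omitEquiv e m) ∘ₗ contract n ι κ (e.symm m) b :=
    mixed_ext fun v f => by
      rw [LinearMap.comp_apply, mixedToU_tmul, traceMap_smulRight, wedgeProj_tprod,
        interior_ιMulti, LinearMap.sum_apply]
      refine Finset.sum_congr rfl fun m _ => ?_
      rw [LinearMap.smul_apply, LinearMap.comp_apply, contract_tprod, map_smul,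
        mixedToWedge_tprod, wedgeProj_tprod, neg_one_pow_zsmul]
      rfl
  rw [← LinearMap.comp_apply, h, LinearMap.sum_apply]
  rfl

/-- The contraction of `U_i` is a signed sum of contractions of mixed tensors; it is applied to
`uToMixed u`, which projects back to `(i + 1)! u`. -/
theorem traceMap_eq_zero_of_traceless (e : ι ≃ Fin (i + 1)) (b : κ) [DecidableEq κ] {u : U n i}
    (hu : uToMixed κ n e u ∈ traceless n ι κ) : traceMap n i u = 0 := by
  have : IsEmpty {c : κ // c ≠ b} := ⟨fun c => c.2 (Subsingleton.elim _ _)⟩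
  have h := traceMap_mixedToU e b (uToMixed κ n e u)
  rw [mixedToU_uToMixed, map_smul, Finset.sum_eq_zero] at h
  · exact (smul_eq_zero.mp h).resolve_left (Nat.cast_ne_zero.mpr (Nat.factorial_ne_zero _))
  · intro m _
    rw [mem_traceless.mp hu, map_zero, smul_zero]

variable [Fintype ι]

/-- The underlying pure tensor has no pairing of `e_k^*` with its factors, hence is traceless, and
antisymmetrization preserves tracelessness. -/
theorem uToMixed_eU_mem (e : ι ≃ Fin (i + 1)) (b : κ) [DecidableEq κ] {c : Fin (i + 1) → Fin n}
    {k : Fin n} (hk : ∀ j, c j ≠ k) : uToMixed κ n e (eU c k) ∈ traceless n ι κ := by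
  have h : eU c k = mixedToU n e b (PiTensorProduct.tprod ℚ (fun a => stdE (c (e a))) ⊗ₜ
      PiTensorProduct.tprod ℚ fun _ => dualE k) := by
    rw [mixedToU_tmul, wedgeProj_tprod]
    simp only [Equiv.apply_symm_apply]
    rfl
  rw [h, uToMixed_mixedToU]
  refine Submodule.sum_mem _ fun σ _ => Submodule.smul_mem _ _ (permRep_traceless (σ, 1) ?_)
  refine mem_traceless.mpr fun a d => ?_
  have h₀ : dualE k (stdE (c (e a)) : H n) = 0 := by simp [dualE, hk]
  rw [contract_tprod, h₀, zero_smul]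

end TreeTrace

/-! ### Identification of the tree part and of the wheel part -/

section Columns
variable {n i : ℕ}

theorem mem_column {p : ℕ} {c : ℕ × ℕ} : c ∈ column p ↔ c.1 < p ∧ c.2 = 0 := by
  rw [column, YoungDiagram.mem_ofRowLens]
  simp

theorem column_snd {p : ℕ} (c d : (column p).cells) : c.1.2 = d.1.2 := by
  rw [(mem_column.mp c.2).2, (mem_column.mp d.2).2]

/-- The boxes of a column. -/
def columnEquiv (p : ℕ) : (column p).cells ≃ Fin p where
  toFun c := ⟨c.1.1, (mem_column.mp c.2).1⟩
  invFun j := ⟨(j, 0), mem_column.mpr ⟨j.2, rfl⟩⟩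
  left_inv c := Subtype.ext (Prod.ext rfl (mem_column.mp c.2).2.symm)
  right_inv _ := rfl

/-- The image lies in the kernel of the trace. Conversely it is stable and, when `n ≥ i + 2`,
contains a traceless monomial, so `treePart_le` gives equality. -/
theorem exists_tree_intertwiner [NeZero i] (hn : i + 1 ≤ n) :
    ∃ a : (vRep n (column (i + 1)) (column 1)).IntertwiningMap (uRep n i),
      Function.Injective a ∧ LinearMap.range a.toLinearMap = treePart n i := by
  have : Subsingleton (column 1).cells := (columnEquiv 1).subsingleton
  let e := columnEquiv (i + 1)
  let b := (columnEquiv 1).symm 0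
  obtain ⟨a, ha, hr⟩ := exists_vRep_intertwiner (lam := column (i + 1)) (mu := column 1)
    column_snd (uRep n i) (mixedToU n e b) (uToMixed _ n e) (mixedToU_mixedRep e b)
    (mixedToU_permRep e b) (uToMixed_mixedToU e b)
    (Nat.cast_ne_zero.mpr (Nat.factorial_ne_zero (i + 1))) (mixedToU_uToMixed e b)
  refine ⟨a, ha, le_antisymm (fun u hu => ?_) (treePart_le hn _ ?_ fun hn' => ?_)⟩
  · exact traceMap_eq_zero_of_traceless e b ((hr u).mp hu)
  · rintro g _ ⟨v, rfl⟩
    exact ⟨_, LinearMap.congr_fun (a.isIntertwining' g) v⟩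
  -- The monomial is `(e_1 ∧ … ∧ e_{i+1}) ⊗ e_{i+2}^*`.
  · refine ⟨fun j => ⟨j, by omega⟩, ⟨i + 1, hn'⟩, fun j l h => ?_, fun j h => ?_, ?_⟩
    · exact Fin.ext (Fin.mk.inj_iff.mp h)
    · exact j.2.ne (Fin.mk.inj_iff.mp h)
    · refine (hr _).mpr (uToMixed_eU_mem e b fun j h => ?_)
      exact j.2.ne (Fin.mk.inj_iff.mp h)

theorem exists_wheel_intertwiner [NeZero i] (hn : i + 1 ≤ n) :
    ∃ b : (vRep n (column i) ⊥).IntertwiningMap (uRep n i),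
      Function.Injective b ∧ LinearMap.range b.toLinearMap = wheelPart n i := by
  have : IsEmpty (⊥ : YoungDiagram).cells := ⟨fun c => Finset.notMem_empty _ c.2⟩
  let e := columnEquiv i
  obtain ⟨a, ha, hr⟩ := exists_vRep_intertwiner (lam := column i) (mu := ⊥)
    column_snd (extRep (stdRep n) i) (mixedToWedge n _ e) (wedgeToMixed n _ e)
    (mixedToWedge_mixedRep e) (mixedToWedge_permRep e) (wedgeToMixed_mixedToWedge e)
    (Nat.cast_ne_zero.mpr (Nat.factorial_ne_zero i)) (mixedToWedge_wedgeToMixed e)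
  -- Without dual factors there is nothing to contract, so every tensor is traceless and the map
  -- reaches all of `⋀^i H`.
  have hsurj : LinearMap.range a.toLinearMap = ⊤ := by
    rw [eq_top_iff]
    intro w _
    exact (hr w).mpr (mem_traceless.mpr fun _ l => isEmptyElim l)
  have hcomm : ∀ g v, (wheelIncl n i ∘ₗ a.toLinearMap) (vRep n (column i) ⊥ g v) =
      uRep n i g ((wheelIncl n i ∘ₗ a.toLinearMap) v) := fun g v => by
    rw [LinearMap.comp_apply, LinearMap.comp_apply, uRep_wheelIncl]
    exact congrArg _ (LinearMap.congr_fun (a.isIntertwining' g) v)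
  refine ⟨LinearMap.intertwiningMap_of_isIntertwiningMap _ _ _ hcomm,
    (wheelIncl_injective hn).comp ha, ?_⟩
  change LinearMap.range (wheelIncl n i ∘ₗ a.toLinearMap) = _
  rw [LinearMap.range_comp, hsurj, Submodule.map_top]
  rfl

end Columns

end AlbIA

/-! ### Assembly of the decomposition of `U_i` and of the theorem -/

namespace AlbIA

theorem nonempty_equiv_prod {G E W₁ W₂ : Type} [Group G] [AddCommGroup E] [Module ℚ E]
    [AddCommMonoid W₁] [Module ℚ W₁] [AddCommMonoid W₂] [Module ℚ W₂]
    (ρ : Representation ℚ G E) (σ₁ : Representation ℚ G W₁) (σ₂ : Representation ℚ G W₂)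
    (b : σ₁.IntertwiningMap ρ) (a : σ₂.IntertwiningMap ρ) (hb : Function.Injective b)
    (ha : Function.Injective a)
    (h : IsCompl (LinearMap.range a.toLinearMap) (LinearMap.range b.toLinearMap)) :
    Nonempty (ρ.Equiv (σ₁.prod σ₂)) := by
  let e : (W₁ × W₂) ≃ₗ[ℚ] E :=
    ((LinearEquiv.ofInjective b.toLinearMap hb).prodCongr
      (LinearEquiv.ofInjective a.toLinearMap ha)).trans (Submodule.prodEquivOfIsCompl _ _ h.symm)
  have he : ∀ x, e x = b x.1 + a x.2 := fun x => rfl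
  refine ⟨Representation.Equiv.mk e.symm fun g => LinearMap.ext fun x => ?_⟩
  obtain ⟨y, rfl⟩ := e.surjective x
  have h₁ : ρ g (e y) = e (σ₁.prod σ₂ g y) := by
    rw [he, he, map_add]
    exact congrArg₂ _ (LinearMap.congr_fun (b.isIntertwining' g) y.1).symm
      (LinearMap.congr_fun (a.isIntertwining' g) y.2).symm
  simp only [LinearMap.comp_apply, LinearEquiv.coe_coe, h₁, LinearEquiv.symm_apply_apply]

theorem nonempty_uRep_equiv {n i : ℕ} [NeZero i] (hn : i + 1 ≤ n) :
    Nonempty ((uRep n i).Equiv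
      ((vRep n (column i) ⊥).prod (vRep n (column (i + 1)) (column 1)))) := by
  obtain ⟨a, ha, hra⟩ := exists_tree_intertwiner hn
  obtain ⟨b, hb, hrb⟩ := exists_wheel_intertwiner hn
  have h := isCompl_treePart_wheelPart hn
  rw [← hra, ← hrb] at h
  have h₁ := @nonempty_equiv_prod (GL (Fin n) ℚ) (U n i) _ _ _ _ _ _ _ _ _ (uRep n i) _ _ b a
  have h₂ := h₁ hb ha
  exact h₂ h

end AlbIA

theorem theorem4p2 (i n : ℕ) [NeZero i] (hn : i + 1 ≤ n) :
    (∃ ρ : Representation ℚ (GL (Fin n) ℚ) (AlbIA.AlbaneseHomology (AlbIA.IA n) i),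
      AlbIA.IsAlbaneseAction n i ρ ∧
        ∃ s : (AlbIA.uRep n i).IntertwiningMap ρ, Function.Injective s) ∧
    Nonempty ((AlbIA.uRep n i).Equiv
      ((AlbIA.vRep n (AlbIA.column i) ⊥).prod
        (AlbIA.vRep n (AlbIA.column (i + 1)) (AlbIA.column 1)))) ∧
    (∃ hc : IsCompl (AlbIA.treePart n i) (AlbIA.wheelPart n i),
      (∃ a : (AlbIA.vRep n (AlbIA.column (i + 1)) (AlbIA.column 1)).IntertwiningMap
          (AlbIA.uRep n i),
        Function.Injective a ∧ LinearMap.range a.toLinearMap = AlbIA.treePart n i) ∧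
      (∃ b : (AlbIA.vRep n (AlbIA.column i) ⊥).IntertwiningMap (AlbIA.uRep n i),
        Function.Injective b ∧ LinearMap.range b.toLinearMap = AlbIA.wheelPart n i) ∧
      (∀ ρ : Representation ℚ (GL (Fin n) ℚ) (AlbIA.AlbaneseHomology (AlbIA.IA n) i),
        AlbIA.IsAlbaneseAction n i ρ →
          ∃ f : ρ.IntertwiningMap (AlbIA.uRep n i), Function.Surjective f ∧
            ∀ x, f x =
              AlbIA.wheelIncl n i
                  (AlbIA.cWheel n i (AlbIA.iota n i (AlbIA.albToWedge n i x))) +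
                AlbIA.cTree n i hc (AlbIA.iota n i (AlbIA.albToWedge n i x))) ∧
      AlbIA.cWheel n i
        (AlbIA.iota n i (AlbIA.albToWedge n i (AlbIA.alphaAlb n i hn))) ≠ 0 ∧
      (i + 2 ≤ n → AlbIA.cTree n i hc
        (AlbIA.iota n i (AlbIA.albToWedge n i (AlbIA.alphaAlb n i hn))) ≠ 0)) ∧
    Nontrivial (AlbIA.AlbaneseHomology (AlbIA.IA n) i) := by
  refine ⟨?_, AlbIA.nonempty_uRep_equiv hn, ?_, AlbIA.nontrivial_albaneseHomology hn⟩
  · exact AlbIA.exists_albaneseAction hn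
  · have hc := AlbIA.isCompl_treePart_wheelPart hn
    refine Exists.intro hc ?_
    refine And.intro (AlbIA.exists_tree_intertwiner hn) ?_
    refine And.intro (AlbIA.exists_wheel_intertwiner hn) ?_
    refine And.intro (AlbIA.exists_comparison hn hc) ?_
    exact And.intro (AlbIA.cWheel_alpha_ne_zero hn) (AlbIA.cTree_alpha_ne_zero hn hc)
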